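/- Let $\mathfrak g$ be a six-dimensional real nilpotent Lie algebra. A \emph{pseudo-Kähler pair} on $\mathfrak g$ is a pair $(J,\Omega)$ of an integrable complex structure $J$ on $\mathfrak g$ (a linear map with $J^2=-1$ and $[x,y]+J[Jx,y]+J[x,Jy]-[Jx,Jy]=0$) and a symplectic form $\Omega$ on $\mathfrak g$ (a closed nondegenerate alternating $2$-form) of type $(1,1)$, i.e. $\Omega(Jx,Jy)=\Omega(x,y)$. Given $J$, let $\mathfrak g^{(1,0)},\mathfrak g^{(0,1)}\subset\mathfrak g_{\mathbb C}$ be its $\pm i$-eigenspaces and let $\mathfrak g^{*(0,1)}$ be the space of complex linear forms vanishing on $\mathfrak g^{(1,0)}$. Let $\mathrm{DGA}(\mathfrak g,J)$ be the exterior algebra of $\mathfrak f^1=\mathfrak g^{(1,0)}\oplus\mathfrak g^{*(0,1)}$ with the Schouten extension of the Courant bracket $[x+\alpha\bullet y+\beta]=[x,y]+\iota_xd\beta-\iota_yd\alpha$ (where $d\alpha(x,y)=-\alpha([x,y])$) and with the differential $\overline\partial$, the Chevalley–Eilenberg differential of the conjugate algebra $\overline{\mathfrak f}^1=\mathfrak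 g^{(0,1)}\oplus\mathfrak g^{*(1,0)}\cong(\mathfrak f^1)^*$. Given $\Omega$, let $\mathrm{DGA}(\mathfrak g,\Omega)$ be the exterior algebra of $\mathfrak g^*_{\mathbb C}$ with the Schouten extension of the bracket transported from $\mathfrak g_{\mathbb C}$ to $\mathfrak g^*_{\mathbb C}$ by the isomorphism $x\mapsto\iota_x\Omega$, and with the Chevalley–Eilenberg differential $d$. A quasi-isomorphism is a homomorphism of graded complex algebras that commutes with the brackets and the differentials and induces an isomorphism on cohomology. Then $\mathfrak g$ admits a pseudo-Kähler pair $(J,\Omega)$ for which there is a quasi-isomorphism $\mathrm{DGA}(\mathfrak g,J)\to\mathrm{DGA}(\mathfrak g,\Omega)$ if and only if $\mathfrak g$ is isomorphic to one of $$\mathfrak h_1=(0,0,0,0,0,0),\quad \mathfrak h_6=(0,0,0,0,12,13),\quad \mathfrak h_8=(0,0,0,0,0,12),$$ $$\mathfrak h_9=(0,0,0,0,12,14+25),\quad \mathfrak h_{10}=(0,0,0,12,13,14),$$ where $(de^1,\dots,de^6)$ lists the differentials of a basis $e^1,\dots,e^6$ of $\mathfrak g^*$ and $ij$ stands for $e^i\wedge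 e^j$. -/

import Mathlib

open scoped TensorProduct

noncomputable section

namespace WeakSelfMirror

/-! ### Differential Gerstenhaber algebras on exterior algebras -/

section Exterior

variable {V : Type*} [AddCommGroup V] [Module ℂ V]

theorem involute_ι (v : V) :
    CliffordAlgebra.involute (ExteriorAlgebra.ι ℂ v) = -ExteriorAlgebra.ι ℂ v :=
  CliffordAlgebra.involute_ι v

theorem involute_of_mem {q : ℕ} {b : ExteriorAlgebra ℂ V} (hb : b ∈ ⋀[ℂ]^q V) :
    CliffordAlgebra.involute b = (-1 : ℂ) ^ q • b := by
  induction hb using Submodule.pow_induction_on_left' with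
  | algebraMap r => simp
  | add x y i hx hy h1 h2 => rw [map_add, h1, h2, smul_add]
  | mem_mul m hm i x hx h =>
    obtain ⟨v, rfl⟩ := hm
    rw [map_mul, h, involute_ι, pow_succ]
    simp

theorem ι_mul_eq_involute_mul_ι (v : V) (b : ExteriorAlgebra ℂ V) :
    ExteriorAlgebra.ι ℂ v * b = CliffordAlgebra.involute b * ExteriorAlgebra.ι ℂ v := by
  induction b using ExteriorAlgebra.induction with
  | algebraMap r => simp [Algebra.commutes]
  | ι x =>
    rw [involute_ι, neg_mul]
    exact eq_neg_of_add_eq_zero_left (ExteriorAlgebra.ι_add_mul_swap (R := ℂ) v x)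
  | mul a b ha hb => rw [← mul_assoc, ha, mul_assoc, hb, map_mul, mul_assoc]
  | add a b ha hb => rw [mul_add, ha, hb, map_add, add_mul]

theorem mul_comm_of_mem {p q : ℕ} {a b : ExteriorAlgebra ℂ V} (ha : a ∈ ⋀[ℂ]^p V)
    (hb : b ∈ ⋀[ℂ]^q V) : a * b = (-1 : ℂ) ^ (p * q) • (b * a) := by
  have inv := involute_of_mem hb
  induction ha using Submodule.pow_induction_on_left' with
  | algebraMap r => simp [Algebra.commutes]
  | add x y i hx hy h1 h2 => rw [add_mul, h1, h2, mul_add, smul_add]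
  | mem_mul m hm i x hx h =>
    obtain ⟨v, rfl⟩ := hm
    rw [mul_assoc, h, mul_smul_comm, ← mul_assoc, ι_mul_eq_involute_mul_ι, inv, Nat.succ_mul,
      pow_add]
    simp only [smul_mul_assoc, smul_smul, mul_assoc]

theorem contractLeft_mul (d : Module.Dual ℂ V) (a b : ExteriorAlgebra ℂ V) :
    CliffordAlgebra.contractLeft d (a * b) = CliffordAlgebra.contractLeft d a * b +
      CliffordAlgebra.involute a * CliffordAlgebra.contractLeft d b := by
  induction a using ExteriorAlgebra.induction generalizing b with
  | algebraMap r =>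
    erw [CliffordAlgebra.contractLeft_algebraMap_mul, CliffordAlgebra.contractLeft_algebraMap]
    simp
  | ι x =>
    erw [CliffordAlgebra.contractLeft_ι_mul, CliffordAlgebra.contractLeft_ι,
      CliffordAlgebra.involute_ι]
    rw [← Algebra.smul_def, neg_mul, sub_eq_add_neg]
  | mul x y hx hy =>
    rw [mul_assoc, hx, hy, hx, map_mul]
    simp only [mul_add, add_mul, mul_assoc, add_assoc]
  | add x y hx hy => simp only [add_mul, map_add, hx, hy]; abel

theorem contractLeft_mem (d : Module.Dual ℂ V) {n : ℕ} {a : ExteriorAlgebra ℂ V}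
    (ha : a ∈ ⋀[ℂ]^n V) : (n = 0 → CliffordAlgebra.contractLeft d a = 0) ∧
      ∀ p, n = p + 1 → CliffordAlgebra.contractLeft d a ∈ ⋀[ℂ]^p V := by
  induction ha using Submodule.pow_induction_on_left' with
  | algebraMap r => exact ⟨fun _ => CliffordAlgebra.contractLeft_algebraMap _ d r, by simp⟩
  | add x y i hx hy h1 h2 =>
    refine ⟨fun h => ?_, fun p hp => ?_⟩
    · rw [map_add, h1.1 h, h2.1 h, add_zero]
    · rw [map_add]; exact add_mem (h1.2 p hp) (h2.2 p hp)
  | mem_mul m hm i x hx h =>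
    obtain ⟨v, rfl⟩ := hm
    refine ⟨fun h => by simp at h, fun p hp => ?_⟩
    obtain rfl : i = p := Nat.succ.inj hp
    have e : CliffordAlgebra.contractLeft d (ExteriorAlgebra.ι ℂ v * x) =
        d v • x - ExteriorAlgebra.ι ℂ v * CliffordAlgebra.contractLeft d x :=
      CliffordAlgebra.contractLeft_ι_mul d v x
    rw [e]
    refine sub_mem (Submodule.smul_mem _ _ hx) ?_
    rcases i with _ | j
    · rw [h.1 rfl, mul_zero]; exact zero_mem _
    · rw [ExteriorAlgebra.exteriorPower, pow_succ']
      exact Submodule.mul_mem_mul (LinearMap.mem_range_self _ v) (h.2 j rfl)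

theorem contractRight_of_mem (d : Module.Dual ℂ V) {p : ℕ} {a : ExteriorAlgebra ℂ V}
    (ha : a ∈ ⋀[ℂ]^p V) : CliffordAlgebra.contractRight a d =
      -((-1 : ℂ) ^ p • CliffordAlgebra.contractLeft d a) := by
  induction ha using Submodule.pow_induction_on_right' with
  | algebraMap r =>
    erw [CliffordAlgebra.contractLeft_algebraMap, CliffordAlgebra.contractRight_algebraMap]
    simp
  | add x y i hx hy h1 h2 => simp only [map_add, LinearMap.add_apply, h1, h2, smul_add]; abel
  | mul_mem i x hx h m hm =>
    obtain ⟨v, rfl⟩ := hm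
    have e : CliffordAlgebra.contractRight (x * ExteriorAlgebra.ι ℂ v) d =
        d v • x - CliffordAlgebra.contractRight x d * ExteriorAlgebra.ι ℂ v :=
      CliffordAlgebra.contractRight_mul_ι d v x
    have e2 : CliffordAlgebra.contractLeft d (ExteriorAlgebra.ι ℂ v) =
        algebraMap ℂ (ExteriorAlgebra ℂ V) (d v) := CliffordAlgebra.contractLeft_ι _ d v
    have s : (-1 : ℂ) ^ i * (-1 : ℂ) ^ i = 1 := by rw [← mul_pow]; simp
    rw [e, h, contractLeft_mul, involute_of_mem hx, e2, ← Algebra.commutes, pow_succ]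
    simp only [neg_mul, smul_mul_assoc, mul_neg, mul_one, neg_smul, smul_add, sub_neg_eq_add,
      mul_smul_comm, smul_smul, ← Algebra.smul_def]
    rw [← mul_assoc, s, one_mul, neg_add, neg_neg, neg_neg, add_comm]

variable [FiniteDimensional ℂ V]

/-- The antiderivation of `⋀ V` extending a linear map `D : V → ⋀² V`. In terms of a basis `e_k`
of `V` and its dual basis `e^k` it is `a ↦ ∑ₖ D(e_k) ∧ (e^k ⌟ a)`; see `extendDiff_ι` and
`extendDiff_mul`. -/
def extendDiff (D : V →ₗ[ℂ] ExteriorAlgebra ℂ V) :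
    ExteriorAlgebra ℂ V →ₗ[ℂ] ExteriorAlgebra ℂ V :=
  ∑ k, LinearMap.mulLeft ℂ (D (Module.finBasis ℂ V k)) ∘ₗ
    CliffordAlgebra.contractLeft ((Module.finBasis ℂ V).coord k)

/-- The bracket of degree `-1` on `⋀ V` extending a bracket on `V` (the Schouten bracket). In terms
of a basis `e_k` of `V` and its dual basis `e^k` it is
`[a • b] = ∑ₖₗ (a ⌞ e^k) ∧ [e_k, e_l] ∧ (e^l ⌟ b)`; see `extendBracket_ι_ι`,
`extendBracket_skew` and `extendBracket_mul`. -/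
def extendBracket (br : V →ₗ[ℂ] V →ₗ[ℂ] V) :
    ExteriorAlgebra ℂ V →ₗ[ℂ] ExteriorAlgebra ℂ V →ₗ[ℂ] ExteriorAlgebra ℂ V :=
  ∑ k, ∑ l, (LinearMap.mul ℂ (ExteriorAlgebra ℂ V)).compl₁₂
    (LinearMap.mulRight ℂ
        (ExteriorAlgebra.ι ℂ (br (Module.finBasis ℂ V k) (Module.finBasis ℂ V l))) ∘ₗ
      CliffordAlgebra.contractRight.flip ((Module.finBasis ℂ V).coord k))
    (CliffordAlgebra.contractLeft ((Module.finBasis ℂ V).coord l))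

theorem extendDiff_apply (D : V →ₗ[ℂ] ExteriorAlgebra ℂ V) (a : ExteriorAlgebra ℂ V) :
    extendDiff D a = ∑ k, D (Module.finBasis ℂ V k) *
      CliffordAlgebra.contractLeft ((Module.finBasis ℂ V).coord k) a := by
  simp [extendDiff]

theorem extendDiff_ι (D : V →ₗ[ℂ] ExteriorAlgebra ℂ V) (v : V) :
    extendDiff D (ExteriorAlgebra.ι ℂ v) = D v := by
  have e (d : Module.Dual ℂ V) : CliffordAlgebra.contractLeft d (ExteriorAlgebra.ι ℂ v) =
        algebraMap ℂ (ExteriorAlgebra ℂ V) (d v) := CliffordAlgebra.contractLeft_ι _ d v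
  conv_rhs => rw [← (Module.finBasis ℂ V).sum_repr v]
  simp only [extendDiff_apply, e, map_sum, map_smul]
  refine Finset.sum_congr rfl fun k _ => ?_
  rw [← Algebra.commutes, ← Algebra.smul_def, Module.Basis.coord_apply]

theorem extendDiff_mul (D : V →ₗ[ℂ] ExteriorAlgebra ℂ V) (hD : ∀ v, D v ∈ ⋀[ℂ]^2 V) {p : ℕ}
    {a : ExteriorAlgebra ℂ V} (ha : a ∈ ⋀[ℂ]^p V) (b : ExteriorAlgebra ℂ V) :
    extendDiff D (a * b) = extendDiff D a * b + (-1 : ℂ) ^ p • (a * extendDiff D b) := by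
  simp only [extendDiff_apply, contractLeft_mul, involute_of_mem ha, Finset.sum_mul,
    Finset.mul_sum, Finset.smul_sum, ← Finset.sum_add_distrib, mul_add, smul_mul_assoc,
    mul_smul_comm, ← mul_assoc]
  refine Finset.sum_congr rfl fun k _ => ?_
  rw [mul_comm_of_mem (hD _) ha, pow_mul]
  simp

theorem extendBracket_apply (br : V →ₗ[ℂ] V →ₗ[ℂ] V) (a b : ExteriorAlgebra ℂ V) :
    extendBracket br a b = ∑ k, ∑ l,
      CliffordAlgebra.contractRight a ((Module.finBasis ℂ V).coord k) *
      ExteriorAlgebra.ι ℂ (br (Module.finBasis ℂ V k) (Module.finBasis ℂ V l)) *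
      CliffordAlgebra.contractLeft ((Module.finBasis ℂ V).coord l) b := by
  simp [extendBracket]

theorem extendBracket_ι_ι (br : V →ₗ[ℂ] V →ₗ[ℂ] V) (v w : V) :
    extendBracket br (ExteriorAlgebra.ι ℂ v) (ExteriorAlgebra.ι ℂ w) =
      ExteriorAlgebra.ι ℂ (br v w) := by
  have e (d : Module.Dual ℂ V) : CliffordAlgebra.contractLeft d (ExteriorAlgebra.ι ℂ w) =
        algebraMap ℂ (ExteriorAlgebra ℂ V) (d w) := CliffordAlgebra.contractLeft_ι _ d w
  have e' (d : Module.Dual ℂ V) : CliffordAlgebra.contractRight (ExteriorAlgebra.ι ℂ v) d =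
        algebraMap ℂ (ExteriorAlgebra ℂ V) (d v) := CliffordAlgebra.contractRight_ι _ d v
  conv_rhs => rw [← (Module.finBasis ℂ V).sum_repr v, ← (Module.finBasis ℂ V).sum_repr w]
  simp only [extendBracket_apply, e, e', map_sum, map_smul, LinearMap.sum_apply,
    LinearMap.smul_apply, Finset.smul_sum]
  rw [Finset.sum_comm]
  refine Finset.sum_congr rfl fun k _ => Finset.sum_congr rfl fun l _ => ?_
  rw [← Algebra.commutes, ← Algebra.smul_def, ← Algebra.smul_def, Module.Basis.coord_apply,
    Module.Basis.coord_apply]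
  
theorem extendBracket_mul (br : V →ₗ[ℂ] V →ₗ[ℂ] V) {p q : ℕ} {a b : ExteriorAlgebra ℂ V}
    (ha : a ∈ ⋀[ℂ]^p V) (hb : b ∈ ⋀[ℂ]^q V) (c : ExteriorAlgebra ℂ V) :
    extendBracket br a (b * c) = extendBracket br a b * c +
      (-1 : ℂ) ^ ((p + 1) * q) • (b * extendBracket br a c) := by
  simp only [extendBracket_apply, contractLeft_mul, involute_of_mem hb, Finset.sum_mul,
    Finset.mul_sum, Finset.smul_sum, ← Finset.sum_add_distrib, mul_add, smul_mul_assoc,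
    mul_smul_comm, ← mul_assoc]
  refine Finset.sum_congr rfl fun k _ => Finset.sum_congr rfl fun l _ => ?_
  congr 1
  rw [contractRight_of_mem _ ha]
  rcases p with _ | p
  · simp [(contractLeft_mem _ ha).1 rfl]
  · have h := Submodule.mul_mem_mul ((contractLeft_mem ((Module.finBasis ℂ V).coord k) ha).2 p rfl)
      (LinearMap.mem_range_self (ExteriorAlgebra.ι ℂ)
        (br (Module.finBasis ℂ V k) (Module.finBasis ℂ V l)))
    rw [← pow_succ] at h
    simp only [neg_mul, mul_neg, smul_mul_assoc, mul_smul_comm, smul_neg]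
    rw [mul_comm_of_mem h hb]
    simp only [smul_mul_assoc, smul_smul, ← mul_assoc]
    congr 2
    ring

theorem extendBracket_skew (br : V →ₗ[ℂ] V →ₗ[ℂ] V) (hbr : ∀ v w, br v w = -br w v) {p q : ℕ}
    {a b : ExteriorAlgebra ℂ V} (ha : a ∈ ⋀[ℂ]^p V) (hb : b ∈ ⋀[ℂ]^q V) :
    extendBracket br a b = -((-1 : ℂ) ^ ((p + 1) * (q + 1)) • extendBracket br b a) := by
  rw [extendBracket_apply, extendBracket_apply, Finset.sum_comm, Finset.smul_sum,
    ← Finset.sum_neg_distrib]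
  refine Finset.sum_congr rfl fun k _ => ?_
  rw [Finset.smul_sum, ← Finset.sum_neg_distrib]
  refine Finset.sum_congr rfl fun l _ => ?_
  rw [contractRight_of_mem _ ha, contractRight_of_mem _ hb, hbr, map_neg]
  rcases p with _ | p
  · simp [(contractLeft_mem _ ha).1 rfl]
  rcases q with _ | q
  · simp [(contractLeft_mem _ hb).1 rfl]
  have hA := (contractLeft_mem ((Module.finBasis ℂ V).coord l) ha).2 p rfl
  have hB := (contractLeft_mem ((Module.finBasis ℂ V).coord k) hb).2 q rfl
  have hw : ExteriorAlgebra.ι ℂ (br (Module.finBasis ℂ V k) (Module.finBasis ℂ V l)) ∈ 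
      ⋀[ℂ]^1 V := by
    rw [ExteriorAlgebra.exteriorPower, pow_one]; exact LinearMap.mem_range_self _ _
  have hAw := Submodule.mul_mem_mul hA hw
  rw [← pow_add] at hAw
  simp only [neg_mul, mul_neg, smul_mul_assoc, neg_neg, smul_neg]
  rw [mul_comm_of_mem hAw hB, mul_comm_of_mem hA hw]
  simp only [mul_smul_comm, smul_smul, ← mul_assoc]
  congr 1
  rw [← pow_add, ← pow_add, ← pow_add]
  apply neg_one_pow_congr
  grind

/-- The data of a differential Gerstenhaber algebra whose underlying graded algebra is `⋀ V`: the
bracket `[- • -]` and the differential. -/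
structure ExteriorDGA (V : Type*) [AddCommGroup V] [Module ℂ V] where
  bracket : ExteriorAlgebra ℂ V →ₗ[ℂ] ExteriorAlgebra ℂ V →ₗ[ℂ] ExteriorAlgebra ℂ V
  diff : ExteriorAlgebra ℂ V →ₗ[ℂ] ExteriorAlgebra ℂ V

/-- The structure on `⋀ V` generated by a bracket on `V` and a differential `V → ⋀² V`. -/
def ExteriorDGA.generatedBy (br : V →ₗ[ℂ] V →ₗ[ℂ] V) (D : V →ₗ[ℂ] ExteriorAlgebra ℂ V) :
    ExteriorDGA V where
  bracket := extendBracket br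
  diff := extendDiff D

end Exterior

section Homomorphisms

variable {V W : Type*} [AddCommGroup V] [Module ℂ V] [AddCommGroup W] [Module ℂ W]

/-- Homomorphisms of differential Gerstenhaber algebras: homomorphisms of graded algebras that
commute with the brackets and with the differentials. -/
structure ExteriorDGA.Hom (A : ExteriorDGA V) (B : ExteriorDGA W) where
  toAlgHom : ExteriorAlgebra ℂ V →ₐ[ℂ] ExteriorAlgebra ℂ W
  map_degree : ∀ (n : ℕ), ∀ a ∈ ⋀[ℂ]^n V, toAlgHom a ∈ ⋀[ℂ]^n W
  map_bracket : ∀ a b, toAlgHom (A.bracket a b) = B.bracket (toAlgHom a) (toAlgHom b)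
  map_diff : ∀ a, toAlgHom (A.diff a) = B.diff (toAlgHom a)

/-- The coboundaries, as a subspace of the space of cocycles. -/
def ExteriorDGA.boundaries (A : ExteriorDGA V) : Submodule ℂ (LinearMap.ker A.diff) :=
  (LinearMap.range A.diff).comap (LinearMap.ker A.diff).subtype

/-- The total cohomology `ker d / im d`. -/
abbrev ExteriorDGA.Cohomology (A : ExteriorDGA V) : Type _ :=
  LinearMap.ker A.diff ⧸ A.boundaries

variable {A : ExteriorDGA V} {B : ExteriorDGA W}

/-- The map induced on cocycles. -/
def ExteriorDGA.Hom.mapCocycles (φ : A.Hom B) :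
    LinearMap.ker A.diff →ₗ[ℂ] LinearMap.ker B.diff :=
  φ.toAlgHom.toLinearMap.restrict fun a ha => by
    rw [LinearMap.mem_ker] at ha ⊢
    rw [AlgHom.toLinearMap_apply, ← φ.map_diff, ha, map_zero]

theorem ExteriorDGA.Hom.boundaries_le (φ : A.Hom B) :
    A.boundaries ≤ B.boundaries.comap φ.mapCocycles := by
  rintro ⟨a, ha⟩ ⟨c, hc⟩
  exact ⟨φ.toAlgHom c, by rw [← φ.map_diff, hc]; rfl⟩

/-- The map induced on cohomology. -/
def ExteriorDGA.Hom.mapCohomology (φ : A.Hom B) : A.Cohomology →ₗ[ℂ] B.Cohomology :=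
  Submodule.mapQ _ _ φ.mapCocycles φ.boundaries_le

/-- A quasi-isomorphism is a homomorphism that induces an isomorphism on cohomology. -/
def ExteriorDGA.Hom.IsQuasiIso (φ : A.Hom B) : Prop :=
  Function.Bijective φ.mapCohomology

end Homomorphisms

/-! ### The Chevalley-Eilenberg differential -/

/-- The Chevalley-Eilenberg differential `K* → ⋀² K*` of a bracket on `K`, that is
`(dα)(x, y) = -α([x, y])`. In terms of a basis `e_k` of `K` and its dual basis `e^k` it is
`dα = -½ ∑ₖₗ α([e_k, e_l]) e^k ∧ e^l`; see `ceDiff_contract`. -/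
def ceDiff {K : Type*} [AddCommGroup K] [Module ℂ K] [FiniteDimensional ℂ K]
    (br : K →ₗ[ℂ] K →ₗ[ℂ] K) :
    Module.Dual ℂ K →ₗ[ℂ] ExteriorAlgebra ℂ (Module.Dual ℂ K) :=
  -((2 : ℂ)⁻¹ • ∑ k, ∑ l,
    (Module.Dual.eval ℂ K (br (Module.finBasis ℂ K k) (Module.finBasis ℂ K l))).smulRight
      (ExteriorAlgebra.ι ℂ ((Module.finBasis ℂ K).coord k) *
        ExteriorAlgebra.ι ℂ ((Module.finBasis ℂ K).coord l)))

theorem ceDiff_apply {K : Type*} [AddCommGroup K] [Module ℂ K] [FiniteDimensional ℂ K]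
    (br : K →ₗ[ℂ] K →ₗ[ℂ] K) (α : Module.Dual ℂ K) :
    ceDiff br α = -((2 : ℂ)⁻¹ • ∑ k, ∑ l,
      α (br (Module.finBasis ℂ K k) (Module.finBasis ℂ K l)) •
        (ExteriorAlgebra.ι ℂ ((Module.finBasis ℂ K).coord k) *
          ExteriorAlgebra.ι ℂ ((Module.finBasis ℂ K).coord l))) := by
  simp [ceDiff]

theorem ceDiff_mem {K : Type*} [AddCommGroup K] [Module ℂ K] [FiniteDimensional ℂ K]
    (br : K →ₗ[ℂ] K →ₗ[ℂ] K) (α : Module.Dual ℂ K) :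
    ceDiff br α ∈ ⋀[ℂ]^2 (Module.Dual ℂ K) := by
  rw [ceDiff_apply]
  refine neg_mem (Submodule.smul_mem _ _ (Submodule.sum_mem _ fun k _ =>
    Submodule.sum_mem _ fun l _ => Submodule.smul_mem _ _ ?_))
  rw [ExteriorAlgebra.exteriorPower, pow_two]
  exact Submodule.mul_mem_mul (LinearMap.mem_range_self _ _) (LinearMap.mem_range_self _ _)

/-- The value of `dα` on `x, y` is `-α([x, y])`. -/
theorem ceDiff_contract {K : Type*} [AddCommGroup K] [Module ℂ K] [FiniteDimensional ℂ K]
    (br : K →ₗ[ℂ] K →ₗ[ℂ] K) (hbr : ∀ x y, br x y = -br y x) (α : Module.Dual ℂ K) (x y : K) :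
    CliffordAlgebra.contractLeft (Module.Dual.eval ℂ K y)
      (CliffordAlgebra.contractLeft (Module.Dual.eval ℂ K x) (ceDiff br α)) =
      algebraMap ℂ (ExteriorAlgebra ℂ (Module.Dual ℂ K)) (-α (br x y)) := by
  have e (d : Module.Dual ℂ (Module.Dual ℂ K)) (β : Module.Dual ℂ K) :
      CliffordAlgebra.contractLeft d (ExteriorAlgebra.ι ℂ β) =
        algebraMap ℂ (ExteriorAlgebra ℂ (Module.Dual ℂ K)) (d β) :=
    CliffordAlgebra.contractLeft_ι _ d β
  have e2 (d : Module.Dual ℂ (Module.Dual ℂ K)) (β : Module.Dual ℂ K)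
      (z : ExteriorAlgebra ℂ (Module.Dual ℂ K)) :
      CliffordAlgebra.contractLeft d (ExteriorAlgebra.ι ℂ β * z) =
        d β • z - ExteriorAlgebra.ι ℂ β * CliffordAlgebra.contractLeft d z :=
    CliffordAlgebra.contractLeft_ι_mul d β z
  have e3 (β γ : Module.Dual ℂ K) : CliffordAlgebra.contractLeft (Module.Dual.eval ℂ K y)
      (CliffordAlgebra.contractLeft (Module.Dual.eval ℂ K x)
        (ExteriorAlgebra.ι ℂ β * ExteriorAlgebra.ι ℂ γ)) =
      algebraMap ℂ (ExteriorAlgebra ℂ (Module.Dual ℂ K)) (β x * γ y - γ x * β y) := by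
    rw [e2, map_sub, map_smul, e, e, ← Algebra.commutes, ← Algebra.smul_def, map_smul, e]
    simp only [Module.Dual.eval_apply, Algebra.smul_def, map_sub, map_mul]
  set b := Module.finBasis ℂ K with hb
  have hx : α (br x y) = ∑ k, ∑ l, α (br (b k) (b l)) * (b.coord k x * b.coord l y) := by
    conv_lhs => rw [← b.sum_repr x, ← b.sum_repr y]
    simp only [map_sum, map_smul, LinearMap.sum_apply, LinearMap.smul_apply, smul_eq_mul,
      Finset.mul_sum, Module.Basis.coord_apply]
    rw [Finset.sum_comm]
    exact Finset.sum_congr rfl fun k _ => Finset.sum_congr rfl fun l _ => by ring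
  have hy : -α (br x y) = ∑ k, ∑ l, α (br (b k) (b l)) * (b.coord l x * b.coord k y) := by
    rw [← map_neg, ← hbr]
    conv_lhs => rw [← b.sum_repr x, ← b.sum_repr y]
    simp only [map_sum, map_smul, LinearMap.sum_apply, LinearMap.smul_apply, smul_eq_mul,
      Finset.mul_sum, Module.Basis.coord_apply]
    rw [Finset.sum_comm]
    exact Finset.sum_congr rfl fun k _ => Finset.sum_congr rfl fun l _ => by ring
  rw [ceDiff_apply]
  simp only [map_neg, map_smul, map_sum, e3]
  rw [neg_inj]
  simp only [Algebra.smul_def, ← map_mul, ← map_sum]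
  congr 1
  simp only [mul_sub, Finset.sum_sub_distrib]
  rw [← hx, ← hy]
  ring

/-- The bracket of a complex Lie algebra as a bilinear map. -/
def lieBilin (L : Type*) [LieRing L] [LieAlgebra ℂ L] : L →ₗ[ℂ] L →ₗ[ℂ] L :=
  LinearMap.mk₂ ℂ (fun x y => ⁅x, y⁆) add_lie (fun c x y => smul_lie c x y) lie_add
    (fun c x y => lie_smul c x y)

/-! ### The differential Gerstenhaber algebra of a complex structure -/

section Courant

variable {L : Type*} [LieRing L] [LieAlgebra ℂ L]

/-- For a subalgebra `P` of a complex Lie algebra `L`, the space of all `x + α` with `x ∈ P` and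
`α ∈ L*` vanishing on `P`. -/
abbrev CourantSpace (P : LieSubalgebra ℂ L) : Type _ :=
  P.toSubmodule × P.toSubmodule.dualAnnihilator

/-- The contraction `ι_x dβ`, that is `z ↦ (dβ)(x, z) = -β([x, z])`, for `x ∈ P` and `β`
vanishing on `P`. -/
def contractD (P : LieSubalgebra ℂ L) (x : P.toSubmodule) (β : P.toSubmodule.dualAnnihilator) :
    P.toSubmodule.dualAnnihilator :=
  ⟨-(β.1 ∘ₗ lieBilin L x.1), by
    rw [Submodule.mem_dualAnnihilator]
    intro z hz
    have h : β.1 ⁅x.1, z⁆ = 0 := (Submodule.mem_dualAnnihilator _).1 β.2 _ (P.lie_mem x.2 hz)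
    simp [lieBilin, h]⟩

/-- The Courant bracket `[x + α • y + β] = [x, y] + ι_x dβ - ι_y dα`. -/
def courantBracket (P : LieSubalgebra ℂ L) :
    CourantSpace P →ₗ[ℂ] CourantSpace P →ₗ[ℂ] CourantSpace P :=
  LinearMap.mk₂ ℂ
    (fun a b => (⟨⁅a.1.1, b.1.1⁆, P.lie_mem a.1.2 b.1.2⟩,
      contractD P a.1 b.2 - contractD P b.1 a.2))
    (fun a a' b => by ext <;> simp [contractD, lieBilin] <;> ring)
    (fun c a b => by ext <;> simp [contractD, lieBilin])
    (fun a b b' => by ext <;> simp [contractD, lieBilin] <;> ring)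
    (fun c a b => by ext <;> simp [contractD, lieBilin])

/-- The pairing `⟨x + α, y + β⟩ = α(y) + β(x)`, as a map to the dual. -/
def courantPairing (P Q : LieSubalgebra ℂ L) :
    CourantSpace P →ₗ[ℂ] Module.Dual ℂ (CourantSpace Q) :=
  LinearMap.mk₂ ℂ (fun a b => a.2.1 b.1.1 + b.2.1 a.1.1)
    (fun a a' b => by simp; ring) (fun c a b => by simp; ring)
    (fun a b b' => by simp; ring) (fun c a b => by simp; ring)

theorem courantPairing_bijective [FiniteDimensional ℂ L] {P Q : LieSubalgebra ℂ L}
    (h : IsCompl P.toSubmodule Q.toSubmodule) : Function.Bijective (courantPairing P Q) := by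
  have hfin : Module.finrank ℂ (CourantSpace P) =
      Module.finrank ℂ (Module.Dual ℂ (CourantSpace Q)) := by
    rw [Subspace.dual_finrank_eq, Module.finrank_prod, Module.finrank_prod,
      Subspace.finrank_add_finrank_dualAnnihilator_eq,
      Subspace.finrank_add_finrank_dualAnnihilator_eq]
  have hinj : Function.Injective (courantPairing P Q) := by
    rw [← LinearMap.ker_eq_bot, LinearMap.ker_eq_bot']
    rintro ⟨⟨x, hx⟩, ⟨α, hα⟩⟩ h0
    have h1 : ∀ y ∈ Q.toSubmodule, α y = 0 := fun y hy => by
      simpa [courantPairing] using LinearMap.congr_fun h0 (⟨y, hy⟩, 0)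
    have h2 : ∀ β ∈ Q.toSubmodule.dualAnnihilator, β x = 0 := fun β hβ => by
      simpa [courantPairing] using LinearMap.congr_fun h0 (0, ⟨β, hβ⟩)
    have hα0 : α = 0 := by
      have : α ∈ (P.toSubmodule ⊔ Q.toSubmodule).dualAnnihilator := by
        rw [Submodule.dualAnnihilator_sup_eq]
        exact ⟨hα, (Submodule.mem_dualAnnihilator _).2 h1⟩
      rw [h.sup_eq_top, Submodule.dualAnnihilator_top] at this
      simpa using this
    have hxQ : x ∈ Q.toSubmodule := by
      rw [← Subspace.dualAnnihilator_dualCoannihilator_eq (W := Q.toSubmodule)]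
      exact (Submodule.mem_dualCoannihilator _).2 h2
    have hx0 : x = 0 := by
      have : x ∈ P.toSubmodule ⊓ Q.toSubmodule := ⟨hx, hxQ⟩
      rw [h.inf_eq_bot] at this
      simpa using this
    subst hα0 hx0
    rfl
  exact ⟨hinj, (LinearMap.injective_iff_surjective_of_finrank_eq_finrank hfin).1 hinj⟩

/-- If `L = P ⊕ Q`, the pairing identifies `P ⊕ P°` with the dual of `Q ⊕ Q°`. -/
def courantDual [FiniteDimensional ℂ L] {P Q : LieSubalgebra ℂ L}
    (h : IsCompl P.toSubmodule Q.toSubmodule) :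
    CourantSpace P ≃ₗ[ℂ] Module.Dual ℂ (CourantSpace Q) :=
  LinearEquiv.ofBijective (courantPairing P Q) (courantPairing_bijective h)

/-- The Chevalley-Eilenberg differential of `Q ⊕ Q°` with its Courant bracket, as a map
`P ⊕ P° → ⋀² (P ⊕ P°)`. -/
def courantDiff [FiniteDimensional ℂ L] {P Q : LieSubalgebra ℂ L}
    (h : IsCompl P.toSubmodule Q.toSubmodule) :
    CourantSpace P →ₗ[ℂ] ExteriorAlgebra ℂ (CourantSpace P) :=
  (ExteriorAlgebra.map (courantDual h).symm.toLinearMap).toLinearMap ∘ₗ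
    ceDiff (courantBracket Q) ∘ₗ (courantDual h).toLinearMap

end Courant

section Structures

variable (g : Type*) [LieRing g] [LieAlgebra ℝ g]

/-- An integrable complex structure on a real Lie algebra. -/
structure ComplexStructure where
  J : g →ₗ[ℝ] g
  sq : ∀ x, J (J x) = -x
  integrable : ∀ x y, ⁅x, y⁆ + J ⁅J x, y⁆ + J ⁅x, J y⁆ - ⁅J x, J y⁆ = 0

/-- A symplectic form on a real Lie algebra: a closed nondegenerate alternating form. -/
structure SymplecticForm where
  form : LinearMap.BilinForm ℝ g
  alt : form.IsAlt
  nondegenerate : form.Nondegenerate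
  closed : ∀ x y z, form ⁅x, y⁆ z + form ⁅y, z⁆ x + form ⁅z, x⁆ y = 0

variable {g}

/-- `(J, Ω)` is a pseudo-Kähler pair if the symplectic form `Ω` is of type `(1,1)` for `J`. -/
def IsPseudoKahler (J : ComplexStructure g) (Ω : SymplecticForm g) : Prop :=
  ∀ x y, Ω.form (J.J x) (J.J y) = Ω.form x y

namespace ComplexStructure

/-- The complex linear extension of `J` to the complexification. -/
def JC (J : ComplexStructure g) : (ℂ ⊗[ℝ] g) →ₗ[ℂ] (ℂ ⊗[ℝ] g) :=
  J.J.baseChange ℂ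

theorem JC_sq (J : ComplexStructure g) (x : ℂ ⊗[ℝ] g) : J.JC (J.JC x) = -x := by
  induction x using TensorProduct.induction_on with
  | zero => simp
  | tmul a x => simp [JC, J.sq, TensorProduct.tmul_neg]
  | add x y hx hy => rw [map_add, map_add, hx, hy, neg_add]

theorem JC_integrable (J : ComplexStructure g) (x y : ℂ ⊗[ℝ] g) :
    lieBilin (ℂ ⊗[ℝ] g) x y + J.JC (lieBilin (ℂ ⊗[ℝ] g) (J.JC x) y) +
      J.JC (lieBilin (ℂ ⊗[ℝ] g) x (J.JC y)) - lieBilin (ℂ ⊗[ℝ] g) (J.JC x) (J.JC y) = 0 := by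
  induction x using TensorProduct.induction_on with
  | zero => simp
  | tmul a x =>
    induction y using TensorProduct.induction_on with
    | zero => simp
    | tmul b y =>
      simp only [JC, LinearMap.baseChange_tmul, lieBilin, LinearMap.mk₂_apply]
      erw [LieAlgebra.ExtendScalars.bracket_tmul, LieAlgebra.ExtendScalars.bracket_tmul,
        LieAlgebra.ExtendScalars.bracket_tmul, LieAlgebra.ExtendScalars.bracket_tmul]
      simp only [LinearMap.baseChange_tmul]
      rw [← TensorProduct.tmul_add, ← TensorProduct.tmul_add, ← TensorProduct.tmul_sub,
        J.integrable, TensorProduct.tmul_zero]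
    | add y z hy hz =>
      simp only [map_add]
      rw [← add_zero (0 : ℂ ⊗[ℝ] g)]
      nth_rewrite 1 [← hy]
      rw [← hz]
      abel
  | add x z hx hz =>
    simp only [map_add, LinearMap.add_apply]
    rw [← add_zero (0 : ℂ ⊗[ℝ] g)]
    nth_rewrite 1 [← hx]
    rw [← hz]
    abel

/-- The eigenspace of `J` in the complexification for an eigenvalue `μ` with `μ² = -1`, which is a
complex subalgebra because `J` is integrable. -/
def eigenSubalgebra (J : ComplexStructure g) (μ : ℂ) (hμ : μ * μ = -1) :
    LieSubalgebra ℂ (ℂ ⊗[ℝ] g) where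
  toSubmodule := Module.End.eigenspace J.JC μ
  lie_mem' := by
    intro x y hx hy
    change x ∈ Module.End.eigenspace J.JC μ at hx
    change y ∈ Module.End.eigenspace J.JC μ at hy
    change ⁅x, y⁆ ∈ Module.End.eigenspace J.JC μ
    rw [Module.End.mem_eigenspace_iff] at hx hy ⊢
    have h := J.JC_integrable x y
    rw [hx, hy] at h
    simp only [map_smul, LinearMap.smul_apply, smul_smul, hμ] at h
    change ⁅x, y⁆ + μ • J.JC ⁅x, y⁆ + μ • J.JC ⁅x, y⁆ - (-1 : ℂ) • ⁅x, y⁆ = 0 at h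
    have h2 : (2 : ℂ) • (⁅x, y⁆ + μ • J.JC ⁅x, y⁆) = 0 := by
      rw [← h]; module
    have h3 := (smul_eq_zero.1 h2).resolve_left two_ne_zero
    have h4 : μ • (⁅x, y⁆ + μ • J.JC ⁅x, y⁆) = 0 := by rw [h3, smul_zero]
    rw [smul_add, smul_smul, hμ, neg_one_smul, ← sub_eq_add_neg, sub_eq_zero] at h4
    exact h4.symm

/-- The `i`-eigenspace of `J`. -/
def g10 (J : ComplexStructure g) : LieSubalgebra ℂ (ℂ ⊗[ℝ] g) :=
  J.eigenSubalgebra Complex.I Complex.I_mul_I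

/-- The `-i`-eigenspace of `J`. -/
def g01 (J : ComplexStructure g) : LieSubalgebra ℂ (ℂ ⊗[ℝ] g) :=
  J.eigenSubalgebra (-Complex.I) (by rw [neg_mul_neg, Complex.I_mul_I])

theorem isCompl_g10_g01 (J : ComplexStructure g) :
    IsCompl J.g10.toSubmodule J.g01.toSubmodule := by
  change IsCompl (Module.End.eigenspace J.JC Complex.I) (Module.End.eigenspace J.JC (-Complex.I))
  rw [isCompl_iff]
  constructor
  · rw [Submodule.disjoint_def]
    intro x hx hy
    rw [Module.End.mem_eigenspace_iff] at hx hy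
    rw [hx] at hy
    have h : (2 * Complex.I) • x = 0 := by
      rw [two_mul, add_smul]; nth_rewrite 1 [hy]; rw [← add_smul]; simp
    exact (smul_eq_zero.1 h).resolve_left (by simp)
  · rw [Submodule.codisjoint_iff_exists_add_eq]
    intro x
    refine ⟨(2 : ℂ)⁻¹ • (x - Complex.I • J.JC x), (2 : ℂ)⁻¹ • (x + Complex.I • J.JC x),
      ?_, ?_, ?_⟩
    · rw [Module.End.mem_eigenspace_iff]
      simp only [map_smul, map_sub, JC_sq, smul_sub, smul_smul, smul_neg, sub_neg_eq_add]
      rw [show Complex.I * (2⁻¹ * Complex.I) = -2⁻¹ by linear_combination (2 : ℂ)⁻¹ * Complex.I_mul_I,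
        mul_comm]
      simp only [neg_smul, sub_neg_eq_add]
      abel
    · rw [Module.End.mem_eigenspace_iff]
      simp only [map_smul, map_add, JC_sq, smul_add, smul_smul, smul_neg]
      rw [show -Complex.I * (2⁻¹ * Complex.I) = 2⁻¹ by
        linear_combination -(2 : ℂ)⁻¹ * Complex.I_mul_I, mul_comm]
      simp only [neg_mul, neg_smul]
      abel
    · rw [← smul_add, sub_add_add_cancel, ← two_smul ℂ x, smul_smul]
      simp

variable [FiniteDimensional ℝ g]

/-- The differential Gerstenhaber algebra `DGA(g, J)`: the exterior algebra of
`f¹ = g^(1,0) ⊕ g*^(0,1)` with the Courant bracket and with `∂̄`, where `g*^(0,1)` is the space of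
complex linear forms vanishing on `g^(1,0)` and `∂̄` is the Chevalley-Eilenberg differential of
the conjugate algebra `g^(0,1) ⊕ g*^(1,0) ≅ (f¹)*`. -/
def dga (J : ComplexStructure g) : ExteriorDGA (CourantSpace J.g10) :=
  ExteriorDGA.generatedBy (courantBracket J.g10) (courantDiff J.isCompl_g10_g01)

end ComplexStructure

/-! ### The differential Gerstenhaber algebra of a symplectic form -/

namespace SymplecticForm

variable [FiniteDimensional ℝ g]

/-- The complex bilinear extension of the symplectic form. -/
def formC (Ω : SymplecticForm g) : LinearMap.BilinForm ℂ (ℂ ⊗[ℝ] g) :=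
  Ω.form.baseChange ℂ

theorem formC_nondegenerate (Ω : SymplecticForm g) : Ω.formC.Nondegenerate := by
  classical
  let b := Module.finBasis ℝ g
  have h := (LinearMap.BilinForm.nondegenerate_iff_det_ne_zero b).1 Ω.nondegenerate
  rw [LinearMap.BilinForm.nondegenerate_iff_det_ne_zero (b.baseChange ℂ)]
  have e : LinearMap.BilinForm.toMatrix (b.baseChange ℂ) Ω.formC =
      (algebraMap ℝ ℂ).mapMatrix (LinearMap.BilinForm.toMatrix b Ω.form) := by
    ext i j
    simp [formC, LinearMap.BilinForm.toMatrix_apply]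
  rw [e, ← RingHom.map_det]
  simpa using h

/-- The isomorphism `x ↦ ι_x Ω` from the complexification of `g` to its dual. -/
def contraction (Ω : SymplecticForm g) : (ℂ ⊗[ℝ] g) ≃ₗ[ℂ] Module.Dual ℂ (ℂ ⊗[ℝ] g) :=
  Ω.formC.toDual Ω.formC_nondegenerate

/-- The bracket `[α • β]_Ω = Ω [Ω⁻¹ α, Ω⁻¹ β]` on the complexified dual. -/
def dualBracket (Ω : SymplecticForm g) : Module.Dual ℂ (ℂ ⊗[ℝ] g) →ₗ[ℂ]
    Module.Dual ℂ (ℂ ⊗[ℝ] g) →ₗ[ℂ] Module.Dual ℂ (ℂ ⊗[ℝ] g) :=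
  ((lieBilin (ℂ ⊗[ℝ] g)).compl₁₂ Ω.contraction.symm.toLinearMap
    Ω.contraction.symm.toLinearMap).compr₂ Ω.contraction.toLinearMap

/-- The differential Gerstenhaber algebra `DGA(g, Ω)`: the exterior algebra of the complexified
dual of `g` with the bracket `[- • -]_Ω` and with the Chevalley-Eilenberg differential. -/
def dga (Ω : SymplecticForm g) : ExteriorDGA (Module.Dual ℂ (ℂ ⊗[ℝ] g)) :=
  ExteriorDGA.generatedBy Ω.dualBracket (ceDiff (lieBilin (ℂ ⊗[ℝ] g)))

end SymplecticForm

end Structures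

/-! ### Nilpotent Lie algebras given by structure equations -/

section StructureEquations

variable (g : Type*) [LieRing g] [LieAlgebra ℝ g]

/-- The `2`-form `α ∧ β`. -/
def wedge {g : Type*} [LieRing g] [LieAlgebra ℝ g] (α β : Module.Dual ℝ g) : g → g → ℝ :=
  fun x y => α x * β y - α y * β x

/-- There is a basis of `g` whose dual basis `e⁰, …, e⁵` satisfies the structure equations
`de^k = c_k(e⁰, …, e⁵)`, where `(dα)(x, y) = -α([x, y])`. These equations determine `g` up to
isomorphism. Indices start at `0`, while the usual shorthand `(0, 0, 0, 12, …)` for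
`(de¹, …, de⁶)` counts from `1`. -/
def HasStructureEquations (c : (Fin 6 → Module.Dual ℝ g) → Fin 6 → g → g → ℝ) : Prop :=
  ∃ e : Module.Basis (Fin 6) ℝ g, ∀ k x y, -e.coord k ⁅x, y⁆ = c e.coord k x y

/-- `g ≅ h₁ = (0, 0, 0, 0, 0, 0)`. -/
def IsH1 : Prop :=
  HasStructureEquations g fun _ => ![0, 0, 0, 0, 0, 0]

/-- `g ≅ h₆ = (0, 0, 0, 0, 12, 13)`. -/
def IsH6 : Prop :=
  HasStructureEquations g fun e => ![0, 0, 0, 0, wedge (e 0) (e 1), wedge (e 0) (e 2)]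

/-- `g ≅ h₈ = (0, 0, 0, 0, 0, 12)`. -/
def IsH8 : Prop :=
  HasStructureEquations g fun e => ![0, 0, 0, 0, 0, wedge (e 0) (e 1)]

/-- `g ≅ h₉ = (0, 0, 0, 0, 12, 14 + 25)`. -/
def IsH9 : Prop :=
  HasStructureEquations g fun e =>
    ![0, 0, 0, 0, wedge (e 0) (e 1), wedge (e 0) (e 3) + wedge (e 1) (e 4)]

/-- `g ≅ h₁₀ = (0, 0, 0, 12, 13, 14)`. -/
def IsH10 : Prop :=
  HasStructureEquations g fun e =>
    ![0, 0, 0, wedge (e 0) (e 1), wedge (e 0) (e 2), wedge (e 0) (e 3)]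

end StructureEquations

end WeakSelfMirror

end

/-! Let `L` be the complexification of `g` and `A = g^(1,0)`, a Lagrangian subalgebra complementary
to its conjugate `Ā` (`PKData`). The formula `Ω(xy, z) = -Ω(y, [x, z])` defines a product on `L`.
Closedness of `Ω` gives `xy - yx = [x, y]`, the Jacobi identity gives `[x, y]z = x(yz) - y(xz)`, and
`A` is stable under the product. As `A` is Lagrangian, `y ↦ ι_y Ω` identifies `A` with its
annihilator and turns the Courant bracket into that of the semidirect product `A ⋉ A`. In degree one
a homomorphism of the two algebras is a linear map `f`. Compatibility with brackets says that `ψ =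
Ω⁻¹f : A ⋉ A → L` is a Lie homomorphism; compatibility with differentials says that the transpose `χ
: L → Ā ⋉ Ā` is one. A quasi-isomorphism is injective on closed generators, so `χ` is onto modulo
brackets, hence onto by nilpotency (`surjective_of_nilpotent`), and a dimension count makes both
maps bijective. The problem becomes one about pairs of Lie isomorphisms `ψ`, `χ` adjoint to each
other (`SelfMirror`); see `exists_selfMirror_of_quasiIso` and `exists_quasiIso_of_selfMirror`. For
the necessity of the list, nilpotency and left symmetry give a basis `a, w, u` of `A` with `aa = βw
+ γu`, `aw = αu`, `wa = κu`, `ww = δu`, `βδ = 0` and all other products zero (`exists_frame`). The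
brackets of `L` can now be computed twice: through `ψ` from this table alone, and directly, the
brackets of `A` with `Ā` being determined by the table and the values of `Ω`. If `β = 0` and `α =
κ`, or `β ≠ 0` and `α = κ = 0`, the derived algebra is at most a line and `g` is `h₁` or `h₈`. If `β
= 0` and `α ≠ κ`, the derived algebra is spanned by `u` and `ū`, which gives `h₆`
(`exists_frame_of_ne`). Otherwise one normalizes to `aa = w`, `aw = u`, `wa = tu` and puts `Ω` in a
balanced position (`exists_balanced_frame`). If `t` were neither `0` nor `1`, then `t` would be
real, and the leading coefficients of `ψ` and `χ`, tied by adjointness, would give `(1 - 2t)² = -1`;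
so `t` is `0` or `1` (`eq_zero_or_eq_one`), which yields `h₁₀` and `h₉`. For sufficiency, each
algebra on the list has a basis in which the standard complex structure is integrable
(`IsStandard`), an explicit form of type `(1,1)` is symplectic (`exists_adaptedFrame`), and `ψ`, `χ`
can be written down (`selfMirror_h10` and its analogues). -/

namespace WeakSelfMirror

/-! ### Contractions and functoriality on exterior algebras -/

section ExteriorLemmas

variable {V W : Type*} [AddCommGroup V] [Module ℂ V] [AddCommGroup W] [Module ℂ W]

theorem contractLeft_ι' (d : Module.Dual ℂ V) (v : V) :
    CliffordAlgebra.contractLeft d (ExteriorAlgebra.ι ℂ v) =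
      algebraMap ℂ (ExteriorAlgebra ℂ V) (d v) :=
  CliffordAlgebra.contractLeft_ι _ d v

theorem contractLeft_ι_mul' (d : Module.Dual ℂ V) (v : V) (z : ExteriorAlgebra ℂ V) :
    CliffordAlgebra.contractLeft d (ExteriorAlgebra.ι ℂ v * z) =
      d v • z - ExteriorAlgebra.ι ℂ v * CliffordAlgebra.contractLeft d z :=
  CliffordAlgebra.contractLeft_ι_mul d v z

theorem contractLeft_algebraMap' (d : Module.Dual ℂ V) (r : ℂ) :
    CliffordAlgebra.contractLeft d (algebraMap ℂ (ExteriorAlgebra ℂ V) r) = 0 :=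
  CliffordAlgebra.contractLeft_algebraMap _ d r

theorem ι_mem_exteriorPower_one (v : V) : ExteriorAlgebra.ι ℂ v ∈ ⋀[ℂ]^1 V := by
  rw [ExteriorAlgebra.exteriorPower, pow_one]; exact LinearMap.mem_range_self _ _

/-- Induction on homogeneous elements by left multiplication with generators. -/
theorem exterior_left_induction {P : ExteriorAlgebra ℂ V → Prop}
    (algebraMap : ∀ r : ℂ, P (algebraMap ℂ _ r)) (add : ∀ x y, P x → P y → P (x + y))
    (ι_mul : ∀ (v : V) (n : ℕ) (x : ExteriorAlgebra ℂ V), x ∈ ⋀[ℂ]^n V → P x →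
      P (ExteriorAlgebra.ι ℂ v * x)) (z : ExteriorAlgebra ℂ V) : P z := by
  classical
  induction z using DirectSum.Decomposition.inductionOn (fun i : ℕ => ⋀[ℂ]^i V) with
  | zero => simpa using algebraMap 0
  | @homogeneous i m =>
    obtain ⟨m, hm⟩ := m
    change P m
    induction hm using Submodule.pow_induction_on_left' with
    | algebraMap r => exact algebraMap r
    | add x y i hx hy h1 h2 => exact add _ _ h1 h2
    | mem_mul m hm i x hx h => obtain ⟨v, rfl⟩ := hm; exact ι_mul v i x hx h
  | add x y hx hy => exact add _ _ hx hy

theorem contractLeft_map (f : V →ₗ[ℂ] W) (d : Module.Dual ℂ W) (z : ExteriorAlgebra ℂ V) :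
    CliffordAlgebra.contractLeft d (ExteriorAlgebra.map f z) =
      ExteriorAlgebra.map f (CliffordAlgebra.contractLeft (d ∘ₗ f) z) := by
  induction z using exterior_left_induction with
  | algebraMap r => rw [AlgHom.commutes, contractLeft_algebraMap', contractLeft_algebraMap', map_zero]
  | add x y hx hy => simp only [map_add, hx, hy]
  | ι_mul v n x hx h =>
    rw [map_mul, ExteriorAlgebra.map_apply_ι, contractLeft_ι_mul', contractLeft_ι_mul', h, map_sub,
      map_smul, map_mul, ExteriorAlgebra.map_apply_ι]
    rfl

theorem map_mem_exteriorPower (f : V →ₗ[ℂ] W) {n : ℕ} {z : ExteriorAlgebra ℂ V}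
    (hz : z ∈ ⋀[ℂ]^n V) : ExteriorAlgebra.map f z ∈ ⋀[ℂ]^n W := by
  induction hz using Submodule.pow_induction_on_left' with
  | algebraMap r => simp
  | add x y i hx hy h1 h2 => rw [map_add]; exact add_mem h1 h2
  | mem_mul m hm i x hx h =>
    obtain ⟨v, rfl⟩ := hm
    rw [map_mul, ExteriorAlgebra.map_apply_ι, ExteriorAlgebra.exteriorPower, pow_succ']
    exact Submodule.mul_mem_mul (LinearMap.mem_range_self _ _) h

/-- `ιInv` factors through the trivial square-zero extension of `V`, where a product of two vectors
is zero. It follows that nothing of degree one is exact when the differential maps generators into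
`⋀²`. -/
theorem ιInv_mul_of_mem {x : ExteriorAlgebra ℂ V} (hx : x ∈ ⋀[ℂ]^2 V) (z : ExteriorAlgebra ℂ V) :
    ExteriorAlgebra.ιInv (x * z) = 0 := by
  rw [ExteriorAlgebra.exteriorPower, pow_two] at hx
  -- The right action is part of the structure of the square-zero extension behind `ιInv`.
  let : Module ℂᵐᵒᵖ V := Module.compHom _ ((RingHom.id ℂ).fromOpposite mul_comm)
  have : IsCentralScalar ℂ V := ⟨fun r m => rfl⟩
  induction hx using Submodule.mul_induction_on' with
  | mem_mul_mem a ha b hb =>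
    obtain ⟨v, rfl⟩ := ha
    obtain ⟨w, rfl⟩ := hb
    simp [ExteriorAlgebra.ιInv]
  | add a _ b _ ha hb => rw [add_mul, map_add, ha, hb, add_zero]

theorem ιInv_ι (v : V) : ExteriorAlgebra.ιInv (ExteriorAlgebra.ι ℂ v) = v :=
  ExteriorAlgebra.ι_leftInverse v

variable [FiniteDimensional ℂ V] [FiniteDimensional ℂ W]

/-- Euler's identity in degree two: the factor is the degree. It recovers a 2-form from its
contractions. -/
theorem sum_ι_mul_contractLeft {η : ExteriorAlgebra ℂ V} (hη : η ∈ ⋀[ℂ]^2 V) :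
    ∑ k, ExteriorAlgebra.ι ℂ (Module.finBasis ℂ V k) *
      CliffordAlgebra.contractLeft ((Module.finBasis ℂ V).coord k) η = (2 : ℂ) • η := by
  rw [ExteriorAlgebra.exteriorPower, pow_two] at hη
  induction hη using Submodule.mul_induction_on' with
  | mem_mul_mem a ha b hb =>
    obtain ⟨v, rfl⟩ := ha
    obtain ⟨w, rfl⟩ := hb
    have e : ∀ k, ExteriorAlgebra.ι ℂ (Module.finBasis ℂ V k) *
        CliffordAlgebra.contractLeft ((Module.finBasis ℂ V).coord k)
          (ExteriorAlgebra.ι ℂ v * ExteriorAlgebra.ι ℂ w) =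
        ExteriorAlgebra.ι ℂ ((Module.finBasis ℂ V).repr v k • Module.finBasis ℂ V k) *
          ExteriorAlgebra.ι ℂ w -
        ExteriorAlgebra.ι ℂ ((Module.finBasis ℂ V).repr w k • Module.finBasis ℂ V k) *
          ExteriorAlgebra.ι ℂ v := by
      intro k
      rw [contractLeft_ι_mul', contractLeft_ι', ← Algebra.commutes, ← Algebra.smul_def]
      simp [mul_sub]
    simp only [e, Finset.sum_sub_distrib, ← Finset.sum_mul, ← map_sum,
      (Module.finBasis ℂ V).sum_repr]
    rw [eq_neg_of_add_eq_zero_left (ExteriorAlgebra.ι_add_mul_swap (R := ℂ) w v), two_smul]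
    abel
  | add a _ b _ ha hb => simp only [map_add, mul_add, Finset.sum_add_distrib, ha, hb, smul_add]

theorem eq_zero_of_contractLeft {η : ExteriorAlgebra ℂ V} (hη : η ∈ ⋀[ℂ]^2 V)
    (h : ∀ d d' : Module.Dual ℂ V, CliffordAlgebra.contractLeft d'
      (CliffordAlgebra.contractLeft d η) = 0) : η = 0 := by
  have h1 : ∀ d : Module.Dual ℂ V, CliffordAlgebra.contractLeft d η = 0 := by
    intro d
    have h2 := (contractLeft_mem d hη).2 1 rfl
    rw [ExteriorAlgebra.exteriorPower, pow_one] at h2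
    obtain ⟨v, hv⟩ := h2
    rw [← hv]
    have : v = 0 := by
      rw [← Module.forall_dual_apply_eq_zero_iff ℂ]
      intro d'
      have h3 := h d d'
      rw [← hv, contractLeft_ι'] at h3
      simpa using h3
    rw [this, map_zero]
  have h2 := sum_ι_mul_contractLeft hη
  simp only [h1, mul_zero, Finset.sum_const_zero] at h2
  exact (smul_eq_zero.1 h2.symm).resolve_left two_ne_zero

/-- Naturality of the Chevalley-Eilenberg differential under a linear map `χ`, at a form `α`. -/
theorem map_ceDiff_iff {K M : Type*} [AddCommGroup K] [Module ℂ K] [FiniteDimensional ℂ K]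
    [AddCommGroup M] [Module ℂ M] [FiniteDimensional ℂ M] (br : K →ₗ[ℂ] K →ₗ[ℂ] K)
    (br' : M →ₗ[ℂ] M →ₗ[ℂ] M) (hbr : ∀ x y, br x y = -br y x) (hbr' : ∀ x y, br' x y = -br' y x)
    (χ : K →ₗ[ℂ] M) (α : Module.Dual ℂ M) :
    ExteriorAlgebra.map χ.dualMap (ceDiff br' α) = ceDiff br (χ.dualMap α) ↔
      ∀ x y, α (br' (χ x) (χ y)) = α (χ (br x y)) := by
  have key : ∀ x y, CliffordAlgebra.contractLeft (Module.Dual.eval ℂ K y)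
      (CliffordAlgebra.contractLeft (Module.Dual.eval ℂ K x)
        (ExteriorAlgebra.map χ.dualMap (ceDiff br' α) - ceDiff br (χ.dualMap α))) =
      algebraMap ℂ (ExteriorAlgebra ℂ (Module.Dual ℂ K))
        (α (χ (br x y)) - α (br' (χ x) (χ y))) := by
    intro x y
    have e : ∀ z, Module.Dual.eval ℂ K z ∘ₗ χ.dualMap = Module.Dual.eval ℂ M (χ z) :=
      fun z => rfl
    rw [map_sub, map_sub, ceDiff_contract br hbr, contractLeft_map, contractLeft_map, e, e,
      ceDiff_contract br' hbr', AlgHom.commutes, ← map_sub]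
    congr 1
    simp
    ring
  constructor
  · intro h x y
    have := key x y
    rw [h, sub_self, map_zero, map_zero] at this
    have h2 := (map_eq_zero_iff _ (ExteriorAlgebra.algebraMap_leftInverse _).injective).1 this.symm
    exact (sub_eq_zero.1 h2).symm
  · intro h
    rw [← sub_eq_zero]
    refine eq_zero_of_contractLeft (sub_mem (map_mem_exteriorPower _ (ceDiff_mem _ _))
      (ceDiff_mem _ _)) fun d d' => ?_
    obtain ⟨x, rfl⟩ := (Module.evalEquiv ℂ K).surjective d
    obtain ⟨y, rfl⟩ := (Module.evalEquiv ℂ K).surjective d'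
    have := key x y
    rw [h, sub_self, map_zero] at this
    exact this

end ExteriorLemmas

/-! ### Homomorphisms of algebras generated in degree one -/

section Generated

variable {V W : Type*} [AddCommGroup V] [Module ℂ V] [AddCommGroup W] [Module ℂ W]
  [FiniteDimensional ℂ V] [FiniteDimensional ℂ W]

theorem extendBracket_algebraMap (br : V →ₗ[ℂ] V →ₗ[ℂ] V) (a : ExteriorAlgebra ℂ V) (r : ℂ) :
    extendBracket br a (algebraMap ℂ _ r) = 0 := by
  simp [extendBracket_apply]

theorem extendDiff_algebraMap (D : V →ₗ[ℂ] ExteriorAlgebra ℂ V) (r : ℂ) :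
    extendDiff D (algebraMap ℂ _ r) = 0 := by
  simp [extendDiff_apply]

/-- Both sides obey the same Leibniz rule in the second argument, and graded skew-symmetry moves a
generator from the second slot to the first. So the case of a generator in the first slot, `h1`, is
enough. -/
theorem map_extendBracket (br : V →ₗ[ℂ] V →ₗ[ℂ] V) (br' : W →ₗ[ℂ] W →ₗ[ℂ] W)
    (hbr : ∀ x y, br x y = -br y x) (hbr' : ∀ x y, br' x y = -br' y x) (f : V →ₗ[ℂ] W)
    (hf : ∀ x y, f (br x y) = br' (f x) (f y)) (a b : ExteriorAlgebra ℂ V) :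
    ExteriorAlgebra.map f (extendBracket br a b) =
      extendBracket br' (ExteriorAlgebra.map f a) (ExteriorAlgebra.map f b) := by
  have h1 : ∀ (v : V) (b : ExteriorAlgebra ℂ V),
      ExteriorAlgebra.map f (extendBracket br (ExteriorAlgebra.ι ℂ v) b) =
        extendBracket br' (ExteriorAlgebra.ι ℂ (f v)) (ExteriorAlgebra.map f b) := by
    intro v b
    induction b using exterior_left_induction with
    | algebraMap r => rw [extendBracket_algebraMap, AlgHom.commutes, extendBracket_algebraMap,
        map_zero]
    | add x y hx hy => simp only [map_add, hx, hy]
    | ι_mul w n x hx h =>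
      rw [map_mul (ExteriorAlgebra.map f), ExteriorAlgebra.map_apply_ι,
        extendBracket_mul br (ι_mem_exteriorPower_one v) (ι_mem_exteriorPower_one w),
        extendBracket_mul br' (ι_mem_exteriorPower_one _) (ι_mem_exteriorPower_one _),
        extendBracket_ι_ι, extendBracket_ι_ι, map_add, map_smul, map_mul, map_mul, h,
        ExteriorAlgebra.map_apply_ι, ExteriorAlgebra.map_apply_ι, hf]
  induction a using DirectSum.Decomposition.inductionOn (fun i : ℕ => ⋀[ℂ]^i V) with
  | zero => simp
  | @homogeneous i m =>
    obtain ⟨a, ha⟩ := m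
    change ExteriorAlgebra.map f (extendBracket br a b) =
      extendBracket br' (ExteriorAlgebra.map f a) (ExteriorAlgebra.map f b)
    have ha' := map_mem_exteriorPower f ha
    induction b using exterior_left_induction with
    | algebraMap r => rw [extendBracket_algebraMap, AlgHom.commutes, extendBracket_algebraMap,
        map_zero]
    | add x y hx hy => simp only [map_add, hx, hy]
    | ι_mul w n x hx h =>
      rw [map_mul (ExteriorAlgebra.map f), ExteriorAlgebra.map_apply_ι,
        extendBracket_mul br ha (ι_mem_exteriorPower_one w),
        extendBracket_mul br' ha' (ι_mem_exteriorPower_one _),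
        extendBracket_skew br hbr ha (ι_mem_exteriorPower_one w),
        extendBracket_skew br' hbr' ha' (ι_mem_exteriorPower_one _), map_add, map_smul, map_mul,
        map_mul, map_neg, map_smul, h, h1, ExteriorAlgebra.map_apply_ι]
  | add x y hx hy => simp only [map_add, LinearMap.add_apply, hx, hy]

theorem map_extendDiff (D : V →ₗ[ℂ] ExteriorAlgebra ℂ V) (D' : W →ₗ[ℂ] ExteriorAlgebra ℂ W)
    (hD : ∀ v, D v ∈ ⋀[ℂ]^2 V) (hD' : ∀ v, D' v ∈ ⋀[ℂ]^2 W) (f : V →ₗ[ℂ] W)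
    (hf : ∀ x, ExteriorAlgebra.map f (D x) = D' (f x)) (a : ExteriorAlgebra ℂ V) :
    ExteriorAlgebra.map f (extendDiff D a) = extendDiff D' (ExteriorAlgebra.map f a) := by
  induction a using exterior_left_induction with
  | algebraMap r => rw [extendDiff_algebraMap, AlgHom.commutes, extendDiff_algebraMap, map_zero]
  | add x y hx hy => simp only [map_add, hx, hy]
  | ι_mul w n x hx h =>
    rw [map_mul (ExteriorAlgebra.map f), ExteriorAlgebra.map_apply_ι,
      extendDiff_mul D hD (ι_mem_exteriorPower_one w),
      extendDiff_mul D' hD' (ι_mem_exteriorPower_one _), extendDiff_ι, extendDiff_ι, map_add,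
      map_smul, map_mul, map_mul, h, hf, ExteriorAlgebra.map_apply_ι]

/-- A linear isomorphism that respects brackets and differentials on generators gives a
quasi-isomorphism. -/
theorem exists_quasiIso_of_linearEquiv (br : V →ₗ[ℂ] V →ₗ[ℂ] V) (br' : W →ₗ[ℂ] W →ₗ[ℂ] W)
    (hbr : ∀ x y, br x y = -br y x) (hbr' : ∀ x y, br' x y = -br' y x)
    (D : V →ₗ[ℂ] ExteriorAlgebra ℂ V) (D' : W →ₗ[ℂ] ExteriorAlgebra ℂ W)
    (hD : ∀ v, D v ∈ ⋀[ℂ]^2 V) (hD' : ∀ v, D' v ∈ ⋀[ℂ]^2 W) (f : V ≃ₗ[ℂ] W)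
    (hf : ∀ x y, f (br x y) = br' (f x) (f y))
    (hf' : ∀ x, ExteriorAlgebra.map f.toLinearMap (D x) = D' (f x)) :
    ∃ φ : (ExteriorDGA.generatedBy br D).Hom (ExteriorDGA.generatedBy br' D'), φ.IsQuasiIso := by
  have hd := map_extendDiff D D' hD hD' f.toLinearMap hf'
  let φ : (ExteriorDGA.generatedBy br D).Hom (ExteriorDGA.generatedBy br' D') :=
    ⟨ExteriorAlgebra.map f.toLinearMap, fun n a ha => map_mem_exteriorPower _ ha,
      map_extendBracket br br' hbr hbr' f.toLinearMap hf, hd⟩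
  have inv1 : ∀ z, ExteriorAlgebra.map f.toLinearMap (ExteriorAlgebra.map f.symm.toLinearMap z) =
      z := by
    intro z
    rw [← AlgHom.comp_apply, ExteriorAlgebra.map_comp_map]
    simp
  have inv2 : ∀ z, ExteriorAlgebra.map f.symm.toLinearMap (ExteriorAlgebra.map f.toLinearMap z) =
      z := by
    intro z
    rw [← AlgHom.comp_apply, ExteriorAlgebra.map_comp_map]
    simp
  -- The inverse of a bijective chain map is again a chain map, so it inverts the map on cohomology.
  have hd' : ∀ z, ExteriorAlgebra.map f.symm.toLinearMap (extendDiff D' z) =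
      extendDiff D (ExteriorAlgebra.map f.symm.toLinearMap z) := by
    intro z
    rw [← inv2 (extendDiff D _), hd, inv1]
  refine ⟨φ, ?_, ?_⟩
  · rw [← LinearMap.ker_eq_bot, LinearMap.ker_eq_bot']
    intro c hc
    obtain ⟨⟨a, ha⟩, rfl⟩ := Submodule.Quotient.mk_surjective _ c
    have h1 : φ.mapCocycles ⟨a, ha⟩ ∈ (ExteriorDGA.generatedBy br' D').boundaries :=
      (Submodule.Quotient.mk_eq_zero _).1 hc
    obtain ⟨b, hb⟩ := h1
    refine (Submodule.Quotient.mk_eq_zero _).2 ⟨ExteriorAlgebra.map f.symm.toLinearMap b, ?_⟩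
    change extendDiff D _ = a
    rw [← hd']
    refine Eq.trans (congrArg _ hb) ?_
    exact inv2 a
  · intro c
    obtain ⟨⟨a, ha⟩, rfl⟩ := Submodule.Quotient.mk_surjective _ c
    have ha' : extendDiff D (ExteriorAlgebra.map f.symm.toLinearMap a) = 0 := by
      rw [← hd']
      exact (congrArg _ ha).trans (map_zero _)
    refine ⟨Submodule.Quotient.mk ⟨ExteriorAlgebra.map f.symm.toLinearMap a, ha'⟩, ?_⟩
    change Submodule.Quotient.mk (φ.mapCocycles _) = _
    congr 1
    exact Subtype.ext (inv1 a)

/-- What a quasi-isomorphism does on generators. -/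
theorem exists_linearMap_of_quasiIso (br : V →ₗ[ℂ] V →ₗ[ℂ] V) (br' : W →ₗ[ℂ] W →ₗ[ℂ] W)
    (D : V →ₗ[ℂ] ExteriorAlgebra ℂ V) (D' : W →ₗ[ℂ] ExteriorAlgebra ℂ W)
    (hD : ∀ v, D v ∈ ⋀[ℂ]^2 V)
    (φ : (ExteriorDGA.generatedBy br D).Hom (ExteriorDGA.generatedBy br' D'))
    (hφ : φ.IsQuasiIso) :
    ∃ f : V →ₗ[ℂ] W, (∀ x y, f (br x y) = br' (f x) (f y)) ∧
      (∀ x, ExteriorAlgebra.map f (D x) = D' (f x)) ∧ ∀ x, D x = 0 → f x = 0 → x = 0 := by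
  let f : V →ₗ[ℂ] W := ExteriorAlgebra.ιInv ∘ₗ φ.toAlgHom.toLinearMap ∘ₗ ExteriorAlgebra.ι ℂ
  have hf : ∀ v, φ.toAlgHom (ExteriorAlgebra.ι ℂ v) = ExteriorAlgebra.ι ℂ (f v) := by
    intro v
    have h := φ.map_degree 1 _ (ι_mem_exteriorPower_one v)
    rw [ExteriorAlgebra.exteriorPower, pow_one] at h
    obtain ⟨w, hw⟩ := h
    change _ = ExteriorAlgebra.ι ℂ (ExteriorAlgebra.ιInv (φ.toAlgHom (ExteriorAlgebra.ι ℂ v)))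
    rw [← hw, ιInv_ι]
  have hφf : φ.toAlgHom = ExteriorAlgebra.map f := by
    ext v
    simpa using hf v
  refine ⟨f, fun x y => ?_, fun x => ?_, fun x hx hfx => ?_⟩
  · have h := φ.map_bracket (ExteriorAlgebra.ι ℂ x) (ExteriorAlgebra.ι ℂ y)
    rw [hf, hf] at h
    change φ.toAlgHom (extendBracket br _ _) = extendBracket br' _ _ at h
    rw [extendBracket_ι_ι, extendBracket_ι_ι, hf] at h
    exact (ExteriorAlgebra.ι_inj ℂ _ _).1 h
  · have h := φ.map_diff (ExteriorAlgebra.ι ℂ x)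
    rw [hf] at h
    change φ.toAlgHom (extendDiff D _) = extendDiff D' _ at h
    rwa [extendDiff_ι, extendDiff_ι, hφf] at h
  · have hc : ExteriorAlgebra.ι ℂ x ∈ LinearMap.ker (ExteriorDGA.generatedBy br D).diff := by
      change extendDiff D _ = 0
      rw [extendDiff_ι, hx]
    have h0 : φ.mapCohomology (Submodule.Quotient.mk ⟨_, hc⟩) = 0 := by
      change Submodule.Quotient.mk (φ.mapCocycles _) = 0
      have : φ.mapCocycles ⟨_, hc⟩ = 0 := Subtype.ext ((hf x).trans (by rw [hfx, map_zero]; rfl))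
      rw [this]
      rfl
    have h1 : (Submodule.Quotient.mk ⟨_, hc⟩ : (ExteriorDGA.generatedBy br D).Cohomology) = 0 :=
      hφ.1 (h0.trans (map_zero _).symm)
    obtain ⟨c, hc'⟩ := (Submodule.Quotient.mk_eq_zero _).1 h1
    have h2 : extendDiff D c = ExteriorAlgebra.ι ℂ x := hc'
    -- A closed generator killed by `f` is exact. Every term of `extendDiff D c` has a factor in
    -- `⋀²`, so its degree-one part, read by `ιInv`, is zero.
    rw [← ιInv_ι x, ← h2, extendDiff_apply, map_sum]
    exact Finset.sum_eq_zero fun k _ => ιInv_mul_of_mem (hD _) _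

end Generated

/-! ### Surjectivity modulo brackets -/

section Nilpotent

/-- If a homomorphism `χ` into a nilpotent algebra is surjective modulo brackets, then it is
surjective. -/
theorem surjective_of_nilpotent {K M : Type*} [AddCommGroup K] [Module ℂ K]
    [AddCommGroup M] [Module ℂ M] (br : K →ₗ[ℂ] K →ₗ[ℂ] K)
    (br' : M →ₗ[ℂ] M →ₗ[ℂ] M) (hbr' : ∀ x y, br' x y = -br' y x) (χ : K →ₗ[ℂ] M)
    (hχ : ∀ x y, br' (χ x) (χ y) = χ (br x y)) (S : ℕ → Submodule ℂ M) (h0 : S 0 = ⊤)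
    (hS : ∀ j x, ∀ y ∈ S j, br' x y ∈ S (j + 1)) (n : ℕ) (hn : S n = ⊥)
    (h : ∀ α : Module.Dual ℂ M, (∀ x y, α (br' x y) = 0) → (∀ x, α (χ x) = 0) → α = 0) :
    Function.Surjective χ := by
  have key : ∀ j, LinearMap.range χ ⊔ S j = ⊤ := by
    intro j
    induction j with
    | zero => rw [h0, sup_top_eq]
    | succ j ih =>
      -- A form `α` vanishing on `range χ + S (j + 1)` also kills all brackets: by induction the two
      -- entries lie in the range up to `S j`, and the corrections change the bracket only within `S
      -- (j + 1)`.
      by_contra hne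
      obtain ⟨α, hα, hle⟩ := Submodule.exists_le_ker_of_lt_top _ (lt_top_iff_ne_top.2 hne)
      refine hα (h α (fun x y => ?_) fun x => ?_)
      · obtain ⟨_, ⟨a, rfl⟩, f, hf, rfl⟩ := Submodule.mem_sup.1 (ih ▸ Submodule.mem_top : x ∈ _)
        obtain ⟨_, ⟨b, rfl⟩, f', hf', rfl⟩ := Submodule.mem_sup.1 (ih ▸ Submodule.mem_top : y ∈ _)
        refine hle ?_
        rw [map_add (br' _), map_add br', LinearMap.add_apply, hχ, hbr' f (χ b), add_assoc]
        refine Submodule.add_mem_sup ⟨_, rfl⟩ (add_mem (neg_mem (hS _ _ _ hf)) ?_)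
        rw [← map_add br']
        exact hS _ _ _ hf'
      · exact hle (Submodule.mem_sup_left ⟨x, rfl⟩)
  have := key n
  rw [hn, sup_bot_eq] at this
  exact LinearMap.range_eq_top.1 this

end Nilpotent

end WeakSelfMirror

/-! ### The left symmetric product and adapted bases of `A` -/

namespace WeakSelfMirror

open scoped ComplexConjugate

/-- The complexification of a pseudo-Kähler Lie algebra: a complex Lie algebra with a real
structure `σ`, a real symplectic form `Om`, the left symmetric product `mul` that it defines, and
a Lagrangian subalgebra `A` complementary to its conjugate. -/
structure PKData (L : Type*) [LieRing L] [LieAlgebra ℂ L] where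
  σ : L →ₛₗ[starRingEnd ℂ] L
  Om : L →ₗ[ℂ] L →ₗ[ℂ] ℂ
  mul : L →ₗ[ℂ] L →ₗ[ℂ] L
  A : Submodule ℂ L
  σ_σ : ∀ x, σ (σ x) = x
  σ_lie : ∀ x y, σ ⁅x, y⁆ = ⁅σ x, σ y⁆
  Om_σ : ∀ x y, Om (σ x) (σ y) = conj (Om x y)
  Om_self : ∀ x, Om x x = 0
  nondeg : ∀ x, (∀ y, Om x y = 0) → x = 0
  closed : ∀ x y z, Om ⁅x, y⁆ z + Om ⁅y, z⁆ x + Om ⁅z, x⁆ y = 0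
  Om_mul : ∀ x y z, Om (mul x y) z = -Om y ⁅x, z⁆
  lie_mem : ∀ x ∈ A, ∀ y ∈ A, ⁅x, y⁆ ∈ A
  isotropic : ∀ x ∈ A, ∀ y ∈ A, Om x y = 0
  exists_add : ∀ x, ∃ y ∈ A, ∃ z ∈ A, x = y + σ z

namespace PKData

variable {L : Type*} [LieRing L] [LieAlgebra ℂ L] (D : PKData L)

theorem Om_skew (x y : L) : D.Om x y = -D.Om y x := by
  have h := D.Om_self (x + y)
  simp only [map_add, LinearMap.add_apply, D.Om_self] at h
  linear_combination h

theorem ext_Om {x y : L} (h : ∀ z, D.Om x z = D.Om y z) : x = y := by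
  rw [← sub_eq_zero]
  refine D.nondeg _ fun z => ?_
  rw [map_sub, LinearMap.sub_apply, h, sub_self]

theorem Om_lie (x l y : L) : D.Om ⁅x, l⁆ y = D.Om (D.mul x y) l := by
  rw [D.Om_mul, D.Om_skew]

/-- This is closedness of `Om`: the product is a torsion-free connection. -/
theorem mul_sub_mul (x y : L) : D.mul x y - D.mul y x = ⁅x, y⁆ := by
  refine D.ext_Om fun z => ?_
  rw [map_sub, LinearMap.sub_apply, D.Om_mul, D.Om_mul]
  have h := D.closed x y z
  rw [D.Om_skew ⁅y, z⁆ x, D.Om_skew ⁅z, x⁆ y, ← lie_skew z x, map_neg] at h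
  linear_combination -h

/-- The operators `mul x` are minus the `Om`-adjoints of `ad x`, so the Jacobi identity makes the
connection flat. Together with `mul_sub_mul` this is left symmetry. -/
theorem mul_lie (x y z : L) :
    D.mul ⁅x, y⁆ z = D.mul x (D.mul y z) - D.mul y (D.mul x z) := by
  refine D.ext_Om fun l => ?_
  rw [map_sub, LinearMap.sub_apply, D.Om_mul, D.Om_mul, D.Om_mul, D.Om_mul, D.Om_mul, lie_lie,
    map_sub]
  ring

theorem σ_mul (x y : L) : D.σ (D.mul x y) = D.mul (D.σ x) (D.σ y) := by
  refine D.ext_Om fun z => ?_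
  rw [← D.σ_σ z, D.Om_σ, D.Om_mul, D.Om_mul, ← D.σ_lie, D.Om_σ, map_neg]

theorem Om_conj (x y : L) : D.Om (D.σ x) y = conj (D.Om x (D.σ y)) := by
  rw [← D.Om_σ, D.σ_σ]

theorem isotropic_σ {x y : L} (hx : x ∈ D.A) (hy : y ∈ D.A) : D.Om (D.σ x) (D.σ y) = 0 := by
  rw [D.Om_σ, D.isotropic x hx y hy, map_zero]

/-- `A` is its own orthogonal: the conjugate component of `x` is orthogonal to `A` by hypothesis and
to `D.σ` of `A` by isotropy, hence zero. -/
theorem mem_of_Om {x : L} (h : ∀ y ∈ D.A, D.Om x y = 0) : x ∈ D.A := by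
  obtain ⟨y, hy, z, hz, rfl⟩ := D.exists_add x
  have : D.σ z = 0 := by
    refine D.nondeg _ fun l => ?_
    obtain ⟨p, hp, q, hq, rfl⟩ := D.exists_add l
    have h1 := h p hp
    rw [map_add, LinearMap.add_apply, D.isotropic y hy p hp, zero_add] at h1
    rw [map_add, h1, D.isotropic_σ hz hq, add_zero]
  rw [this, add_zero]
  exact hy

theorem mul_mem {x y : L} (hx : x ∈ D.A) (hy : y ∈ D.A) : D.mul x y ∈ D.A :=
  D.mem_of_Om fun z hz => by
    rw [D.Om_mul, D.isotropic y hy _ (D.lie_mem x hx z hz), neg_zero]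

theorem eq_zero_of_mem {x : L} (hx : x ∈ D.A) (hσ : D.σ x ∈ D.A) : x = 0 := by
  refine D.nondeg _ fun l => ?_
  obtain ⟨p, hp, q, hq, rfl⟩ := D.exists_add l
  have h := D.isotropic_σ hσ hq
  rw [D.σ_σ] at h
  rw [map_add, D.isotropic x hx p hp, h, add_zero]

/-- A basis `a, w, u` of `A` adapted to the left symmetric product. -/
structure Frame (D : PKData L) (a w u : L) (β γ α κ δ : ℂ) : Prop where
  a_mem : a ∈ D.A
  w_mem : w ∈ D.A
  u_mem : u ∈ D.A
  span : ∀ x ∈ D.A, ∃ c₁ c₂ c₃ : ℂ, x = c₁ • a + c₂ • w + c₃ • u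
  indep : ∀ c₁ c₂ c₃ : ℂ, c₁ • a + c₂ • w + c₃ • u = 0 → c₁ = 0 ∧ c₂ = 0 ∧ c₃ = 0
  aa : D.mul a a = β • w + γ • u
  aw : D.mul a w = α • u
  wa : D.mul w a = κ • u
  ww : D.mul w w = δ • u
  au : D.mul a u = 0
  ua : D.mul u a = 0
  wu : D.mul w u = 0
  uw : D.mul u w = 0
  uu : D.mul u u = 0

/-- The hypothesis is applied to `0`, to the line of `u` and to the plane of `w, u`. All left
multiplications by elements of `A` become strictly triangular for the resulting flag. -/
theorem exists_basis_of_flag [FiniteDimensional ℂ L] (hfin : Module.finrank ℂ D.A = 3)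
    (hP : ∀ S : Submodule ℂ L, ¬D.A ≤ S → ∃ x ∈ D.A, x ∉ S ∧ ∀ y ∈ D.A, D.mul y x ∈ S) :
    ∃ a ∈ D.A, ∃ w ∈ D.A, ∃ u ∈ D.A,
      (∀ x ∈ D.A, ∃ c₁ c₂ c₃ : ℂ, x = c₁ • a + c₂ • w + c₃ • u) ∧
      (∀ c₁ c₂ c₃ : ℂ, c₁ • a + c₂ • w + c₃ • u = 0 → c₁ = 0 ∧ c₂ = 0 ∧ c₃ = 0) ∧
      (∀ x ∈ D.A, ∃ c₁ c₂ : ℂ, D.mul x a = c₁ • w + c₂ • u) ∧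
      (∀ x ∈ D.A, ∃ c : ℂ, D.mul x w = c • u) ∧ ∀ x ∈ D.A, D.mul x u = 0 := by
  have small : ∀ s : Finset L, s.card < 3 → ¬D.A ≤ Submodule.span ℂ (s : Set L) := by
    intro s hs hle
    have h1 := Submodule.finrank_mono hle
    have h2 := finrank_span_finset_le_card (R := ℂ) s
    simp only [Set.finrank] at h2
    omega
  classical
  obtain ⟨u, hu, hu0, hun⟩ := hP ⊥ (by simpa using small ∅ (by simp))
  obtain ⟨w, hw, hw0, hwn⟩ := hP (Submodule.span ℂ {u}) (by simpa using small {u} (by simp))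
  obtain ⟨a, ha, ha0, han⟩ := hP (Submodule.span ℂ {w, u})
    (by simpa using small {w, u} (lt_of_le_of_lt (Finset.card_le_two) (by norm_num)))
  simp only [Submodule.mem_bot] at hu0 hun
  simp only [Submodule.mem_span_singleton] at hw0 hwn
  simp only [Submodule.mem_span_pair] at ha0 han
  have hind : ∀ c₁ c₂ c₃ : ℂ, c₁ • a + c₂ • w + c₃ • u = 0 → c₁ = 0 ∧ c₂ = 0 ∧ c₃ = 0 := by
    intro c₁ c₂ c₃ h
    have h1 : c₁ = 0 := by
      by_contra h1
      refine ha0 ⟨-c₁⁻¹ * c₂, -c₁⁻¹ * c₃, ?_⟩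
      have h2 : c₁⁻¹ • (c₁ • a + c₂ • w + c₃ • u) = 0 := by rw [h, smul_zero]
      rw [smul_add, smul_add, smul_smul, inv_mul_cancel₀ h1, one_smul] at h2
      rw [← sub_eq_zero, ← neg_eq_zero, ← h2]
      module
    subst h1
    have h2 : c₂ = 0 := by
      by_contra h1
      refine hw0 ⟨-c₂⁻¹ * c₃, ?_⟩
      have h2 : c₂⁻¹ • ((0 : ℂ) • a + c₂ • w + c₃ • u) = 0 := by rw [h, smul_zero]
      rw [smul_add, smul_add, smul_smul c₂⁻¹ c₂, inv_mul_cancel₀ h1, one_smul] at h2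
      rw [← sub_eq_zero, ← neg_eq_zero, ← h2]
      module
    subst h2
    simp only [zero_smul, zero_add] at h
    exact ⟨rfl, rfl, (smul_eq_zero.1 h).resolve_right hu0⟩
  have hli : LinearIndependent ℂ ![(⟨a, ha⟩ : D.A), ⟨w, hw⟩, ⟨u, hu⟩] := by
    rw [Fintype.linearIndependent_iff]
    intro c hc
    simp only [Fin.sum_univ_three, Matrix.cons_val_zero, Matrix.cons_val_one,
      Matrix.cons_val_two] at hc
    have h := hind (c 0) (c 1) (c 2) (by simpa using congrArg Subtype.val hc)
    intro i
    fin_cases i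
    exacts [h.1, h.2.1, h.2.2]
  have hsp := hli.span_eq_top_of_card_eq_finrank' (by simp [hfin])
  refine ⟨a, ha, w, hw, u, hu, fun x hx => ?_, hind, fun x hx => ?_, fun x hx => ?_, hun⟩
  · have : (⟨x, hx⟩ : D.A) ∈ Submodule.span ℂ (Set.range ![(⟨a, ha⟩ : D.A), ⟨w, hw⟩, ⟨u, hu⟩]) := by
      rw [hsp]; trivial
    obtain ⟨c, hc⟩ := (Submodule.mem_span_range_iff_exists_fun ℂ).1 this
    simp only [Fin.sum_univ_three] at hc
    exact ⟨c 0, c 1, c 2, by simpa using (congrArg Subtype.val hc).symm⟩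
  · obtain ⟨c, d, h⟩ := han x hx; exact ⟨c, d, h.symm⟩
  · obtain ⟨c, h⟩ := hwn x hx; exact ⟨c, h.symm⟩

/-- The flag leaves unknown coefficients in the left multiplications by `a`, `w` and `u`. The left
symmetry identity `mul_lie` on triples of basis vectors removes most of them, after a change of
basis when `D.mul u a` has a `w`-component. -/
theorem exists_frame [FiniteDimensional ℂ L] (hfin : Module.finrank ℂ D.A = 3)
    (hP : ∀ S : Submodule ℂ L, ¬D.A ≤ S → ∃ x ∈ D.A, x ∉ S ∧ ∀ y ∈ D.A, D.mul y x ∈ S) :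
    ∃ (a w u : L) (β γ α κ δ : ℂ), D.Frame a w u β γ α κ δ ∧ β * δ = 0 := by
  obtain ⟨a, ha, w, hw, u, hu, hspan, hind, h1, h2, h3⟩ := D.exists_basis_of_flag hfin hP
  obtain ⟨βa, γa, aa⟩ := h1 a ha
  obtain ⟨βw, γw, wa⟩ := h1 w hw
  obtain ⟨βu, γu, ua⟩ := h1 u hu
  obtain ⟨αa, aw⟩ := h2 a ha
  obtain ⟨αw, ww⟩ := h2 w hw
  obtain ⟨αu, uw⟩ := h2 u hu
  have au := h3 a ha
  have wu := h3 w hw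
  have uu := h3 u hu
  -- This identity reduces to `αu ^ 2 = 0`, so `u` multiplies `w` to zero.
  have E1 := D.mul_lie w u w
  rw [← D.mul_sub_mul] at E1
  simp only [map_sub, map_smul, LinearMap.sub_apply, LinearMap.smul_apply, ww, uw, wu, uu,
    LinearMap.zero_apply, map_zero] at E1
  obtain ⟨-, -, e1⟩ := hind 0 0 (αu * αu) (by linear_combination (norm := module) -E1)
  obtain rfl : αu = 0 := by simpa using e1
  have E2 := D.mul_lie w u a
  have E3 := D.mul_lie a u a
  have E4 := D.mul_lie a w w
  have E5 := D.mul_lie a w a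
  rw [← D.mul_sub_mul] at E2 E3 E4 E5
  simp only [map_sub, map_add, map_smul, LinearMap.sub_apply, LinearMap.add_apply,
    LinearMap.smul_apply, aa, wa, ua, aw, ww, uw, au, wu, uu, LinearMap.zero_apply, map_zero]
    at E2 E3 E4 E5
  obtain ⟨-, -, e2⟩ := hind 0 0 (βu * αw) (by linear_combination (norm := module) -E2)
  obtain ⟨-, e3, e3'⟩ := hind 0 (-βu * (βw + γu)) (-βu * γw - γu * γu - βu * αa)
    (by linear_combination (norm := module) E3)
  obtain ⟨-, e5, e5'⟩ := hind 0 ((αa - γw) * βu - βw * βw)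
    ((αa - γw) * γu - βw * γw - βw * αa + βa * αw) (by linear_combination (norm := module) E5)
  by_cases hβ : βu = 0
  · subst hβ
    obtain rfl : γu = 0 := by simpa using e3'
    obtain rfl : βw = 0 := by simpa using e5
    refine ⟨a, w, u, βa, γa, αa, γw, αw, ⟨ha, hw, hu, hspan, hind, aa, aw, ?_, ww, au, ?_, wu,
      ?_, uu⟩, ?_⟩
    · simpa using wa
    · simpa using ua
    · simpa using uw
    · simpa using e5'
  · obtain rfl : αw = 0 := by simpa [hβ] using e2
    obtain rfl : γu = -βw := by
      have := e3
      simp only [neg_mul, neg_eq_zero, mul_eq_zero, hβ, false_or] at this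
      linear_combination this
    obtain rfl : αa = 0 := by
      have h6 : αa * βw = 0 := by linear_combination (-1 / 2 : ℂ) * e5'
      rcases mul_eq_zero.1 h6 with h | rfl
      · exact h
      · have h7 : αa - γw = 0 := by simpa [hβ] using e5
        have h8 : αa + γw = 0 := by
          have : βu * (αa + γw) = 0 := by linear_combination -e3'
          simpa [hβ] using this
        linear_combination (h7 + h8) / 2
    -- If `βu ≠ 0`, the product `D.mul u a` equals `βu • w - βw • u`. It becomes the last basis
    -- vector and `u` the middle one, so that `κ = 1` and `α = δ = 0`.
    refine ⟨a, u, βu • w + (-βw) • u, γa + βa * βw / βu, βa / βu, 0, 1, 0,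
      ⟨ha, hu, add_mem (D.A.smul_mem _ hw) (D.A.smul_mem _ hu), fun x hx => ?_,
      fun c₁ c₂ c₃ h => ?_, ?_, ?_, ?_, ?_, ?_, ?_, ?_, ?_, ?_⟩, by simp⟩
    · obtain ⟨c₁, c₂, c₃, rfl⟩ := hspan x hx
      refine ⟨c₁, c₃ + c₂ * βw / βu, c₂ / βu, ?_⟩
      match_scalars <;> field_simp
      ring
    · obtain ⟨k1, k2, k3⟩ := hind c₁ (c₃ * βu) (c₂ - c₃ * βw) (by
        rw [← h]; module)
      have k4 : c₃ = 0 := by simpa [hβ] using k2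
      subst k4
      exact ⟨k1, by simpa using k3, rfl⟩
    · rw [aa]
      match_scalars <;> field_simp
      ring
    · simp [au]
    · rw [ua]; simp
    · simp [uu]
    · simp [aw, au]
    · simp only [map_add, map_smul, LinearMap.add_apply, LinearMap.smul_apply, wa, ua]
      match_scalars
      · ring
      · linear_combination -e3'
    · simp [uw, uu]
    · simp [wu, uu]
    · simp [ww, wu, uw, uu]

end PKData

end WeakSelfMirror

/-! ### Brackets read from a frame and from a self-mirror structure -/

namespace WeakSelfMirror

open scoped ComplexConjugate

theorem not_indep_of_mem_span_pair {L : Type*} [AddCommGroup L] [Module ℂ L] {η₁ η₂ x y z : L}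
    (hx : x ∈ Submodule.span ℂ {η₁, η₂}) (hy : y ∈ Submodule.span ℂ {η₁, η₂})
    (hz : z ∈ Submodule.span ℂ {η₁, η₂})
    (h : ∀ c₁ c₂ c₃ : ℂ, c₁ • x + c₂ • y + c₃ • z = 0 → c₁ = 0 ∧ c₂ = 0 ∧ c₃ = 0) : False := by
  classical
  have hli : LinearIndependent ℂ ![x, y, z] := by
    rw [Fintype.linearIndependent_iff]
    intro c hc
    simp only [Fin.sum_univ_three, Matrix.cons_val_zero, Matrix.cons_val_one,
      Matrix.cons_val_two] at hc
    have h := h (c 0) (c 1) (c 2) (by simpa using hc)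
    intro i
    fin_cases i
    exacts [h.1, h.2.1, h.2.2]
  have h1 := linearIndependent_le_span_aux' _ hli ↑({η₁, η₂} : Finset L) (by
    rintro _ ⟨i, rfl⟩
    fin_cases i <;> simp [hx, hy, hz])
  have h2 : ({η₁, η₂} : Finset L).card ≤ 2 := Finset.card_le_two
  simp only [Fintype.card_fin, Fintype.card_coe, Finset.coe_sort_coe] at h1
  omega

namespace PKData

variable {L : Type*} [LieRing L] [LieAlgebra ℂ L] {D : PKData L}

/-- Together with `Om_lie` this determines every mixed bracket `⁅x, D.σ z⁆`: pairings with `A` come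
from the product `D.mul x`, pairings with the conjugate of `A` from the conjugate of `D.mul z`. -/
theorem Om_lie_σ (x z y : L) : D.Om ⁅x, D.σ z⁆ (D.σ y) = -D.Om (D.σ (D.mul z y)) x := by
  rw [← lie_skew, map_neg, LinearMap.neg_apply, D.Om_lie, D.σ_mul]

theorem Om_table_of_mem {a w u : L} (ha : a ∈ D.A) (hw : w ∈ D.A) (hu : u ∈ D.A)
    {s r q p n m : ℂ} (hs : D.Om a (D.σ a) = s) (hr : D.Om a (D.σ w) = r)
    (hq : D.Om a (D.σ u) = q) (hp : D.Om w (D.σ w) = p) (hn : D.Om w (D.σ u) = n)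
    (hm : D.Om u (D.σ u) = m) :
    (D.Om a (D.σ a) = s ∧ D.Om a (D.σ w) = r ∧ D.Om a (D.σ u) = q ∧
      D.Om w (D.σ a) = -conj r ∧ D.Om w (D.σ w) = p ∧ D.Om w (D.σ u) = n ∧
      D.Om u (D.σ a) = -conj q ∧ D.Om u (D.σ w) = -conj n ∧ D.Om u (D.σ u) = m) ∧
    (D.Om (D.σ a) a = -s ∧ D.Om (D.σ w) a = -r ∧ D.Om (D.σ u) a = -q ∧
      D.Om (D.σ a) w = conj r ∧ D.Om (D.σ w) w = -p ∧ D.Om (D.σ u) w = -n ∧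
      D.Om (D.σ a) u = conj q ∧ D.Om (D.σ w) u = conj n ∧ D.Om (D.σ u) u = -m) ∧
    (D.Om a a = 0 ∧ D.Om a w = 0 ∧ D.Om a u = 0 ∧ D.Om w a = 0 ∧ D.Om w w = 0 ∧ D.Om w u = 0 ∧
      D.Om u a = 0 ∧ D.Om u w = 0 ∧ D.Om u u = 0) ∧
    (D.Om (D.σ a) (D.σ a) = 0 ∧ D.Om (D.σ a) (D.σ w) = 0 ∧ D.Om (D.σ a) (D.σ u) = 0 ∧
      D.Om (D.σ w) (D.σ a) = 0 ∧ D.Om (D.σ w) (D.σ w) = 0 ∧ D.Om (D.σ w) (D.σ u) = 0 ∧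
      D.Om (D.σ u) (D.σ a) = 0 ∧ D.Om (D.σ u) (D.σ w) = 0 ∧ D.Om (D.σ u) (D.σ u) = 0) := by
  have h1 : ∀ x y, D.Om x (D.σ y) = -conj (D.Om y (D.σ x)) := fun x y => by
    rw [D.Om_skew, D.Om_conj]
  have h2 : ∀ x y, D.Om (D.σ x) y = -D.Om y (D.σ x) := fun x y => D.Om_skew _ _
  refine ⟨⟨hs, hr, hq, ?_, hp, hn, ?_, ?_, hm⟩, ⟨?_, ?_, ?_, ?_, ?_, ?_, ?_, ?_, ?_⟩,
    ⟨?_, ?_, ?_, ?_, ?_, ?_, ?_, ?_, ?_⟩, ?_, ?_, ?_, ?_, ?_, ?_, ?_, ?_, ?_⟩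
  · rw [h1, hr]
  · rw [h1, hq]
  · rw [h1, hn]
  · rw [h2, hs]
  · rw [h2, hr]
  · rw [h2, hq]
  · rw [h2, h1, hr, neg_neg]
  · rw [h2, hp]
  · rw [h2, hn]
  · rw [h2, h1, hq, neg_neg]
  · rw [h2, h1, hn, neg_neg]
  · rw [h2, hm]
  all_goals first
    | exact D.isotropic _ (by assumption) _ (by assumption)
    | exact D.isotropic_σ (by assumption) (by assumption)

namespace Frame

variable {a w u : L} {β γ α κ δ : ℂ} (F : D.Frame a w u β γ α κ δ)
include F

theorem Om_table {s r q p n m : ℂ} (hs : D.Om a (D.σ a) = s) (hr : D.Om a (D.σ w) = r)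
    (hq : D.Om a (D.σ u) = q) (hp : D.Om w (D.σ w) = p) (hn : D.Om w (D.σ u) = n)
    (hm : D.Om u (D.σ u) = m) :
    (D.Om a (D.σ a) = s ∧ D.Om a (D.σ w) = r ∧ D.Om a (D.σ u) = q ∧
      D.Om w (D.σ a) = -conj r ∧ D.Om w (D.σ w) = p ∧ D.Om w (D.σ u) = n ∧
      D.Om u (D.σ a) = -conj q ∧ D.Om u (D.σ w) = -conj n ∧ D.Om u (D.σ u) = m) ∧
    (D.Om (D.σ a) a = -s ∧ D.Om (D.σ w) a = -r ∧ D.Om (D.σ u) a = -q ∧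
      D.Om (D.σ a) w = conj r ∧ D.Om (D.σ w) w = -p ∧ D.Om (D.σ u) w = -n ∧
      D.Om (D.σ a) u = conj q ∧ D.Om (D.σ w) u = conj n ∧ D.Om (D.σ u) u = -m) ∧
    (D.Om a a = 0 ∧ D.Om a w = 0 ∧ D.Om a u = 0 ∧ D.Om w a = 0 ∧ D.Om w w = 0 ∧ D.Om w u = 0 ∧
      D.Om u a = 0 ∧ D.Om u w = 0 ∧ D.Om u u = 0) ∧
    (D.Om (D.σ a) (D.σ a) = 0 ∧ D.Om (D.σ a) (D.σ w) = 0 ∧ D.Om (D.σ a) (D.σ u) = 0 ∧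
      D.Om (D.σ w) (D.σ a) = 0 ∧ D.Om (D.σ w) (D.σ w) = 0 ∧ D.Om (D.σ w) (D.σ u) = 0 ∧
      D.Om (D.σ u) (D.σ a) = 0 ∧ D.Om (D.σ u) (D.σ w) = 0 ∧ D.Om (D.σ u) (D.σ u) = 0) :=
  D.Om_table_of_mem F.a_mem F.w_mem F.u_mem hs hr hq hp hn hm

theorem exists_coords (l : L) : ∃ c₁ c₂ c₃ c₄ c₅ c₆ : ℂ,
    l = c₁ • a + c₂ • w + c₃ • u + c₄ • D.σ a + c₅ • D.σ w + c₆ • D.σ u := by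
  obtain ⟨x, hx, y, hy, rfl⟩ := D.exists_add l
  obtain ⟨c₁, c₂, c₃, rfl⟩ := F.span x hx
  obtain ⟨d₁, d₂, d₃, rfl⟩ := F.span y hy
  refine ⟨c₁, c₂, c₃, conj d₁, conj d₂, conj d₃, ?_⟩
  simp only [map_add, map_smulₛₗ]
  module

theorem ext {x y : L} (ha : D.Om x a = D.Om y a) (hw : D.Om x w = D.Om y w)
    (hu : D.Om x u = D.Om y u) (ha' : D.Om x (D.σ a) = D.Om y (D.σ a))
    (hw' : D.Om x (D.σ w) = D.Om y (D.σ w)) (hu' : D.Om x (D.σ u) = D.Om y (D.σ u)) : x = y := by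
  refine D.ext_Om fun z => ?_
  obtain ⟨c₁, c₂, c₃, c₄, c₅, c₆, rfl⟩ := F.exists_coords z
  simp only [map_add, map_smul, ha, hw, hu, ha', hw', hu']

/-- The relation puts the conjugate of the `A`-part back into `A`, and `A` meets its conjugate only
in zero. -/
theorem indep₆ {c₁ c₂ c₃ c₄ c₅ c₆ : ℂ}
    (h : c₁ • a + c₂ • w + c₃ • u + c₄ • D.σ a + c₅ • D.σ w + c₆ • D.σ u = 0) :
    c₁ = 0 ∧ c₂ = 0 ∧ c₃ = 0 ∧ c₄ = 0 ∧ c₅ = 0 ∧ c₆ = 0 := by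
  have hm : ∀ d₁ d₂ d₃ : ℂ, d₁ • a + d₂ • w + d₃ • u ∈ D.A := fun d₁ d₂ d₃ =>
    add_mem (add_mem (D.A.smul_mem _ F.a_mem) (D.A.smul_mem _ F.w_mem)) (D.A.smul_mem _ F.u_mem)
  have h1 : D.σ (c₁ • a + c₂ • w + c₃ • u) =
      (-conj c₄) • a + (-conj c₅) • w + (-conj c₆) • u := by
    have h2 := congrArg D.σ h
    simp only [map_add, map_smulₛₗ, map_zero, D.σ_σ] at h2 ⊢
    linear_combination (norm := module) h2
  have h2 : c₁ • a + c₂ • w + c₃ • u = 0 :=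
    D.eq_zero_of_mem (hm _ _ _) (by rw [h1]; exact hm _ _ _)
  rw [h2, map_zero] at h1
  obtain ⟨e1, e2, e3⟩ := F.indep _ _ _ h2
  obtain ⟨e4, e5, e6⟩ := F.indep _ _ _ h1.symm
  simp only [neg_eq_zero, map_eq_zero] at e4 e5 e6
  exact ⟨e1, e2, e3, e4, e5, e6⟩

theorem u_ne : u ≠ 0 := by
  rintro rfl
  have := (F.indep 0 0 1 (by simp)).2.2
  exact one_ne_zero this

theorem lie_aw : ⁅a, w⁆ = (α - κ) • u := by
  rw [← D.mul_sub_mul, F.aw, F.wa, sub_smul]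

/-- Brackets lie in a subspace if those of the basis do. -/
theorem lie_mem_of (S : Submodule ℂ L) (hσ : ∀ x ∈ S, D.σ x ∈ S) (h1 : ⁅a, w⁆ ∈ S)
    (hu : ∀ l : L, ⁅u, l⁆ = 0) (h2 : ⁅a, D.σ a⁆ ∈ S)
    (h3 : ⁅a, D.σ w⁆ ∈ S) (h4 : ⁅w, D.σ w⁆ ∈ S) (x y : L) : ⁅x, y⁆ ∈ S := by
  have hσu : ∀ l : L, ⁅D.σ u, l⁆ = 0 := fun l => by rw [← D.σ_σ l, ← D.σ_lie, hu, map_zero]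
  have hu' : ∀ l : L, ⁅l, u⁆ = 0 := fun l => by rw [← lie_skew, hu, neg_zero]
  have hσu' : ∀ l : L, ⁅l, D.σ u⁆ = 0 := fun l => by rw [← lie_skew, hσu, neg_zero]
  have sk : ∀ {x y : L}, ⁅x, y⁆ ∈ S → ⁅y, x⁆ ∈ S := fun {x y} h => by
    rw [← lie_skew]; exact neg_mem h
  have h1' : ⁅D.σ a, D.σ w⁆ ∈ S := by rw [← D.σ_lie]; exact hσ _ h1
  have h3' : ⁅D.σ a, w⁆ ∈ S := by
    have := hσ _ h3
    rwa [D.σ_lie, D.σ_σ] at this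
  obtain ⟨c₁, c₂, c₃, c₄, c₅, c₆, rfl⟩ := F.exists_coords x
  obtain ⟨d₁, d₂, d₃, d₄, d₅, d₆, rfl⟩ := F.exists_coords y
  simp only [add_lie, lie_add, smul_lie, lie_smul, hu, hu', hσu, hσu', lie_self, smul_zero,
    add_zero, zero_add, smul_add]
  repeat' apply add_mem
  all_goals first
    | exact S.smul_mem _ (S.smul_mem _ h1) | exact S.smul_mem _ (S.smul_mem _ (sk h1))
    | exact S.smul_mem _ (S.smul_mem _ h1') | exact S.smul_mem _ (S.smul_mem _ (sk h1'))
    | exact S.smul_mem _ (S.smul_mem _ h2) | exact S.smul_mem _ (S.smul_mem _ (sk h2))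
    | exact S.smul_mem _ (S.smul_mem _ h3) | exact S.smul_mem _ (S.smul_mem _ (sk h3))
    | exact S.smul_mem _ (S.smul_mem _ h3') | exact S.smul_mem _ (S.smul_mem _ (sk h3'))
    | exact S.smul_mem _ (S.smul_mem _ h4) | exact S.smul_mem _ (S.smul_mem _ (sk h4))

theorem mul_coords (c₁ c₂ c₃ d₁ d₂ d₃ : ℂ) :
    D.mul (c₁ • a + c₂ • w + c₃ • u) (d₁ • a + d₂ • w + d₃ • u) =
      (β * (c₁ * d₁)) • w + (c₁ * d₁ * γ + c₁ * d₂ * α + c₂ * d₁ * κ + c₂ * d₂ * δ) • u := by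
  simp only [map_add, map_smul, LinearMap.add_apply, LinearMap.smul_apply, F.aa, F.aw, F.wa, F.ww,
    F.au, F.ua, F.wu, F.uw, F.uu]
  module

/-- Replacing `w` by `D(a, a)`. -/
theorem normalize_w (F' : D.Frame a w u β γ α κ 0) (hβ : β ≠ 0) :
    D.Frame a (β • w + γ • u) u 1 0 (β * α) (β * κ) 0 where
  a_mem := F.a_mem
  w_mem := add_mem (D.A.smul_mem _ F.w_mem) (D.A.smul_mem _ F.u_mem)
  u_mem := F.u_mem
  span x hx := by
    obtain ⟨c₁, c₂, c₃, rfl⟩ := F.span x hx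
    refine ⟨c₁, c₂ / β, c₃ - c₂ * γ / β, ?_⟩
    match_scalars <;> field_simp
    ring
  indep c₁ c₂ c₃ h := by
    obtain ⟨e1, e2, e3⟩ := F.indep c₁ (c₂ * β) (c₃ + c₂ * γ) (by rw [← h]; module)
    obtain rfl : c₂ = 0 := by simpa [hβ] using e2
    exact ⟨e1, rfl, by simpa using e3⟩
  aa := by rw [F.aa]; module
  aw := by simp only [map_add, map_smul, F.aw, F.au]; module
  wa := by simp only [map_add, map_smul, F.wa, F.ua, LinearMap.add_apply, LinearMap.smul_apply]
           module
  ww := by simp [map_add, map_smul, F'.ww, F.uw, F.wu, F.uu]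
  au := F.au
  ua := F.ua
  wu := by simp [F.wu, F.uu]
  uw := by simp [F.uw, F.uu]
  uu := F.uu

/-- Rescaling a normalized basis. -/
theorem rescale (F' : D.Frame a w u 1 0 α κ 0) (c d : ℂ) (hc : c ≠ 0) (hd : d ≠ 0) :
    D.Frame (c • a) (c ^ 2 • w) (d • u) 1 0 (c ^ 3 / d * α) (c ^ 3 / d * κ) 0 where
  a_mem := D.A.smul_mem _ F.a_mem
  w_mem := D.A.smul_mem _ F.w_mem
  u_mem := D.A.smul_mem _ F.u_mem
  span x hx := by
    obtain ⟨c₁, c₂, c₃, rfl⟩ := F.span x hx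
    refine ⟨c₁ / c, c₂ / c ^ 2, c₃ / d, ?_⟩
    match_scalars <;> field_simp
  indep c₁ c₂ c₃ h := by
    obtain ⟨e1, e2, e3⟩ := F.indep (c₁ * c) (c₂ * c ^ 2) (c₃ * d) (by rw [← h]; module)
    exact ⟨by simpa [hc] using e1, by simpa [hc] using e2, by simpa [hd] using e3⟩
  aa := by simp only [map_smul, LinearMap.smul_apply, F'.aa]; module
  aw := by
    simp only [map_smul, LinearMap.smul_apply, F'.aw]
    match_scalars
    field_simp
  wa := by
    simp only [map_smul, LinearMap.smul_apply, F'.wa]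
    match_scalars
    field_simp
  ww := by simp [F'.ww]
  au := by simp [F.au]
  ua := by simp [F.ua]
  wu := by simp [F.wu]
  uw := by simp [F.uw]
  uu := by simp [F.uu]

end Frame

/-- An isomorphism between the differential Gerstenhaber algebras of the complex and of the
symplectic structure, in terms of the semidirect products of `A` and of its conjugate with
themselves. -/
structure SelfMirror (D : PKData L) where
  ψ₁ : L →ₗ[ℂ] L
  ψ₂ : L →ₗ[ℂ] L
  χ₁ : L →ₗ[ℂ] L
  χ₂ : L →ₗ[ℂ] L
  ψ₁_ψ₁ : ∀ x ∈ D.A, ∀ y ∈ D.A, ⁅ψ₁ x, ψ₁ y⁆ = ψ₁ ⁅x, y⁆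
  ψ₁_ψ₂ : ∀ x ∈ D.A, ∀ y ∈ D.A, ⁅ψ₁ x, ψ₂ y⁆ = ψ₂ (D.mul x y)
  ψ₂_ψ₂ : ∀ x ∈ D.A, ∀ y ∈ D.A, ⁅ψ₂ x, ψ₂ y⁆ = 0
  surj : ∀ l, ∃ x ∈ D.A, ∃ y ∈ D.A, l = ψ₁ x + ψ₂ y
  inj : ∀ x ∈ D.A, ∀ y ∈ D.A, ψ₁ x + ψ₂ y = 0 → x = 0 ∧ y = 0
  χ₁_mem : ∀ l, D.σ (χ₁ l) ∈ D.A
  χ₂_mem : ∀ l, D.σ (χ₂ l) ∈ D.A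
  χ₁_lie : ∀ l l', χ₁ ⁅l, l'⁆ = ⁅χ₁ l, χ₁ l'⁆
  χ₂_lie : ∀ l l', χ₂ ⁅l, l'⁆ = D.mul (χ₁ l) (χ₂ l') - D.mul (χ₁ l') (χ₂ l)
  compat : ∀ x ∈ D.A, ∀ y ∈ D.A, ∀ l, D.Om (ψ₁ x + ψ₂ y) l = D.Om y (χ₁ l) + D.Om (χ₂ l) x

namespace SelfMirror

variable (M : D.SelfMirror) {a w u : L} {β γ α κ δ : ℂ}

theorem lie_eq {x y z v : L} (hx : x ∈ D.A) (hy : y ∈ D.A) (hz : z ∈ D.A) (hv : v ∈ D.A) :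
    ⁅M.ψ₁ x + M.ψ₂ y, M.ψ₁ z + M.ψ₂ v⁆ = M.ψ₁ ⁅x, z⁆ + M.ψ₂ (D.mul x v - D.mul z y) := by
  rw [add_lie, lie_add, lie_add, M.ψ₁_ψ₁ x hx z hz, M.ψ₁_ψ₂ x hx v hv, M.ψ₂_ψ₂ y hy v hv,
    ← lie_skew (M.ψ₂ y), M.ψ₁_ψ₂ z hz y hy, map_sub]
  abel

/-- Through `ψ` the derived algebra is visible from the product table alone. The coefficients `α -
κ` and `β` are kept because their vanishing reduces it to a plane or a line. -/
theorem exists_lie_eq (F : D.Frame a w u β γ α κ δ) (l l' : L) : ∃ k k₁ k₂ : ℂ,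
    ⁅l, l'⁆ = ((α - κ) * k) • M.ψ₁ u + (β * k₁) • M.ψ₂ w + k₂ • M.ψ₂ u := by
  obtain ⟨x, hx, y, hy, rfl⟩ := M.surj l
  obtain ⟨z, hz, v, hv, rfl⟩ := M.surj l'
  rw [M.lie_eq hx hy hz hv, ← D.mul_sub_mul]
  obtain ⟨x₁, x₂, x₃, rfl⟩ := F.span x hx
  obtain ⟨y₁, y₂, y₃, rfl⟩ := F.span y hy
  obtain ⟨z₁, z₂, z₃, rfl⟩ := F.span z hz
  obtain ⟨v₁, v₂, v₃, rfl⟩ := F.span v hv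
  rw [F.mul_coords, F.mul_coords, F.mul_coords, F.mul_coords]
  simp only [map_sub, map_add, map_smul]
  refine ⟨x₁ * z₂ - z₁ * x₂, x₁ * v₁ - z₁ * y₁, x₁ * v₁ * γ + x₁ * v₂ * α + x₂ * v₁ * κ +
    x₂ * v₂ * δ - (z₁ * y₁ * γ + z₁ * y₂ * α + z₂ * y₁ * κ + z₂ * y₂ * δ), ?_⟩
  module

/-- In a derived element only the `M.ψ₂ w` term has brackets: `u` annihilates and is annihilated,
and with `δ = 0` only the coefficient `α` survives. That triple brackets are confined to one line
drives the later comparisons. -/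
theorem exists_lie_lie_eq (F : D.Frame a w u β γ α κ 0) (l l' l'' : L) :
    ∃ k : ℂ, ⁅⁅l, l'⁆, l''⁆ = k • M.ψ₂ u := by
  obtain ⟨k, k₁, k₂, h⟩ := M.exists_lie_eq F l l'
  obtain ⟨z, hz, v, hv, rfl⟩ := M.surj l''
  have e : ⁅l, l'⁆ = M.ψ₁ (((α - κ) * k) • u) + M.ψ₂ ((β * k₁) • w + k₂ • u) := by
    rw [h, map_smul, map_add, map_smul, map_smul, add_assoc]
  rw [e, M.lie_eq (D.A.smul_mem _ F.u_mem)
    (add_mem (D.A.smul_mem _ F.w_mem) (D.A.smul_mem _ F.u_mem)) hz hv, ← D.mul_sub_mul]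
  obtain ⟨z₁, z₂, z₃, rfl⟩ := F.span z hz
  obtain ⟨v₁, v₂, v₃, rfl⟩ := F.span v hv
  refine ⟨-(z₁ * (β * k₁) * α), ?_⟩
  simp only [map_add, map_smul, LinearMap.smul_apply, LinearMap.add_apply, F.ua, F.uw, F.uu, F.au,
    F.wu, F.aw, F.ww, map_sub, map_zero]
  module

end SelfMirror

end PKData

end WeakSelfMirror

/-! ### Isotropy of `u` and the case `β = 0` -/

namespace WeakSelfMirror

open scoped ComplexConjugate

theorem exists_combination_of_mem_span_pair {L : Type*} [AddCommGroup L] [Module ℂ L]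
    {η₁ η₂ x y z : L} (hx : x ∈ Submodule.span ℂ {η₁, η₂}) (hy : y ∈ Submodule.span ℂ {η₁, η₂})
    (hz : z ∈ Submodule.span ℂ {η₁, η₂})
    (h : ∀ c₁ c₂ : ℂ, c₁ • x + c₂ • y = 0 → c₁ = 0 ∧ c₂ = 0) :
    ∃ c₁ c₂ : ℂ, z = c₁ • x + c₂ • y := by
  by_contra hne
  refine not_indep_of_mem_span_pair hx hy hz fun c₁ c₂ c₃ h0 => ?_
  by_cases h3 : c₃ = 0
  · subst h3
    have := h c₁ c₂ (by simpa using h0)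
    exact ⟨this.1, this.2, rfl⟩
  · refine (hne ⟨-c₁ / c₃, -c₂ / c₃, ?_⟩).elim
    have h2 : c₃⁻¹ • (c₁ • x + c₂ • y + c₃ • z) = 0 := by rw [h0, smul_zero]
    rw [smul_add, smul_smul c₃⁻¹ c₃, inv_mul_cancel₀ h3, one_smul] at h2
    rw [← sub_eq_zero, ← h2]
    match_scalars <;> field_simp

namespace PKData

variable {L : Type*} [LieRing L] [LieAlgebra ℂ L] {D : PKData L}

theorem conj_Om_self_σ (x : L) : conj (D.Om x (D.σ x)) = -D.Om x (D.σ x) := by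
  rw [← D.Om_conj, D.Om_skew]

namespace Frame

variable {a w u : L} {β γ α κ δ s t : ℂ}

/-- Pairings of `⁅u, D.σ z⁆` with `A` vanish because `u` multiplies `A` to zero. Those with the
conjugate of `A` involve `Om` of `u` with conjugates of products, which lie in the span of `w` and
`u`; the `w`-part occurs only in `D.mul a a`, with coefficient `β`. -/
theorem lie_u (F : D.Frame a w u β γ α κ δ) (hm : D.Om u (D.σ u) = 0)
    (hn : β = 0 ∨ D.Om w (D.σ u) = 0) (l : L) : ⁅u, l⁆ = 0 := by
  have T := F.Om_table rfl rfl rfl rfl rfl hm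
  have hn' : conj β * conj (D.Om w (D.σ u)) = 0 := by rcases hn with h | h <;> simp [h]
  obtain ⟨c₁, c₂, c₃, c₄, c₅, c₆, rfl⟩ := F.exists_coords l
  have e1 : ⁅u, a⁆ = 0 := by rw [← D.mul_sub_mul, F.au, F.ua, sub_zero]
  have e2 : ⁅u, w⁆ = 0 := by rw [← D.mul_sub_mul, F.uw, F.wu, sub_zero]
  have e3 : ⁅u, D.σ a⁆ = 0 := by
    refine F.ext ?_ ?_ ?_ ?_ ?_ ?_ <;> first
      | (rw [Om_lie_σ]; simp [F.aa, F.aw, F.au, map_smulₛₗ, T, hn', -mul_eq_zero])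
      | simp [D.Om_lie u, F.ua, F.uw, F.uu]
  have e4 : ⁅u, D.σ w⁆ = 0 := by
    refine F.ext ?_ ?_ ?_ ?_ ?_ ?_ <;> first
      | (rw [Om_lie_σ]; simp [F.wa, F.ww, F.wu, map_smulₛₗ, T, -mul_eq_zero])
      | simp [D.Om_lie u, F.ua, F.uw, F.uu]
  have e5 : ⁅u, D.σ u⁆ = 0 := by
    refine F.ext ?_ ?_ ?_ ?_ ?_ ?_ <;> first
      | (rw [Om_lie_σ]; simp [F.ua, F.uw, F.uu, -mul_eq_zero])
      | simp [D.Om_lie u, F.ua, F.uw, F.uu]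
  simp [e1, e2, e3, e4, e5]

end Frame

namespace SelfMirror

variable {a w u : L} {β γ α κ δ s t : ℂ}

theorem lie_mem_span_pair (M : D.SelfMirror) (F : D.Frame a w u 0 γ α κ δ) (x y : L) :
    ⁅x, y⁆ ∈ Submodule.span ℂ {M.ψ₁ u, M.ψ₂ u} := by
  obtain ⟨k, k₁, k₂, h⟩ := M.exists_lie_eq F x y
  exact Submodule.mem_span_pair.2 ⟨(α - κ) * k, k₂, by rw [h]; module⟩

theorem lie_mem_span_pair' (M : D.SelfMirror) (F : D.Frame a w u β γ α α δ) (x y : L) :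
    ⁅x, y⁆ ∈ Submodule.span ℂ {M.ψ₂ w, M.ψ₂ u} := by
  obtain ⟨k, k₁, k₂, h⟩ := M.exists_lie_eq F x y
  exact Submodule.mem_span_pair.2 ⟨β * k₁, k₂, by rw [h]; module⟩

/-- For `β = 0` the derived algebra lies in a plane, and for `α ≠ κ` it contains the independent
vectors `u` and `D.σ u`, so they span the plane. Pairing `⁅x, D.σ z⁆ = c • u + d • D.σ u` with `y`
in `A` then shows that the product on `A` has rank one: it is a linear form in `x` times `Om y (D.σ
u)`, times `u`. -/
theorem exists_frame_of_ne (M : D.SelfMirror) (F : D.Frame a w u 0 γ α κ δ) (h : α ≠ κ) :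
    ∃ a w : L, D.Frame a w u 0 0 1 0 0 ∧ D.Om a (D.σ u) = 0 ∧ D.Om w (D.σ u) = 1 ∧
      D.Om u (D.σ u) = 0 := by
  have hne := sub_ne_zero.2 h
  have hu : u ∈ Submodule.span ℂ {M.ψ₁ u, M.ψ₂ u} := by
    have := M.lie_mem_span_pair F a w
    rw [F.lie_aw] at this
    exact (Submodule.smul_mem_iff _ hne).1 this
  have hσu : D.σ u ∈ Submodule.span ℂ {M.ψ₁ u, M.ψ₂ u} := by
    have := M.lie_mem_span_pair F (D.σ a) (D.σ w)
    rw [← D.σ_lie, F.lie_aw, map_smulₛₗ] at this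
    exact (Submodule.smul_mem_iff _ ((map_ne_zero _).2 hne)).1 this
  have key : ∀ x y : L, ∃ c d : ℂ, ⁅x, y⁆ = c • u + d • D.σ u := fun x y =>
    exists_combination_of_mem_span_pair hu hσu (M.lie_mem_span_pair F x y) fun c₁ c₂ h0 => by
      obtain ⟨-, -, e3, -, -, e6⟩ := F.indep₆ (c₁ := 0) (c₂ := 0) (c₃ := c₁) (c₄ := 0) (c₅ := 0)
        (c₆ := c₂) (by rw [← h0]; module)
      exact ⟨e3, e6⟩
  obtain ⟨z, hz⟩ : ∃ z, D.Om u (D.σ z) ≠ 0 := by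
    by_contra! hz
    refine F.u_ne (D.nondeg _ fun l => ?_)
    obtain ⟨x, hx, y, hy, rfl⟩ := D.exists_add l
    rw [map_add, D.isotropic u F.u_mem x hx, hz, add_zero]
  obtain ⟨c, d, hd⟩ := key a (D.σ z)
  obtain ⟨c', d', hd'⟩ := key w (D.σ z)
  have val : ∀ (x : L) (c d : ℂ), ⁅x, D.σ z⁆ = c • u + d • D.σ u → ∀ y ∈ D.A,
      D.Om (D.mul x y) (D.σ z) = -d * D.Om y (D.σ u) := by
    intro x c d h y hy
    rw [← D.Om_lie, h]
    simp only [map_add, map_smul, LinearMap.add_apply, LinearMap.smul_apply,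
      D.isotropic u F.u_mem y hy, smul_eq_mul]
    rw [D.Om_skew]
    ring
  have e1 := val a c d hd a F.a_mem
  have e2 := val a c d hd w F.w_mem
  have e3 := val a c d hd u F.u_mem
  have f1 := val w c' d' hd' a F.a_mem
  have f2 := val w c' d' hd' w F.w_mem
  have f3 := val w c' d' hd' u F.u_mem
  simp only [F.aa, F.aw, F.au, F.wa, F.ww, F.wu, zero_smul, zero_add, map_smul,
    LinearMap.smul_apply, smul_eq_mul, map_zero, LinearMap.zero_apply] at e1 e2 e3 f1 f2 f3
  set θ := D.Om u (D.σ z)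
  obtain ⟨p, hp⟩ : ∃ p, p = -d / θ := ⟨_, rfl⟩
  obtain ⟨p', hp'⟩ : ∃ p', p' = -d' / θ := ⟨_, rfl⟩
  set q := D.Om a (D.σ u) with hq
  set n := D.Om w (D.σ u) with hn
  set m := D.Om u (D.σ u) with hm
  have g1 : γ = p * q := by rw [hp]; field_simp; linear_combination e1
  have g2 : α = p * n := by rw [hp]; field_simp; linear_combination e2
  have g3 : κ = p' * q := by rw [hp']; field_simp; linear_combination f1
  have g4 : δ = p' * n := by rw [hp']; field_simp; linear_combination f2
  have hm0 : m = 0 := by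
    by_contra hm0
    have h1 : d = 0 := by simpa [hm0] using e3
    have h2 : d' = 0 := by simpa [hm0] using f3
    apply h
    rw [g2, g3, hp, hp', h1, h2]
    simp
  set Δ := p * n - p' * q with hΔ
  have hΔ0 : Δ ≠ 0 := by rw [hΔ, ← g2, ← g3]; exact hne
  -- The product is `P(x) Q(y) u`, where `P` has values `p, p'` and `Q` has values `q, n` on `a, w`.
  -- Both forms vanish on `u`, and the new vectors are the dual basis of `P, Q`; the determinant `Δ`
  -- is `α - κ`.
  refine ⟨(n / Δ) • a + (-q / Δ) • w, (-p' / Δ) • a + (p / Δ) • w,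
    ⟨add_mem (D.A.smul_mem _ F.a_mem) (D.A.smul_mem _ F.w_mem),
    add_mem (D.A.smul_mem _ F.a_mem) (D.A.smul_mem _ F.w_mem), F.u_mem, fun x hx => ?_,
      fun c₁ c₂ c₃ h0 => ?_, ?_, ?_, ?_, ?_, ?_, ?_, ?_, ?_, ?_⟩, ?_, ?_, hm0⟩
  · obtain ⟨c₁, c₂, c₃, rfl⟩ := F.span x hx
    refine ⟨c₁ * p + c₂ * p', c₁ * q + c₂ * n, c₃, ?_⟩
    match_scalars <;> field_simp <;> rw [hΔ] <;> ring
  · obtain ⟨k1, k2, k3⟩ := F.indep ((c₁ * n - c₂ * p') / Δ) ((c₂ * p - c₁ * q) / Δ) c₃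
      (by rw [← h0]; match_scalars <;> field_simp <;> ring)
    have k1' : c₁ * n - c₂ * p' = 0 := by simpa [hΔ0] using k1
    have k2' : c₂ * p - c₁ * q = 0 := by simpa [hΔ0] using k2
    refine ⟨?_, ?_, k3⟩
    · have : c₁ * Δ = 0 := by rw [hΔ]; linear_combination p * k1' + p' * k2'
      simpa [hΔ0] using this
    · have : c₂ * Δ = 0 := by rw [hΔ]; linear_combination q * k1' + n * k2'
      simpa [hΔ0] using this
  all_goals try simp only [map_add, map_smul, LinearMap.add_apply, LinearMap.smul_apply, F.aa, F.aw,
      F.wa, F.ww, F.au, F.ua, F.wu, F.uw, F.uu, smul_zero, zero_smul, add_zero, zero_add, g1, g2,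
      g3, g4, smul_smul, ← add_smul, ← hq, ← hn, smul_eq_mul]
  · convert zero_smul ℂ u using 2
    ring
  · congr 1
    field_simp
    rw [hΔ]
    ring
  · convert zero_smul ℂ u using 2
    ring
  · convert zero_smul ℂ u using 2
    ring
  · field_simp
    ring
  · field_simp
    rw [hΔ]
    ring

/-- If `s = t`, the product is commutative and the derived algebra lies in a plane, while a nonzero
value of `Om` on `u` would give three independent brackets. If `s ≠ t`, then `u` and `D.σ u` are
multiples of brackets, so their own brackets lie in the single line of `M.ψ₂ u`, and this forces the
relevant ones to vanish. -/
theorem Om_u_eq_zero (M : D.SelfMirror) (F : D.Frame a w u 1 0 s t 0) (h : s ≠ 0 ∨ t ≠ 0) :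
    D.Om u (D.σ u) = 0 ∧ D.Om w (D.σ u) = 0 := by
  have T := F.Om_table rfl rfl rfl rfl rfl rfl
  have l1A : ⁅u, D.σ w⁆ ∈ D.A := D.mem_of_Om fun y hy => by
    obtain ⟨c₁, c₂, c₃, rfl⟩ := F.span y hy
    simp [D.Om_lie u, F.ua, F.uw, F.uu]
  have l2A : ⁅u, D.σ a⁆ ∈ D.A := D.mem_of_Om fun y hy => by
    obtain ⟨c₁, c₂, c₃, rfl⟩ := F.span y hy
    simp [D.Om_lie u, F.ua, F.uw, F.uu]
  have v1 : D.Om ⁅u, D.σ w⁆ (D.σ a) = conj t * D.Om u (D.σ u) := by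
    simp [Om_lie_σ, F.wa, map_smulₛₗ, T]
  have v2 : D.Om ⁅u, D.σ w⁆ (D.σ w) = 0 := by simp [Om_lie_σ, F.ww]
  have v3 : D.Om ⁅u, D.σ a⁆ (D.σ a) = -conj (D.Om w (D.σ u)) := by simp [Om_lie_σ, F.aa, T]
  have v4 : D.Om ⁅u, D.σ a⁆ (D.σ w) = conj s * D.Om u (D.σ u) := by
    simp [Om_lie_σ, F.aw, map_smulₛₗ, T]
  have conjOm : ∀ l y, D.Om (D.σ l) y = conj (D.Om l (D.σ y)) := D.Om_conj
  by_cases hst : s = t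
  · subst hst
    have hs : s ≠ 0 := by simpa using h
    have mem := M.lie_mem_span_pair' F
    by_cases hm : D.Om u (D.σ u) = 0
    · refine ⟨hm, ?_⟩
      by_contra hn
      have e1 : D.σ ⁅u, D.σ a⁆ ∈ Submodule.span ℂ {M.ψ₂ w, M.ψ₂ u} := by
        rw [D.σ_lie]; exact mem _ _
      refine not_indep_of_mem_span_pair (mem u (D.σ a)) e1 (mem a (D.σ w)) fun c₁ c₂ c₃ h0 => ?_
      have k1 := congrArg (fun l => D.Om l w) h0
      have k2 := congrArg (fun l => D.Om l (D.σ a)) h0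
      have k3 := congrArg (fun l => D.Om l a) h0
      have z1 : D.Om ⁅u, D.σ a⁆ w = 0 := D.isotropic _ l2A _ F.w_mem
      have z2 : D.Om ⁅u, D.σ a⁆ a = 0 := D.isotropic _ l2A _ F.a_mem
      have z3 : D.Om ⁅a, D.σ w⁆ w = -(s * conj (D.Om w (D.σ u))) := by
        simp [D.Om_lie a, F.aw, T]
      simp only [map_add, map_smul, LinearMap.add_apply, LinearMap.smul_apply, smul_eq_mul, z1, z2,
        z3, conjOm, v3, v4, hm, D.σ_σ, mul_zero, map_zero, LinearMap.zero_apply, zero_add] at k1 k2 k3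
      have r3 : c₃ = 0 := by simpa [hs, hn] using k1
      subst r3
      have r1 : c₁ = 0 := by simpa [hn] using k2
      have r2 : c₂ = 0 := by simpa [hn] using k3
      exact ⟨r1, r2, rfl⟩
    · exfalso
      have e1 : D.σ ⁅u, D.σ w⁆ ∈ Submodule.span ℂ {M.ψ₂ w, M.ψ₂ u} := by
        rw [D.σ_lie]; exact mem _ _
      refine not_indep_of_mem_span_pair (mem u (D.σ w)) (mem u (D.σ a)) e1 fun c₁ c₂ c₃ h0 => ?_
      have k1 := congrArg (fun l => D.Om l a) h0
      have k2 := congrArg (fun l => D.Om l (D.σ w)) h0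
      have k3 := congrArg (fun l => D.Om l (D.σ a)) h0
      have z1 : D.Om ⁅u, D.σ w⁆ a = 0 := D.isotropic _ l1A _ F.a_mem
      have z2 : D.Om ⁅u, D.σ a⁆ a = 0 := D.isotropic _ l2A _ F.a_mem
      simp only [map_add, map_smul, LinearMap.add_apply, LinearMap.smul_apply, smul_eq_mul, z1, z2,
        conjOm, v1, v2, v3, v4, D.σ_σ, mul_zero, map_zero, LinearMap.zero_apply, zero_add]
        at k1 k2 k3
      have r3 : c₃ = 0 := by simpa [hs, hm] using k1
      subst r3
      have r2 : c₂ = 0 := by simpa [hs, hm] using k2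
      subst r2
      have r1 : c₁ = 0 := by simpa [hs, hm] using k3
      exact ⟨r1, rfl, rfl⟩
  · have hne := sub_ne_zero.2 hst
    have triple : ∀ l, ∃ k : ℂ, ⁅u, l⁆ = k • M.ψ₂ u := by
      intro l
      obtain ⟨k, hk⟩ := M.exists_lie_lie_eq F a w l
      rw [F.lie_aw, smul_lie] at hk
      refine ⟨(s - t)⁻¹ * k, ?_⟩
      rw [mul_smul, ← hk, smul_smul, inv_mul_cancel₀ hne, one_smul]
    have triple' : ∀ l, ∃ k : ℂ, ⁅D.σ u, l⁆ = k • M.ψ₂ u := by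
      intro l
      obtain ⟨k, hk⟩ := M.exists_lie_lie_eq F (D.σ a) (D.σ w) l
      rw [← D.σ_lie, F.lie_aw, map_smulₛₗ, smul_lie] at hk
      refine ⟨(conj (s - t))⁻¹ * k, ?_⟩
      rw [mul_smul, ← hk, smul_smul, inv_mul_cancel₀ ((map_ne_zero _).2 hne), one_smul]
    -- If `⁅u, l⁆` were nonzero in `A`, then `A` would contain `M.ψ₂ u`, hence also the conjugate of
    -- `⁅u, l⁆`, which is a multiple of it. But `A` meets its conjugate in zero.
    have zero : ∀ l, ⁅u, l⁆ ∈ D.A → ⁅u, l⁆ = 0 := by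
      intro l hl
      obtain ⟨k, hk⟩ := triple l
      obtain ⟨k', hk'⟩ := triple' (D.σ l)
      by_cases hk0 : k = 0
      · rw [hk, hk0, zero_smul]
      · refine D.eq_zero_of_mem hl ?_
        rw [D.σ_lie, hk']
        rw [hk] at hl
        exact D.A.smul_mem _ ((Submodule.smul_mem_iff _ hk0).1 hl)
    have z1 := zero _ l1A
    have z2 := zero _ l2A
    rw [z1, map_zero, LinearMap.zero_apply] at v1
    rw [z2, map_zero, LinearMap.zero_apply] at v3 v4
    refine ⟨?_, by simpa using v3.symm⟩
    rcases h with h | h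
    · simpa [h] using v4.symm
    · simpa [h] using v1.symm

end SelfMirror

end PKData

end WeakSelfMirror

/-! ### The case `β ≠ 0`: brackets and relations -/

namespace WeakSelfMirror

open scoped ComplexConjugate

/-- The leading coefficients of a homomorphism between two algebras with brackets
`[1,2] = 4, [1,3] = 5, [1,4] = 6, [2,3] = c 6`. -/
theorem exists_leading_coefficients {V : Type*} [AddCommGroup V] [Module ℂ V]
    (br : V →ₗ[ℂ] V →ₗ[ℂ] V) (hsk : ∀ x y, br x y = -br y x) {c d : ℂ}
    {f₁ f₂ f₃ f₄ f₅ f₆ E₁ E₂ E₃ : V} (h12 : br f₁ f₂ = f₄) (h13 : br f₁ f₃ = f₅)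
    (h14 : br f₁ f₄ = f₆) (h23 : br f₂ f₃ = d • f₆) (h24 : br f₂ f₄ = 0) (h34 : br f₃ f₄ = 0)
    (h5 : ∀ x, br f₅ x = 0) (h6 : ∀ x, br f₆ x = 0) (h0 : f₆ ≠ 0)
    (hE₁ : ∃ x₁ x₂ x₃ x₄ x₅ x₆ : ℂ,
      E₁ = x₁ • f₁ + x₂ • f₂ + x₃ • f₃ + x₄ • f₄ + x₅ • f₅ + x₆ • f₆)
    (hE₂ : ∃ x₁ x₂ x₃ x₄ x₅ x₆ : ℂ,
      E₂ = x₁ • f₁ + x₂ • f₂ + x₃ • f₃ + x₄ • f₄ + x₅ • f₅ + x₆ • f₆)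
    (hE₃ : ∃ x₁ x₂ x₃ x₄ x₅ x₆ : ℂ,
      E₃ = x₁ • f₁ + x₂ • f₂ + x₃ • f₃ + x₄ • f₄ + x₅ • f₅ + x₆ • f₆)
    (ne : br E₁ (br E₁ E₂) ≠ 0) (z24 : br E₂ (br E₁ E₂) = 0) (z34 : br E₃ (br E₁ E₂) = 0)
    (z15 : br E₁ (br E₁ E₃) = 0) (e23 : br E₂ E₃ = c • br E₁ (br E₁ E₂)) :
    ∃ l m n : ℂ, l ≠ 0 ∧ m ≠ 0 ∧ d * n = c * l ^ 2 ∧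
      (∃ x₂ x₃ x₄ x₅ x₆ : ℂ,
        E₁ = l • f₁ + x₂ • f₂ + x₃ • f₃ + x₄ • f₄ + x₅ • f₅ + x₆ • f₆) ∧
      (∃ x₃ x₄ x₅ x₆ : ℂ, E₂ = m • f₂ + x₃ • f₃ + x₄ • f₄ + x₅ • f₅ + x₆ • f₆) ∧
      (∃ x₄ x₅ x₆ : ℂ, E₃ = n • f₃ + x₄ • f₄ + x₅ • f₅ + x₆ • f₆) ∧
      (∃ x₅ x₆ : ℂ, br E₁ E₂ = (l * m) • f₄ + x₅ • f₅ + x₆ • f₆) ∧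
      (∃ x₆ : ℂ, br E₁ E₃ = (l * n) • f₅ + x₆ • f₆) ∧
      br E₁ (br E₁ E₂) = (l ^ 2 * m) • f₆ := by
  have self : ∀ x, br x x = 0 := fun x => by
    have h := hsk x x
    have h2 : (2 : ℂ) • br x x = 0 := by rw [two_smul]; nth_rewrite 1 [h]; simp
    simpa using h2
  have h21 : br f₂ f₁ = -f₄ := by rw [hsk, h12]
  have h31 : br f₃ f₁ = -f₅ := by rw [hsk, h13]
  have h41 : br f₄ f₁ = -f₆ := by rw [hsk, h14]
  have h32 : br f₃ f₂ = -(d • f₆) := by rw [hsk, h23]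
  have h42 : br f₄ f₂ = 0 := by rw [hsk, h24, neg_zero]
  have h43 : br f₄ f₃ = 0 := by rw [hsk, h34, neg_zero]
  have h5' : ∀ x, br x f₅ = 0 := fun x => by rw [hsk, h5, neg_zero]
  have h6' : ∀ x, br x f₆ = 0 := fun x => by rw [hsk, h6, neg_zero]
  have formula : ∀ x₁ x₂ x₃ x₄ x₅ x₆ y₁ y₂ y₃ y₄ y₅ y₆ : ℂ,
      br (x₁ • f₁ + x₂ • f₂ + x₃ • f₃ + x₄ • f₄ + x₅ • f₅ + x₆ • f₆)
        (y₁ • f₁ + y₂ • f₂ + y₃ • f₃ + y₄ • f₄ + y₅ • f₅ + y₆ • f₆) =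
      (0 : ℂ) • f₁ + (0 : ℂ) • f₂ + (0 : ℂ) • f₃ +
      (x₁ * y₂ - x₂ * y₁) • f₄ + (x₁ * y₃ - x₃ * y₁) • f₅ +
        (x₁ * y₄ - x₄ * y₁ + d * (x₂ * y₃ - x₃ * y₂)) • f₆ := by
    intros
    simp only [map_add, map_smul, LinearMap.add_apply, LinearMap.smul_apply, h12, h13, h14, h23,
      h24, h34, h5, h6, h21, h31, h41, h32, h42, h43, h5', h6', self, smul_zero, add_zero, zero_add]
    module
  obtain ⟨α₁, α₂, α₃, α₄, α₅, α₆, rfl⟩ := hE₁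
  obtain ⟨β₁, β₂, β₃, β₄, β₅, β₆, rfl⟩ := hE₂
  obtain ⟨γ₁, γ₂, γ₃, γ₄, γ₅, γ₆, rfl⟩ := hE₃
  simp only [formula] at ne z24 z34 z15 e23 ⊢
  simp only [zero_smul, mul_zero, zero_add, sub_zero, add_zero, smul_eq_zero, h0, or_false, ne_eq, mul_eq_zero, not_or] at ne z24 z34 z15
  obtain ⟨n1, n2⟩ := ne
  -- Bracketing with `br E₁ E₂` detects the `f₁`-coefficient. So `E₂` and `E₃`, which commute with
  -- it, have none, and `z15` then removes the `f₂`-coefficient of `E₃`. Only leading terms remain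
  -- in `e23`.
  obtain rfl : β₁ = 0 := z24.resolve_right n2
  obtain rfl : γ₁ = 0 := z34.resolve_right n2
  simp only [mul_zero, sub_zero, mul_eq_zero, n1, false_or] at n2 z15
  subst z15
  simp only [mul_zero, zero_mul, sub_zero, zero_smul, zero_add, add_zero] at e23
  rw [← sub_eq_zero, smul_smul, ← sub_smul, smul_eq_zero] at e23
  have e' := e23.resolve_right h0
  refine ⟨α₁, β₂, γ₃, n1, n2, ?_, ⟨α₂, α₃, α₄, α₅, α₆, rfl⟩, ⟨β₃, β₄, β₅, β₆, ?_⟩,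
    ⟨γ₄, γ₅, γ₆, ?_⟩, ⟨α₁ * β₃, α₁ * β₄ + d * (α₂ * β₃ - α₃ * β₂), ?_⟩,
    ⟨α₁ * γ₄ + d * (α₂ * γ₃), ?_⟩, ?_⟩
  · apply mul_left_cancel₀ n2
    linear_combination e'
  all_goals module

namespace PKData

variable {L : Type*} [LieRing L] [LieAlgebra ℂ L] {D : PKData L}

namespace Frame

variable {a w u : L} {s t : ℂ}

theorem lie_table_h6 (F : D.Frame a w u 0 0 1 0 0) (hq : D.Om a (D.σ u) = 0)
    (hn : D.Om w (D.σ u) = 1) (hm : D.Om u (D.σ u) = 0) :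
    (∀ l : L, ⁅u, l⁆ = 0) ∧ ⁅a, w⁆ = u ∧ ⁅a, D.σ w⁆ = D.σ u ∧ ⁅a, D.σ a⁆ = 0 ∧
      ⁅w, D.σ w⁆ = 0 := by
  have T := F.Om_table rfl rfl hq rfl hn hm
  refine ⟨F.lie_u hm (Or.inl rfl), by rw [F.lie_aw]; simp, ?_, ?_, ?_⟩
  all_goals
    refine F.ext ?_ ?_ ?_ ?_ ?_ ?_ <;> first
      | (rw [Om_lie_σ]; simp [F.aa, F.aw, F.au, F.wa, F.ww, F.wu, T])
      | simp [D.Om_lie, F.aa, F.aw, F.au, F.wa, F.ww, F.wu, T]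

variable (F : D.Frame a w u 1 0 s t 0) (hn : D.Om w (D.σ u) = 0) (hm : D.Om u (D.σ u) = 0)
include F hn hm

/-- Here `u` pairs nontrivially at most with `D.σ a`, and `w`, after subtraction of a multiple of
`u`, at most with `D.σ w`. Both pairings are needed for nondegeneracy. -/
theorem Om_ne_zero : D.Om a (D.σ u) ≠ 0 ∧ D.Om w (D.σ w) ≠ 0 := by
  have T := F.Om_table rfl rfl rfl rfl hn hm
  have hq : D.Om a (D.σ u) ≠ 0 := by
    intro hq
    refine F.u_ne (F.ext ?_ ?_ ?_ ?_ ?_ ?_) <;> simp [T, hq]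
  refine ⟨hq, fun hp => ?_⟩
  have hq' := (map_ne_zero (starRingEnd ℂ)).2 hq
  have h0 : w + (-conj (D.Om a (D.σ w)) / conj (D.Om a (D.σ u))) • u = 0 := by
    refine F.ext ?_ ?_ ?_ ?_ ?_ ?_ <;> simp [T, hp]
    field_simp
    simp
  have := F.indep 0 1 _ (by rw [zero_smul, zero_add, one_smul]; exact h0)
  exact one_ne_zero this.2.1

theorem lie_aσw : ⁅a, D.σ w⁆ = (-(D.Om w (D.σ w) / D.Om a (D.σ u))) • D.σ u +
    (-(conj t * D.Om a (D.σ u) / conj (D.Om a (D.σ u)))) • u := by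
  have T := F.Om_table rfl rfl rfl rfl hn hm
  have hq := (F.Om_ne_zero hn hm).1
  have hq' := (map_ne_zero (starRingEnd ℂ)).2 hq
  refine F.ext ?_ ?_ ?_ ?_ ?_ ?_
  · simp [D.Om_lie, F.aa, T, hq]
  · simp [D.Om_lie, F.aw, T]
  · simp [D.Om_lie, F.au, T]
  · rw [Om_lie_σ]; simp [F.wa, T, map_smulₛₗ]
    field_simp
  · rw [Om_lie_σ]; simp [F.ww, T]
  · rw [Om_lie_σ]; simp [F.wu, T]

theorem lie_wσw : ⁅w, D.σ w⁆ = 0 := by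
  have T := F.Om_table rfl rfl rfl rfl hn hm
  refine F.ext ?_ ?_ ?_ ?_ ?_ ?_ <;> first
    | (rw [Om_lie_σ]; simp [F.wa, F.ww, F.wu, T, map_smulₛₗ])
    | simp [D.Om_lie, F.wa, F.ww, F.wu, T]

/-- The coefficients of `u` and `D.σ u` are left unnamed: in the applications these vectors are
central and do not affect further brackets. -/
theorem exists_lie_aσa : ∃ c₁ c₂ : ℂ, ⁅a, D.σ a⁆ =
    (conj s * D.Om a (D.σ u) / D.Om w (D.σ w)) • w +
    (s * conj (D.Om a (D.σ u)) / D.Om w (D.σ w)) • D.σ w + c₁ • u + c₂ • D.σ u := by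
  have T := F.Om_table rfl rfl rfl rfl hn hm
  obtain ⟨hq, hp⟩ := F.Om_ne_zero hn hm
  have hq' := (map_ne_zero (starRingEnd ℂ)).2 hq
  set q := D.Om a (D.σ u)
  set p := D.Om w (D.σ w)
  set r := D.Om a (D.σ w)
  refine ⟨-(r + conj s * q / p * conj r) / conj q, (conj r - s * conj q / p * r) / q,
    F.ext ?_ ?_ ?_ ?_ ?_ ?_⟩
  · simp [D.Om_lie, F.aa, T]
    field_simp
    ring
  · simp [D.Om_lie, F.aw, T]
    field_simp
  · simp [D.Om_lie, F.au, T]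
  · rw [Om_lie_σ]; simp [F.aa, T]
    field_simp
    ring
  · rw [Om_lie_σ]; simp [F.aw, T, map_smulₛₗ]
    field_simp
    rfl
  · rw [Om_lie_σ]; simp [F.au, T]

end Frame

namespace SelfMirror

variable {a w u : L} {s t : ℂ}

/-- If `s = 0`, the terms in `w` and `D.σ w` of `⁅a, D.σ a⁆` disappear and the derived algebra lies
in the plane of `u` and `D.σ u`. With `t ≠ 0`, however, it contains the independent vectors `M.ψ₁
u`, `M.ψ₂ w`, `M.ψ₂ u`. -/
theorem ne_zero_of_frame (M : D.SelfMirror) (F : D.Frame a w u 1 0 s t 0) (h : s ≠ 0 ∨ t ≠ 0) :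
    s ≠ 0 := by
  rintro rfl
  have ht : t ≠ 0 := by simpa using h
  obtain ⟨hm, hn⟩ := M.Om_u_eq_zero F h
  have hu := F.lie_u hm (Or.inr hn)
  obtain ⟨c₁, c₂, hv⟩ := F.exists_lie_aσa hn hm
  have mem : ∀ x y : L, ⁅x, y⁆ ∈ Submodule.span ℂ {u, D.σ u} := by
    refine F.lie_mem_of _ ?_ ?_ hu ?_ ?_ ?_
    · intro x hx
      obtain ⟨c, d, rfl⟩ := Submodule.mem_span_pair.1 hx
      exact Submodule.mem_span_pair.2 ⟨conj d, conj c, by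
        rw [map_add, map_smulₛₗ, map_smulₛₗ, D.σ_σ, add_comm]⟩
    · exact Submodule.mem_span_pair.2 ⟨0 - t, 0, by rw [F.lie_aw]; simp⟩
    · exact Submodule.mem_span_pair.2 ⟨c₁, c₂, by rw [hv]; simp⟩
    · rw [F.lie_aσw hn hm, add_comm]
      exact Submodule.mem_span_pair.2 ⟨_, _, rfl⟩
    · rw [F.lie_wσw hn hm]
      exact zero_mem _
  have e1 : M.ψ₁ u ∈ Submodule.span ℂ {u, D.σ u} := by
    have := mem (M.ψ₁ a) (M.ψ₁ w)
    rw [M.ψ₁_ψ₁ _ F.a_mem _ F.w_mem, F.lie_aw, map_smul] at this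
    exact (Submodule.smul_mem_iff _ (by simpa using ht)).1 this
  have e2 : M.ψ₂ w ∈ Submodule.span ℂ {u, D.σ u} := by
    have := mem (M.ψ₁ a) (M.ψ₂ a)
    rw [M.ψ₁_ψ₂ _ F.a_mem _ F.a_mem, F.aa] at this
    simpa using this
  have e3 : M.ψ₂ u ∈ Submodule.span ℂ {u, D.σ u} := by
    have := mem (M.ψ₁ w) (M.ψ₂ a)
    rw [M.ψ₁_ψ₂ _ F.w_mem _ F.a_mem, F.wa, map_smul] at this
    exact (Submodule.smul_mem_iff _ ht).1 this
  refine not_indep_of_mem_span_pair e1 e2 e3 fun x y z h0 => ?_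
  obtain ⟨h1, h2⟩ := M.inj (x • u) (D.A.smul_mem _ F.u_mem) (y • w + z • u)
    (add_mem (D.A.smul_mem _ F.w_mem) (D.A.smul_mem _ F.u_mem)) (by
      rw [← h0]; simp only [map_add, map_smul]; abel)
  obtain ⟨-, h3, h4⟩ := F.indep 0 y z (by rw [← h2]; module)
  exact ⟨(smul_eq_zero.1 h1).resolve_right F.u_ne, h3, h4⟩

theorem exists_normalized_frame (M : D.SelfMirror) (F : D.Frame a w u 1 0 s t 0)
    (h : s ≠ 0 ∨ t ≠ 0) : ∃ (u' : L) (t' : ℂ), D.Frame a w u' 1 0 1 t' 0 := by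
  have hs := M.ne_zero_of_frame F h
  have := F.rescale F 1 s one_ne_zero hs
  refine ⟨s • u, t / s, ?_⟩
  convert this using 1
  · simp
  · simp
  · field_simp
  · field_simp

/-- The triple brackets of `⁅a, D.σ a⁆` with `a` and with `D.σ a` both lie in the line of `M.ψ₂ u`,
so they are proportional. The relation is the vanishing of the determinant of their coordinates in
`u` and `D.σ u`. -/
theorem Om_relation (M : D.SelfMirror) (F : D.Frame a w u 1 0 1 t 0) :
    D.Om a (D.σ u) * conj (D.Om a (D.σ u)) * (1 - t - conj t) ^ 2 = -(D.Om w (D.σ w)) ^ 2 := by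
  obtain ⟨hm, hn⟩ := M.Om_u_eq_zero F (Or.inl one_ne_zero)
  have hu := F.lie_u hm (Or.inr hn)
  have hσu : ∀ l : L, ⁅D.σ u, l⁆ = 0 := fun l => by rw [← D.σ_σ l, ← D.σ_lie, hu, map_zero]
  obtain ⟨hq, hp⟩ := F.Om_ne_zero hn hm
  have hq' := (map_ne_zero (starRingEnd ℂ)).2 hq
  obtain ⟨c₁, c₂, hv⟩ := F.exists_lie_aσa hn hm
  have haw := F.lie_aσw hn hm
  have hwa : ⁅D.σ w, a⁆ = -⁅a, D.σ w⁆ := (lie_skew _ _).symm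
  have haw' : ⁅w, D.σ a⁆ = -D.σ ⁅a, D.σ w⁆ := by rw [D.σ_lie, D.σ_σ, lie_skew]
  have hww' : ⁅D.σ w, D.σ a⁆ = -D.σ ⁅a, w⁆ := by rw [D.σ_lie, lie_skew]
  have hwa0 : ⁅w, a⁆ = -⁅a, w⁆ := (lie_skew _ _).symm
  have hpc : conj (D.Om w (D.σ w)) = -D.Om w (D.σ w) := conj_Om_self_σ w
  obtain ⟨k, hk⟩ := M.exists_lie_lie_eq F a (D.σ a) a
  obtain ⟨k', hk'⟩ := M.exists_lie_lie_eq F a (D.σ a) (D.σ a)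
  set q := D.Om a (D.σ u)
  set p := D.Om w (D.σ w)
  rw [hv] at hk hk'
  simp only [add_lie, smul_lie, hu, hσu, smul_zero, add_zero, hwa, haw', hwa0, hww', haw,
    F.lie_aw, map_add, map_smulₛₗ, D.σ_σ, map_one, one_mul, map_neg, map_div₀, hpc, map_mul,
    Complex.conj_conj, map_sub] at hk hk'
  have e1 : (-(q / p * (1 - t - conj t))) • u + (conj q / q) • D.σ u = k • M.ψ₂ u := by
    rw [← hk]
    match_scalars <;> field_simp <;> ring
  have e2 : (-(q / conj q)) • u + (-(conj q / p * (1 - t - conj t))) • D.σ u = k' • M.ψ₂ u := by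
    rw [← hk']
    match_scalars <;> field_simp <;> ring
  have e3 : ∀ x y : ℂ, x * k + y * k' = 0 → -(x * (q / p * (1 - t - conj t))) - y * (q / conj q) = 0 ∧
      x * (conj q / q) - y * (conj q / p * (1 - t - conj t)) = 0 := by
    intro x y hxy
    obtain ⟨-, -, h3, -, -, h6⟩ := F.indep₆ (c₁ := 0) (c₂ := 0)
      (c₃ := -(x * (q / p * (1 - t - conj t))) - y * (q / conj q)) (c₄ := 0) (c₅ := 0)
      (c₆ := x * (conj q / q) - y * (conj q / p * (1 - t - conj t))) (by
        have : (x * k + y * k') • M.ψ₂ u = 0 := by rw [hxy, zero_smul]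
        rw [← this, add_smul, mul_smul, mul_smul, ← e1, ← e2]
        module)
    exact ⟨h3, h6⟩
  have hk' : k' ≠ 0 := by
    rintro rfl
    have := (e3 0 1 (by simp)).1
    simp [hq] at this
  obtain ⟨h1, h2⟩ := e3 k' (-k) (by ring)
  have h3 : k = k' * (1 - t - conj t) * conj q / p := by
    field_simp at h1 ⊢
    exact mul_left_cancel₀ hq (by linear_combination h1)
  subst h3
  field_simp at h2
  have h4 : k' * (q * conj q * (1 - t - conj t) ^ 2) = k' * -p ^ 2 :=
    mul_left_cancel₀ hq' (by linear_combination h2)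
  exact mul_left_cancel₀ hk' h4

end SelfMirror

end PKData

end WeakSelfMirror

/-! ### Balanced frames -/

namespace WeakSelfMirror

open scoped ComplexConjugate

namespace PKData

variable {L : Type*} [LieRing L] [LieAlgebra ℂ L] {D : PKData L}

namespace SelfMirror

variable {a w u : L} {s t : ℂ}

/-- After rescaling `a` by a unit, the form is in a normal position. -/
theorem exists_balanced_frame (M : D.SelfMirror) (F : D.Frame a w u 1 0 1 t 0) :
    ∃ a w u : L, D.Frame a w u 1 0 1 t 0 ∧
      D.Om a (D.σ u) * (1 - t - conj t) = -D.Om w (D.σ w) := by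
  obtain ⟨hm, hn⟩ := M.Om_u_eq_zero F (Or.inl one_ne_zero)
  obtain ⟨hq, hp⟩ := F.Om_ne_zero hn hm
  have rel := M.Om_relation F
  have hpc : conj (D.Om w (D.σ w)) = -D.Om w (D.σ w) := conj_Om_self_σ w
  obtain ⟨ρ, hρ⟩ : ∃ ρ, ρ = 1 - t - conj t := ⟨_, rfl⟩
  have hρc : conj ρ = ρ := by rw [hρ]; simp; ring
  set q := D.Om a (D.σ u) with hqdef
  set p := D.Om w (D.σ w) with hpdef
  rw [← hρ] at rel ⊢
  have hρ0 : ρ ≠ 0 := by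
    rintro rfl
    apply hp
    simpa using rel.symm
  -- Since `ρ` is real and `p` imaginary, `rel` says that `-p / (q * ρ)` has modulus one. Hence its
  -- square root `y` does too.
  obtain ⟨y, hy⟩ := IsAlgClosed.exists_pow_nat_eq (-p / (q * ρ)) (n := 2) (by norm_num)
  have hq' := (map_ne_zero (starRingEnd ℂ)).2 hq
  have hy1 : y * conj y = 1 := by
    have h1 : (y * conj y) ^ 2 = 1 := by
      rw [mul_pow, ← map_pow, hy, map_div₀, map_neg, hpc, map_mul, hρc]
      field_simp
      linear_combination -rel
    rw [Complex.mul_conj] at h1 ⊢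
    have h2 : (Complex.normSq y) ^ 2 = 1 := by exact_mod_cast h1
    have h3 := Complex.normSq_nonneg y
    have h4 : Complex.normSq y = 1 := by nlinarith
    rw [h4]; simp
  have hy0 : conj y ≠ 0 := by
    intro h
    rw [h, mul_zero] at hy1
    exact zero_ne_one hy1
  -- Scaling `a, w, u` by the first three powers of the unit `conj y` keeps the products and `p`,
  -- and multiplies `q` by `y ^ 2`.
  have F' := F.rescale F (conj y) (conj y ^ 3) hy0 (pow_ne_zero _ hy0)
  rw [div_self (pow_ne_zero _ hy0), one_mul, one_mul] at F'
  refine ⟨_, _, _, F', ?_⟩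
  simp only [map_smul, map_smulₛₗ, LinearMap.smul_apply, smul_eq_mul, map_pow, Complex.conj_conj,
    ← hqdef, ← hpdef]
  have h5 : y ^ 2 * (q * ρ) = -p := by rw [hy]; field_simp
  linear_combination (y ^ 2 * (q * ρ) + p * (y * conj y + 1)) * hy1 + h5

/-- The brackets in a balanced frame. -/
theorem lie_table (M : D.SelfMirror) (F : D.Frame a w u 1 0 1 t 0)
    (hb : D.Om a (D.σ u) * (1 - t - conj t) = -D.Om w (D.σ w)) :
    (∀ l : L, ⁅u, l⁆ = 0) ∧ ⁅a, w⁆ = (1 - t) • u ∧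
      ⁅a, D.σ w⁆ = (1 - t - conj t) • D.σ u + conj t • u ∧ ⁅w, D.σ w⁆ = 0 ∧
      conj (D.Om a (D.σ u)) = -D.Om a (D.σ u) ∧ 1 - t - conj t ≠ 0 ∧
      ∃ c₁ c₂ : ℂ, ⁅a, D.σ a⁆ =
        (1 - t - conj t)⁻¹ • (D.σ w - w) + c₁ • u + c₂ • D.σ u := by
  obtain ⟨hm, hn⟩ := M.Om_u_eq_zero F (Or.inl one_ne_zero)
  obtain ⟨hq, hp⟩ := F.Om_ne_zero hn hm
  have hpc : conj (D.Om w (D.σ w)) = -D.Om w (D.σ w) := conj_Om_self_σ w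
  have hv := F.exists_lie_aσa hn hm
  have haw := F.lie_aσw hn hm
  obtain ⟨ρ, hρ⟩ : ∃ ρ, ρ = 1 - t - conj t := ⟨_, rfl⟩
  have hρc : conj ρ = ρ := by rw [hρ]; simp; ring
  rw [← hρ] at hb ⊢
  set q := D.Om a (D.σ u)
  set p := D.Om w (D.σ w)
  have hρ0 : ρ ≠ 0 := by
    rintro rfl
    apply hp
    simpa using hb.symm
  have hqc : conj q = -q := by
    have h1 := congrArg conj hb
    rw [map_mul, map_neg, hρc, hpc] at h1
    exact mul_right_cancel₀ hρ0 (by linear_combination h1 + hb)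
  have hp' : p = -(q * ρ) := by linear_combination hb
  refine ⟨F.lie_u hm (Or.inr hn), F.lie_aw, ?_, F.lie_wσw hn hm, hqc, hρ0, ?_⟩
  · rw [haw, hqc, hp']
    match_scalars <;> field_simp
  · obtain ⟨c₁, c₂, h⟩ := hv
    refine ⟨c₁, c₂, ?_⟩
    rw [h, hqc, hp']
    match_scalars <;> field_simp <;> simp

end SelfMirror

end PKData

end WeakSelfMirror

/-! ### The parameter `t` and the complex classification -/

namespace WeakSelfMirror

open scoped ComplexConjugate

namespace PKData

variable {L : Type*} [LieRing L] [LieAlgebra ℂ L] {D : PKData L}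

/-- The bracket of the semidirect product of `L` with itself as a left symmetric module. -/
def semidirect (D : PKData L) : (L × L) →ₗ[ℂ] (L × L) →ₗ[ℂ] (L × L) :=
  LinearMap.mk₂ ℂ (fun x y => (⁅x.1, y.1⁆, D.mul x.1 y.2 - D.mul y.1 x.2))
    (fun x x' y => by ext <;> simp; abel)
    (fun c x y => by ext <;> simp [smul_sub])
    (fun x y y' => by ext <;> simp; abel)
    (fun c x y => by ext <;> simp [smul_sub])

@[simp]
theorem semidirect_apply (x y : L × L) :
    D.semidirect x y = (⁅x.1, y.1⁆, D.mul x.1 y.2 - D.mul y.1 x.2) := rfl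

namespace SelfMirror

variable {a w u : L} {s t : ℂ}

/-- Through `ψ`, an element commutes with `v` exactly when its component along `M.ψ₁ a` is zero,
because `k₁ ≠ 0`. The brackets of two such elements only involve `M.ψ₂ u`. -/
theorem lie_X_mem (M : D.SelfMirror) (F : D.Frame a w u 1 0 1 t 0) {v x y : L}
    (hv : ∃ k k₁ k₂ : ℂ, v = k • M.ψ₁ u + k₁ • M.ψ₂ w + k₂ • M.ψ₂ u) (h0 : ⁅a, v⁆ ≠ 0)
    (hx : ⁅x, v⁆ = 0) (hy : ⁅y, v⁆ = 0) : ∃ k : ℂ, ⁅x, y⁆ = k • M.ψ₂ u := by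
  obtain ⟨k, k₁, k₂, hv⟩ := hv
  have hv' : v = M.ψ₁ (k • u) + M.ψ₂ (k₁ • w + k₂ • u) := by
    rw [hv]; simp only [map_add, map_smul]; abel
  have formula : ∀ x₁ x₂ x₃ y₁ y₂ y₃ : ℂ,
      ⁅M.ψ₁ (x₁ • a + x₂ • w + x₃ • u) + M.ψ₂ (y₁ • a + y₂ • w + y₃ • u), v⁆ =
        (k₁ * x₁) • M.ψ₂ u := by
    intro x₁ x₂ x₃ y₁ y₂ y₃
    have hAx : ∀ c₁ c₂ c₃ : ℂ, c₁ • a + c₂ • w + c₃ • u ∈ D.A := fun c₁ c₂ c₃ =>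
      add_mem (add_mem (D.A.smul_mem _ F.a_mem) (D.A.smul_mem _ F.w_mem)) (D.A.smul_mem _ F.u_mem)
    rw [hv', M.lie_eq (hAx _ _ _) (hAx _ _ _) (D.A.smul_mem _ F.u_mem)
      (add_mem (D.A.smul_mem _ F.w_mem) (D.A.smul_mem _ F.u_mem)), ← D.mul_sub_mul]
    simp only [map_add, map_smul, LinearMap.smul_apply, LinearMap.add_apply, F.ua, F.uw, F.uu,
      F.au, F.wu, F.aw, F.ww, map_sub, map_zero]
    module
  have decomp : ∀ l : L, ∃ x₁ x₂ x₃ y₁ y₂ y₃ : ℂ,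
      l = M.ψ₁ (x₁ • a + x₂ • w + x₃ • u) + M.ψ₂ (y₁ • a + y₂ • w + y₃ • u) := by
    intro l
    obtain ⟨x, hx, y, hy, rfl⟩ := M.surj l
    obtain ⟨x₁, x₂, x₃, rfl⟩ := F.span x hx
    obtain ⟨y₁, y₂, y₃, rfl⟩ := F.span y hy
    exact ⟨x₁, x₂, x₃, y₁, y₂, y₃, rfl⟩
  have hk₁ : k₁ ≠ 0 := by
    rintro rfl
    apply h0
    have : ∀ l : L, ⁅l, v⁆ = 0 := fun l => by
      obtain ⟨x₁, x₂, x₃, y₁, y₂, y₃, rfl⟩ := decomp l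
      rw [formula, zero_mul, zero_smul]
    exact this a
  have hu0 : M.ψ₂ u ≠ 0 := fun h =>
    F.u_ne (M.inj 0 D.A.zero_mem u F.u_mem (by rw [h, map_zero, add_zero])).2
  obtain ⟨x₁, x₂, x₃, x₁', x₂', x₃', rfl⟩ := decomp x
  obtain ⟨y₁, y₂, y₃, y₁', y₂', y₃', rfl⟩ := decomp y
  rw [formula] at hx hy
  obtain rfl : x₁ = 0 := by simpa [hk₁, hu0] using hx
  obtain rfl : y₁ = 0 := by simpa [hk₁, hu0] using hy
  have hAx : ∀ c₁ c₂ c₃ : ℂ, c₁ • a + c₂ • w + c₃ • u ∈ D.A := fun c₁ c₂ c₃ =>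
    add_mem (add_mem (D.A.smul_mem _ F.a_mem) (D.A.smul_mem _ F.w_mem)) (D.A.smul_mem _ F.u_mem)
  rw [M.lie_eq (hAx _ _ _) (hAx _ _ _) (hAx _ _ _) (hAx _ _ _), ← D.mul_sub_mul, F.mul_coords,
    F.mul_coords, F.mul_coords, F.mul_coords]
  refine ⟨t * (x₂ * y₁' - y₂ * x₁'), ?_⟩
  simp only [map_sub, map_add, map_smul]
  module

/-- For `t ≠ 0, 1` the algebra `L` and both semidirect products have bases of the shape treated in
`exists_leading_coefficients`, so `ψ` and `χ` are triangular. Adjointness ties their diagonal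
entries and forces the real number `ρ = 1 - 2t` to satisfy `ρ ^ 2 = -1`. -/
theorem eq_zero_or_eq_one (M : D.SelfMirror) (F : D.Frame a w u 1 0 1 t 0)
    (hb : D.Om a (D.σ u) * (1 - t - conj t) = -D.Om w (D.σ w)) : t = 0 ∨ t = 1 := by
  by_contra! hne
  obtain ⟨ht0, ht1⟩ := hne
  obtain ⟨hm, hn⟩ := M.Om_u_eq_zero F (Or.inl one_ne_zero)
  obtain ⟨hq0, hp0⟩ := F.Om_ne_zero hn hm
  have T := F.Om_table rfl rfl rfl rfl hn hm
  obtain ⟨hu, haw, haσw, hwσw, hqc, hρ0, c₁, c₂, hv⟩ := M.lie_table F hb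
  obtain ⟨ρ, hρ⟩ : ∃ ρ, ρ = 1 - t - conj t := ⟨_, rfl⟩
  have hρc : conj ρ = ρ := by rw [hρ]; simp; ring
  rw [← hρ] at hb haσw hρ0 hv
  have hσu : ∀ l : L, ⁅D.σ u, l⁆ = 0 := fun l => by rw [← D.σ_σ l, ← D.σ_lie, hu, map_zero]
  have hu' : ∀ l : L, ⁅l, u⁆ = 0 := fun l => by rw [← lie_skew, hu, neg_zero]
  have hσu' : ∀ l : L, ⁅l, D.σ u⁆ = 0 := fun l => by rw [← lie_skew, hσu, neg_zero]
  have hσaw : ⁅D.σ a, w⁆ = ρ • u + t • D.σ u := by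
    have h := congrArg D.σ haσw
    rw [D.σ_lie, D.σ_σ] at h
    rw [h, map_add, map_smulₛₗ, map_smulₛₗ, D.σ_σ, hρc, Complex.conj_conj]
  have hσaσw : ⁅D.σ a, D.σ w⁆ = (1 - conj t) • D.σ u := by
    rw [← D.σ_lie, haw, map_smulₛₗ, map_sub, map_one]
  have hav : ⁅a, ⁅a, D.σ a⁆⁆ = D.σ u - u := by
    rw [hv]
    simp only [lie_add, lie_smul, lie_sub, haσw, haw, hu', hσu', smul_zero, add_zero]
    match_scalars <;> field_simp
    rw [hρ]; ring
  have hσav : ⁅D.σ a, ⁅a, D.σ a⁆⁆ = D.σ u - u := by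
    rw [hv]
    simp only [lie_add, lie_smul, lie_sub, hσaσw, hσaw, hu', hσu', smul_zero, add_zero]
    match_scalars <;> field_simp
    rw [hρ]; ring
  have hwv : ⁅w, ⁅a, D.σ a⁆⁆ = 0 := by
    rw [hv]
    simp only [lie_add, lie_smul, lie_sub, lie_self, hwσw, hu', hσu', smul_zero, add_zero,
      sub_zero]
  have hζ0 : u - D.σ u ≠ 0 := by
    intro h
    have := (F.indep₆ (c₁ := 0) (c₂ := 0) (c₃ := 1) (c₄ := 0) (c₅ := 0) (c₆ := -1)
      (by rw [← h]; module)).2.2.1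
    exact one_ne_zero this
  have hXv : ⁅a - D.σ a, ⁅a, D.σ a⁆⁆ = 0 := by rw [sub_lie, hav, hσav, sub_self]
  have hXw : ⁅a - D.σ a, w⁆ = conj t • u - t • D.σ u := by
    rw [sub_lie, haw, hσaw, hρ]
    module
  have hav0 : ⁅a, ⁅a, D.σ a⁆⁆ ≠ 0 := by
    rw [hav, ← neg_sub, neg_ne_zero]; exact hζ0
  -- Both `a - D.σ a` and `w` commute with `⁅a, D.σ a⁆`, so their bracket lies in the line of `M.ψ₂
  -- u`. That line also contains `u - D.σ u`, and proportionality of the two makes `t` real.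
  have htc : conj t = t := by
    obtain ⟨k, k₁, k₂, h⟩ := M.exists_lie_eq F a (D.σ a)
    obtain ⟨k', hk'⟩ := M.lie_X_mem F ⟨_, _, _, h⟩ hav0 hXv hwv
    obtain ⟨k'', hk''⟩ := M.exists_lie_lie_eq F a (D.σ a) a
    rw [← lie_skew, hav, neg_sub] at hk''
    rw [hXw] at hk'
    have hk0 : k'' ≠ 0 := by
      rintro rfl
      rw [zero_smul] at hk''
      exact hζ0 hk''
    obtain ⟨-, -, h3, -, -, h6⟩ := F.indep₆ (c₁ := 0) (c₂ := 0) (c₃ := k'' * conj t - k')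
      (c₄ := 0) (c₅ := 0) (c₆ := -(k'' * t - k')) (by
        have : k'' • (k' • M.ψ₂ u) = k' • (k'' • M.ψ₂ u) := smul_comm _ _ _
        rw [← hk', ← hk''] at this
        linear_combination (norm := module) this)
    exact mul_left_cancel₀ hk0 (by linear_combination h3 + h6)
  rw [htc] at hXw
  have hXa : ⁅a, a - D.σ a⁆ = -⁅a, D.σ a⁆ := by rw [lie_sub, lie_self, zero_sub]
  have ht1' := sub_ne_zero.2 ht1.symm
  have span : ∀ l : L, ∃ x₁ x₂ x₃ x₄ x₅ x₆ : ℂ, l = x₁ • a + x₂ • (a - D.σ a) + x₃ • w +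
      x₄ • (-⁅a, D.σ a⁆) + x₅ • ((1 - t) • u) + x₆ • (u - D.σ u) := by
    intro l
    obtain ⟨d₁, d₂, d₃, d₄, d₅, d₆, rfl⟩ := F.exists_coords l
    refine ⟨d₁ + d₄, -d₄, d₂ + d₅, -ρ * d₅,
      (d₃ + d₆ - ρ * d₅ * (c₁ + c₂)) / (1 - t), ρ * d₅ * c₂ - d₆, ?_⟩
    rw [hv]
    match_scalars <;> field_simp <;> ring
  have e12 : ⁅M.ψ₁ a, M.ψ₂ a⁆ = M.ψ₂ w := by
    rw [M.ψ₁_ψ₂ a F.a_mem a F.a_mem, F.aa]; simp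
  have e14 : ⁅M.ψ₁ a, M.ψ₂ w⁆ = M.ψ₂ u := by
    rw [M.ψ₁_ψ₂ a F.a_mem w F.w_mem, F.aw]; simp
  have e13 : ⁅M.ψ₁ a, M.ψ₁ w⁆ = (1 - t) • M.ψ₁ u := by
    rw [M.ψ₁_ψ₁ a F.a_mem w F.w_mem, haw, map_smul]
  have e23 : ⁅M.ψ₂ a, M.ψ₁ w⁆ = (-t) • M.ψ₂ u := by
    rw [← lie_skew, M.ψ₁_ψ₂ w F.w_mem a F.a_mem, F.wa, map_smul, neg_smul]
  have e24 : ⁅M.ψ₂ a, M.ψ₂ w⁆ = 0 := M.ψ₂_ψ₂ a F.a_mem w F.w_mem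
  have e34 : ⁅M.ψ₁ w, M.ψ₂ w⁆ = 0 := by
    rw [M.ψ₁_ψ₂ w F.w_mem w F.w_mem, F.ww, zero_smul, map_zero]
  have e15 : ⁅M.ψ₁ a, M.ψ₁ u⁆ = 0 := by
    rw [M.ψ₁_ψ₁ a F.a_mem u F.u_mem, hu', map_zero]
  have hψu : M.ψ₂ u ≠ 0 := fun h =>
    F.u_ne (M.inj 0 D.A.zero_mem u F.u_mem (by rw [h, map_zero, add_zero])).2
  have br : ∀ x y : L, lieBilin L x y = ⁅x, y⁆ := fun _ _ => rfl
  -- The images under `ψ` satisfy the same bracket pattern as the basis of `L`, except that the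
  -- constant of `[2,3]` is `-t` instead of `t`. This sign is the source of the contradiction.
  obtain ⟨l, m, n, hl, -, hnl, ⟨x₂, x₃, x₄, x₅, x₆, E₁⟩, -, ⟨y₄, y₅, y₆, E₃⟩, -, ⟨z₆, E₅⟩, -⟩ :=
    exists_leading_coefficients (lieBilin L) (fun x y => (lie_skew x y).symm)
      (c := -t) (d := t) (f₁ := a) (f₂ := a - D.σ a) (f₃ := w) (f₄ := -⁅a, D.σ a⁆)
      (f₅ := (1 - t) • u) (f₆ := u - D.σ u) (E₁ := M.ψ₁ a) (E₂ := M.ψ₂ a) (E₃ := M.ψ₁ w)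
      hXa haw (by rw [br, lie_neg, hav, neg_sub]) (by rw [br, hXw, smul_sub])
      (by rw [br, lie_neg, hXv, neg_zero]) (by rw [br, lie_neg, hwv, neg_zero])
      (fun x => by rw [br, smul_lie, hu, smul_zero])
      (fun x => by rw [br, sub_lie, hu, hσu, sub_zero]) hζ0 (span _) (span _) (span _)
      (by rw [br, br, e12, e14]; exact hψu) (by rw [br, br, e12, e24])
      (by rw [br, br, e12, e34]) (by rw [br, br, e13, lie_smul, e15, smul_zero])
      (by rw [br, br, br, e12, e14, e23])
  rw [br, e13] at E₅
  have hσA : ∀ x : L, D.σ x ∈ D.A → ∃ d₁ d₂ d₃ : ℂ,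
      x = d₁ • D.σ a + d₂ • D.σ w + d₃ • D.σ u := by
    intro x hx
    obtain ⟨d₁, d₂, d₃, h⟩ := F.span _ hx
    exact ⟨conj d₁, conj d₂, conj d₃, by rw [← D.σ_σ x, h]; simp only [map_add, map_smulₛₗ]⟩
  have spanχ : ∀ l : L, ∃ x₁ x₂ x₃ x₄ x₅ x₆ : ℂ, (M.χ₁ l, M.χ₂ l) =
      x₁ • (D.σ a, (0 : L)) + x₂ • ((0 : L), D.σ a) + x₃ • (D.σ w, (0 : L)) +
      x₄ • ((0 : L), D.σ w) + x₅ • ((1 - t) • D.σ u, (0 : L)) + x₆ • ((0 : L), D.σ u) := by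
    intro l
    obtain ⟨d₁, d₂, d₃, h⟩ := hσA _ (M.χ₁_mem l)
    obtain ⟨d₄, d₅, d₆, h'⟩ := hσA _ (M.χ₂_mem l)
    refine ⟨d₁, d₄, d₂, d₅, d₃ / (1 - t), d₆, ?_⟩
    rw [h, h']
    ext
    · simp only [Prod.fst_add, Prod.smul_fst, smul_zero, add_zero]
      match_scalars <;> field_simp
    · simp only [Prod.snd_add, Prod.smul_snd, smul_zero, add_zero, zero_add]
  have hχ : ∀ x y : L, D.semidirect (M.χ₁ x, M.χ₂ x) (M.χ₁ y, M.χ₂ y) =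
      (M.χ₁ ⁅x, y⁆, M.χ₂ ⁅x, y⁆) := fun x y => by
    rw [semidirect_apply, M.χ₁_lie, M.χ₂_lie]
  have hχ0 : ∀ x : L, (M.χ₁ x, M.χ₂ x) = 0 → x = 0 := by
    intro x h
    obtain ⟨h1, h2⟩ := Prod.mk.inj h
    refine D.nondeg _ fun y => ?_
    obtain ⟨p, hp, q, hq, rfl⟩ := M.surj y
    rw [D.Om_skew, M.compat p hp q hq, h1, h2]
    simp
  have hχz : (M.χ₁ 0, M.χ₂ 0) = (0 : L × L) := by simp
  have sk : ∀ x y : L × L, D.semidirect x y = -D.semidirect y x := by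
    intro x y
    simp only [semidirect_apply, Prod.neg_mk, lie_skew, neg_sub]
  have hXX : ⁅a, ⁅a, a - D.σ a⁆⁆ = u - D.σ u := by rw [hXa, lie_neg, hav, neg_sub]
  have σaa : D.mul (D.σ a) (D.σ a) = D.σ w := by rw [← D.σ_mul, F.aa]; simp
  have σaw : D.mul (D.σ a) (D.σ w) = D.σ u := by rw [← D.σ_mul, F.aw]; simp
  have σwa : D.mul (D.σ w) (D.σ a) = t • D.σ u := by
    rw [← D.σ_mul, F.wa, map_smulₛₗ, htc]
  have σww : D.mul (D.σ w) (D.σ w) = 0 := by rw [← D.σ_mul, F.ww]; simp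
  have σux : ∀ x : L, D.mul (D.σ u) x = 0 := fun x =>
    D.ext_Om fun z => by rw [D.Om_mul, hσu, map_zero, neg_zero, map_zero, LinearMap.zero_apply]
  have xσu : ∀ x : L, D.mul x (D.σ u) = 0 := fun x => by
    have := D.mul_sub_mul x (D.σ u)
    rwa [σux, sub_zero, hσu'] at this
  -- For `χ` the roles are reversed: `L` is the source, with constant `t`, and the conjugate
  -- semidirect product is the target, with constant `-t`.
  obtain ⟨l', m', n', -, -, -, -, ⟨X₃, X₄, X₅, X₆, EX⟩, -, ⟨V₅, V₆, EV⟩, -, EZ⟩ :=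
    exists_leading_coefficients D.semidirect sk (c := t) (d := -t)
      (f₁ := (D.σ a, 0)) (f₂ := (0, D.σ a)) (f₃ := (D.σ w, 0)) (f₄ := (0, D.σ w))
      (f₅ := ((1 - t) • D.σ u, 0)) (f₆ := (0, D.σ u)) (E₁ := (M.χ₁ a, M.χ₂ a))
      (E₂ := (M.χ₁ (a - D.σ a), M.χ₂ (a - D.σ a))) (E₃ := (M.χ₁ w, M.χ₂ w))
      (by simp [σaa]) (by simp [hσaσw, htc]) (by simp [σaw]) (by simp [σwa])
      (by simp) (by simp [σww])
      (fun x => by simp [hσu, σux]) (fun x => by simp [xσu])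
      (by simpa using fun h => F.u_ne (by rw [← D.σ_σ u, h, map_zero]))
      (spanχ _) (spanχ _) (spanχ _)
      (by rw [hχ, hχ, hXX]; exact fun h => hζ0 (hχ0 _ h))
      (by rw [hχ, hχ, hXa, lie_neg, hXv, neg_zero, hχz])
      (by rw [hχ, hχ, hXa, lie_neg, hwv, neg_zero, hχz])
      (by rw [hχ, hχ, haw, lie_smul, hu', smul_zero, hχz])
      (by rw [hχ, hχ, hχ, hXX, hXw, ← smul_sub, map_smul, map_smul]; rfl)
  rw [hχ, hXa] at EV
  rw [hχ, hχ, hXX] at EZ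
  have EX' := congrArg Prod.snd EX
  have EV' := congrArg Prod.snd EV
  have EZ' := congrArg Prod.snd EZ
  simp only [Prod.snd_add, Prod.smul_snd, smul_zero, add_zero] at EX' EV' EZ'
  -- Adjointness is evaluated on pairs for which only leading coefficients contribute: `a` with the
  -- last basis vector of `L`, `u` with the second, `w` with the fourth.
  have C1 := M.compat a F.a_mem 0 D.A.zero_mem (u - D.σ u)
  have C2 := M.compat ((1 - t) • u) (D.A.smul_mem _ F.u_mem) 0 D.A.zero_mem (a - D.σ a)
  have C3 := M.compat w F.w_mem 0 D.A.zero_mem (-⁅a, D.σ a⁆)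
  rw [EZ', map_zero, add_zero, E₁, hv] at C1
  rw [EX', map_zero, add_zero, map_smul, E₅] at C2
  rw [EV', map_zero, add_zero, E₃, hv] at C3
  simp [T, hqc] at C1 C2 C3
  have k1 : l = l' ^ 2 * m' := C1.resolve_right hq0
  have k2 : l * n = m' :=
    mul_right_cancel₀ hq0 (mul_left_cancel₀ ht1' (by linear_combination C2))
  have k3 : n = ρ * (l' * m') := by
    field_simp at C3
    linear_combination C3
  have k4 : n = -l ^ 2 := mul_left_cancel₀ ht0 (by linear_combination hnl)
  have k5 : l' ^ 2 * n = 1 := mul_left_cancel₀ hl (by linear_combination -k1 + l' ^ 2 * k2)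
  have hn0 : n ≠ 0 := by
    rintro rfl
    simp at k5
  have k6 : ρ * l' * l = 1 :=
    mul_right_cancel₀ hn0 (by linear_combination -k3 + ρ * l' * k2)
  -- From `l' ^ 2 * n = 1` and `n = -l ^ 2` one gets `(l * l') ^ 2 = -1`, while `ρ * l' * l = 1`.
  have k7 : ρ ^ 2 = -1 := by
    linear_combination ρ ^ 2 * (-k5) + ρ ^ 2 * l' ^ 2 * k4 - (ρ * l' * l + 1) * k6 
  obtain ⟨x, rfl⟩ := Complex.conj_eq_iff_real.1 hρc
  have k8 : x ^ 2 = -1 := by exact_mod_cast k7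
  nlinarith [sq_nonneg x]

/-- The first alternative collects the degenerate product tables, whose derived algebra is at most a
line. The other three are the complex forms of `h₆`, of `h₁₀` (`t = 0`) and of `h₉` (`t = 1`). -/
theorem classification [FiniteDimensional ℂ L] (M : D.SelfMirror)
    (hfin : Module.finrank ℂ D.A = 3)
    (hP : ∀ S : Submodule ℂ L, ¬D.A ≤ S → ∃ x ∈ D.A, x ∉ S ∧ ∀ y ∈ D.A, D.mul y x ∈ S) :
    (∃ η : L, ∀ x y : L, ∃ c : ℂ, ⁅x, y⁆ = c • η) ∨
    ∃ (a w u : L) (β γ α κ δ : ℂ), D.Frame a w u β γ α κ δ ∧ (∀ l : L, ⁅u, l⁆ = 0) ∧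
      ⁅w, D.σ w⁆ = 0 ∧
      ((⁅a, w⁆ = u ∧ ⁅a, D.σ w⁆ = D.σ u ∧ ⁅a, D.σ a⁆ = 0) ∨
        (∃ c₁ c₂ : ℂ, ⁅a, w⁆ = u ∧ ⁅a, D.σ w⁆ = D.σ u ∧
          ⁅a, D.σ a⁆ = D.σ w - w + c₁ • u + c₂ • D.σ u) ∨
        ∃ c₁ c₂ : ℂ, ⁅a, w⁆ = 0 ∧ ⁅a, D.σ w⁆ = u - D.σ u ∧
          ⁅a, D.σ a⁆ = w - D.σ w + c₁ • u + c₂ • D.σ u) := by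
  obtain ⟨a, w, u, β, γ, α, κ, δ, F, hβδ⟩ := D.exists_frame hfin hP
  by_cases hβ : β = 0
  · subst hβ
    by_cases hακ : α = κ
    · subst hακ
      refine Or.inl ⟨M.ψ₂ u, fun x y => ?_⟩
      obtain ⟨k, k₁, k₂, h⟩ := M.exists_lie_eq F x y
      exact ⟨k₂, by rw [h]; simp⟩
    · obtain ⟨a, w, F, hq, hn, hm⟩ := M.exists_frame_of_ne F hακ
      obtain ⟨h1, h2, h3, h4, h5⟩ := F.lie_table_h6 hq hn hm
      exact Or.inr ⟨a, w, u, _, _, _, _, _, F, h1, h5, Or.inl ⟨h2, h3, h4⟩⟩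
  · obtain rfl : δ = 0 := by simpa [hβ] using hβδ
    have F₁ := F.normalize_w F hβ
    by_cases h0 : α = 0 ∧ κ = 0
    · obtain ⟨rfl, rfl⟩ := h0
      refine Or.inl ⟨M.ψ₂ (β • w + γ • u), fun x y => ?_⟩
      obtain ⟨x', hx, y', hy, rfl⟩ := M.surj x
      obtain ⟨z, hz, v, hv, rfl⟩ := M.surj y
      rw [M.lie_eq hx hy hz hv, ← D.mul_sub_mul]
      obtain ⟨x₁, x₂, x₃, rfl⟩ := F.span x' hx
      obtain ⟨y₁, y₂, y₃, rfl⟩ := F.span y' hy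
      obtain ⟨z₁, z₂, z₃, rfl⟩ := F.span z hz
      obtain ⟨v₁, v₂, v₃, rfl⟩ := F.span v hv
      rw [F.mul_coords, F.mul_coords, F.mul_coords, F.mul_coords]
      simp only [map_sub, map_add, map_smul]
      refine ⟨x₁ * v₁ - z₁ * y₁, ?_⟩
      module
    · have h : β * α ≠ 0 ∨ β * κ ≠ 0 := by
        simp only [ne_eq, mul_eq_zero, hβ, false_or]
        tauto
      obtain ⟨u', t', F₂⟩ := M.exists_normalized_frame F₁ h
      obtain ⟨a, w, u, F, hb⟩ := M.exists_balanced_frame F₂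
      obtain ⟨hu, haw, haσw, hwσw, -, -, c₁, c₂, hv⟩ := M.lie_table F hb
      refine Or.inr ⟨a, w, u, _, _, _, _, _, F, hu, hwσw, ?_⟩
      rcases M.eq_zero_or_eq_one F hb with rfl | rfl
      · refine Or.inr (Or.inl ⟨c₁, c₂, ?_, ?_, ?_⟩)
        · rw [haw]; simp
        · rw [haσw]; simp
        · rw [hv]; simp
      · refine Or.inr (Or.inr ⟨c₁, c₂, ?_, ?_, ?_⟩)
        · rw [haw]; simp
        · rw [haσw, map_one]; module
        · rw [hv, map_one]
          match_scalars <;> norm_num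

end SelfMirror

end PKData

end WeakSelfMirror

/-! ### Nilpotency and complexification -/

namespace WeakSelfMirror

open scoped ComplexConjugate

section Filtration

/-- The lower central series, indexed from `0` so that its first term is everything; hence the extra
`1` in the index of a bracket. The inclusion follows from the Jacobi identity by induction on `i`.
-/
theorem exists_filtration (L : Type*) [LieRing L] [LieAlgebra ℂ L] [LieRing.IsNilpotent L] :
    ∃ (N : ℕ → Submodule ℂ L) (n : ℕ), N 0 = ⊤ ∧ (∀ k, n ≤ k → N k = ⊥) ∧
      ∀ i j, ∀ x ∈ N i, ∀ y ∈ N j, ⁅x, y⁆ ∈ N (i + j + 1) := by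
  obtain ⟨n, hn⟩ := LieModule.IsNilpotent.nilpotent ℂ L L
  refine ⟨fun k => (LieModule.lowerCentralSeries ℂ L L k).toSubmodule, n, by simp,
    fun k hk => ?_, ?_⟩
  · have := LieModule.antitone_lowerCentralSeries ℂ L L hk
    rw [hn, le_bot_iff] at this
    simp [this]
  intro i
  induction i with
  | zero =>
    intro j x _ y hy
    rw [zero_add]
    rw [LieSubmodule.mem_toSubmodule] at hy ⊢
    rw [LieModule.lowerCentralSeries_succ]
    exact LieSubmodule.lie_mem_lie (LieSubmodule.mem_top x) hy
  | succ i ih =>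
    intro j x hx y hy
    have hspan := LieModule.lowerCentralSeries_succ ℂ L L i
    change x ∈ (LieModule.lowerCentralSeries ℂ L L (i + 1)).toSubmodule at hx
    rw [hspan, LieSubmodule.lieIdeal_oper_eq_linear_span'] at hx
    induction hx using Submodule.span_induction with
    | zero => rw [zero_lie]; exact zero_mem _
    | add x x' _ _ h h' => rw [add_lie]; exact add_mem h h'
    | smul c x _ h => rw [smul_lie]; exact Submodule.smul_mem _ _ h
    | mem x hx =>
      obtain ⟨z, -, x, hx, rfl⟩ := hx
      rw [lie_lie]
      have step : ∀ k z, ∀ l ∈ (LieModule.lowerCentralSeries ℂ L L k).toSubmodule,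
          ⁅z, l⁆ ∈ (LieModule.lowerCentralSeries ℂ L L (k + 1)).toSubmodule := fun k z l hl => by
        rw [LieSubmodule.mem_toSubmodule] at hl ⊢
        rw [LieModule.lowerCentralSeries_succ]
        exact LieSubmodule.lie_mem_lie (LieSubmodule.mem_top z) hl
      refine sub_mem ?_ ?_
      · have := step _ z _ (ih j x hx y hy)
        rwa [show i + j + 1 + 1 = i + 1 + j + 1 by ring] at this
      · have := ih (j + 1) x hx _ (step j z y hy)
        rwa [show i + (j + 1) + 1 = i + 1 + j + 1 by ring] at this

instance isNilpotent_complexification (g : Type*) [LieRing g] [LieAlgebra ℝ g]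
    [LieRing.IsNilpotent g] : LieRing.IsNilpotent (ℂ ⊗[ℝ] g) := by
  obtain ⟨n, hn⟩ := LieModule.IsNilpotent.nilpotent ℝ g g
  have key : ∀ k, LieModule.lowerCentralSeries ℂ (ℂ ⊗[ℝ] g) (ℂ ⊗[ℝ] g) k =
      (LieModule.lowerCentralSeries ℝ g g k).baseChange ℂ := by
    intro k
    induction k with
    | zero => simp
    | succ k ih =>
      rw [LieModule.lowerCentralSeries_succ, LieModule.lowerCentralSeries_succ, ih,
        LieSubmodule.lie_baseChange, LieSubmodule.baseChange_top]
  exact (LieModule.isNilpotent_iff ℂ _ _).2 ⟨n, by rw [key, hn, LieSubmodule.baseChange_bot]⟩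

end Filtration

namespace PKData

variable {L : Type*} [LieRing L] [LieAlgebra ℂ L] (D : PKData L)

/-- The `Om`-orthogonals of the lower central series filter `A`, and `D.mul y` lowers this
filtration, because it is minus the adjoint of `ad y`. A vector outside `S` at the lowest possible
level is therefore sent into `S` by every `y` in `A`. -/
theorem exists_mem_not_mem [LieRing.IsNilpotent L] (S : Submodule ℂ L) (hS : ¬D.A ≤ S) :
    ∃ x ∈ D.A, x ∉ S ∧ ∀ y ∈ D.A, D.mul y x ∈ S := by
  obtain ⟨N, n, h0, hn, hN⟩ := exists_filtration L
  have hex : ∃ k, ∃ x ∈ D.A, (∀ z ∈ N k, D.Om x z = 0) ∧ x ∉ S := by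
    obtain ⟨x, hx, hxS⟩ := Set.not_subset.1 hS
    refine ⟨n, x, hx, fun z hz => ?_, hxS⟩
    rw [hn n le_rfl, Submodule.mem_bot] at hz
    rw [hz, map_zero]
  classical
  obtain ⟨x, hx, hxN, hxS⟩ := Nat.find_spec hex
  refine ⟨x, hx, hxS, fun y hy => ?_⟩
  obtain ⟨k, hk⟩ : ∃ k, Nat.find hex = k + 1 := by
    -- Level zero is excluded: a vector orthogonal to all of `L` is zero and lies in `S`.
    refine Nat.exists_eq_succ_of_ne_zero fun h => hxS ?_
    rw [h, h0] at hxN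
    rw [D.nondeg x fun z => hxN z trivial]
    exact zero_mem _
  by_contra hmem
  refine Nat.find_min hex (m := k) (by omega) ⟨D.mul y x, D.mul_mem hy hx, fun z hz => ?_, hmem⟩
  rw [D.Om_mul, neg_eq_zero]
  apply hxN
  rw [hk]
  have := hN 0 k y (by rw [h0]; trivial) z hz
  rwa [zero_add] at this

end PKData

/-- The complex conjugation of the complexification of a real vector space. -/
def conjugation (g : Type*) [AddCommGroup g] [Module ℝ g] :
    (ℂ ⊗[ℝ] g) →ₛₗ[starRingEnd ℂ] (ℂ ⊗[ℝ] g) where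
  toFun := TensorProduct.map (Complex.conjAe.toLinearMap) (LinearMap.id : g →ₗ[ℝ] g)
  map_add' := map_add _
  map_smul' c x := by
    induction x using TensorProduct.induction_on with
    | zero => simp
    | tmul a x => simp [TensorProduct.smul_tmul']
    | add x y hx hy => rw [smul_add, map_add, hx, hy, map_add, smul_add]

@[simp]
theorem conjugation_tmul {g : Type*} [AddCommGroup g] [Module ℝ g] (c : ℂ) (x : g) :
    conjugation g (c ⊗ₜ x) = conj c ⊗ₜ x := rfl

section

variable {g : Type*} [LieRing g] [LieAlgebra ℝ g]

theorem lieBilin_tmul (c d : ℂ) (x y : g) :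
    lieBilin (ℂ ⊗[ℝ] g) (c ⊗ₜ x) (d ⊗ₜ y) = (c * d) ⊗ₜ ⁅x, y⁆ := rfl

theorem conjugation_conjugation (x : ℂ ⊗[ℝ] g) : conjugation g (conjugation g x) = x := by
  induction x using TensorProduct.induction_on with
  | zero => simp
  | tmul a x => simp
  | add x y hx hy => rw [map_add, map_add, hx, hy]

theorem conjugation_lie (x y : ℂ ⊗[ℝ] g) : conjugation g (lieBilin (ℂ ⊗[ℝ] g) x y) =
    lieBilin (ℂ ⊗[ℝ] g) (conjugation g x) (conjugation g y) := by
  induction x using TensorProduct.induction_on with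
  | zero => simp
  | add x z hx hz => simp only [map_add, LinearMap.add_apply, hx, hz]
  | tmul a x =>
    induction y using TensorProduct.induction_on with
    | zero => simp
    | add y z hy hz => simp only [map_add, hy, hz]
    | tmul b y => simp only [lieBilin_tmul, conjugation_tmul, map_mul]

namespace ComplexStructure

theorem JC_conjugation (J : ComplexStructure g) (x : ℂ ⊗[ℝ] g) :
    J.JC (conjugation g x) = conjugation g (J.JC x) := by
  induction x using TensorProduct.induction_on with
  | zero => simp
  | tmul a x => simp [JC]
  | add x y hx hy => rw [map_add, map_add, map_add, map_add, hx, hy]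

theorem mem_g10 (J : ComplexStructure g) {x : ℂ ⊗[ℝ] g} :
    x ∈ J.g10.toSubmodule ↔ J.JC x = Complex.I • x :=
  Module.End.mem_eigenspace_iff

theorem mem_g01 (J : ComplexStructure g) {x : ℂ ⊗[ℝ] g} :
    x ∈ J.g01.toSubmodule ↔ J.JC x = (-Complex.I) • x :=
  Module.End.mem_eigenspace_iff

theorem conjugation_mem_g01 (J : ComplexStructure g) {x : ℂ ⊗[ℝ] g} :
    conjugation g x ∈ J.g01.toSubmodule ↔ x ∈ J.g10.toSubmodule := by
  rw [mem_g01, mem_g10, JC_conjugation, ← Complex.conj_I, ← map_smulₛₗ]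
  refine ⟨fun h => ?_, fun h => by rw [h]⟩
  rw [← conjugation_conjugation (J.JC x), h, conjugation_conjugation]

theorem conjugation_mem_g10 (J : ComplexStructure g) {x : ℂ ⊗[ℝ] g} :
    conjugation g x ∈ J.g10.toSubmodule ↔ x ∈ J.g01.toSubmodule := by
  rw [← conjugation_mem_g01, conjugation_conjugation]

end ComplexStructure

namespace SymplecticForm

variable [FiniteDimensional ℝ g]

theorem formC_tmul (Ω : SymplecticForm g) (c d : ℂ) (x y : g) :
    Ω.formC (c ⊗ₜ x) (d ⊗ₜ y) = c * d * Ω.form x y := by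
  simp [formC, mul_comm]

theorem formC_conjugation (Ω : SymplecticForm g) (x y : ℂ ⊗[ℝ] g) :
    Ω.formC (conjugation g x) (conjugation g y) = conj (Ω.formC x y) := by
  induction x using TensorProduct.induction_on with
  | zero => simp
  | add x z hx hz => simp only [LinearMap.add_apply, map_add, hx, hz]
  | tmul a x =>
    induction y using TensorProduct.induction_on with
    | zero => simp
    | add y z hy hz => simp only [map_add, hy, hz]
    | tmul b y => simp only [formC_tmul, conjugation_tmul, map_mul, Complex.conj_ofReal]

theorem form_skew (Ω : SymplecticForm g) (x y : g) : Ω.form x y = -Ω.form y x :=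
  (Ω.alt.neg_eq y x).symm

theorem formC_skew (Ω : SymplecticForm g) (x y : ℂ ⊗[ℝ] g) :
    Ω.formC x y = -Ω.formC y x := by
  induction x using TensorProduct.induction_on with
  | zero => simp
  | add x z hx hz => simp only [LinearMap.add_apply, map_add, hx, hz, neg_add]
  | tmul a x =>
    induction y using TensorProduct.induction_on with
    | zero => simp
    | add y z hy hz => simp only [map_add, hy, hz, LinearMap.add_apply, neg_add]
    | tmul b y =>
      rw [formC_tmul, formC_tmul, Ω.form_skew]
      push_cast
      ring

theorem formC_closed (Ω : SymplecticForm g) (x y z : ℂ ⊗[ℝ] g) :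
    Ω.formC (lieBilin (ℂ ⊗[ℝ] g) x y) z + Ω.formC (lieBilin (ℂ ⊗[ℝ] g) y z) x +
      Ω.formC (lieBilin (ℂ ⊗[ℝ] g) z x) y = 0 := by
  induction x using TensorProduct.induction_on with
  | zero => simp
  | add x x' hx hx' =>
    simp only [LinearMap.add_apply, map_add]
    linear_combination hx + hx'
  | tmul a x =>
    induction y using TensorProduct.induction_on with
    | zero => simp
    | add y y' hy hy' =>
      simp only [LinearMap.add_apply, map_add]
      linear_combination hy + hy'
    | tmul b y =>
      induction z using TensorProduct.induction_on with
      | zero => simp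
      | add z z' hz hz' =>
        simp only [LinearMap.add_apply, map_add]
        linear_combination hz + hz'
      | tmul c z =>
        simp only [lieBilin_tmul, formC_tmul]
        have h : ((Ω.form ⁅x, y⁆ z + Ω.form ⁅y, z⁆ x + Ω.form ⁅z, x⁆ y : ℝ) : ℂ) = 0 := by
          rw [Ω.closed, Complex.ofReal_zero]
        push_cast at h
        linear_combination (a * b * c) * h

theorem formC_JC (Ω : SymplecticForm g) {J : ComplexStructure g} (h : IsPseudoKahler J Ω)
    (x y : ℂ ⊗[ℝ] g) : Ω.formC (J.JC x) (J.JC y) = Ω.formC x y := by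
  induction x using TensorProduct.induction_on with
  | zero => simp
  | add x z hx hz => simp only [LinearMap.add_apply, map_add, hx, hz]
  | tmul a x =>
    induction y using TensorProduct.induction_on with
    | zero => simp
    | add y z hy hz => simp only [map_add, hy, hz]
    | tmul b y => simp only [formC_tmul, ComplexStructure.JC, LinearMap.baseChange_tmul, h x y]

theorem contraction_apply (Ω : SymplecticForm g) (x y : ℂ ⊗[ℝ] g) :
    Ω.contraction x y = Ω.formC x y := rfl

theorem formC_contraction_symm (Ω : SymplecticForm g) (α : Module.Dual ℂ (ℂ ⊗[ℝ] g))
    (y : ℂ ⊗[ℝ] g) : Ω.formC (Ω.contraction.symm α) y = α y := by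
  rw [← contraction_apply, LinearEquiv.apply_symm_apply]

end SymplecticForm

variable [FiniteDimensional ℝ g]

/-- The complexification of a pseudo-Kähler Lie algebra. -/
noncomputable def pkData (J : ComplexStructure g) (Ω : SymplecticForm g) (h : IsPseudoKahler J Ω) :
    PKData (ℂ ⊗[ℝ] g) where
  σ := conjugation g
  Om := Ω.formC
  mul := LinearMap.mk₂ ℂ
    (fun x y => Ω.contraction.symm (-(Ω.contraction y ∘ₗ lieBilin (ℂ ⊗[ℝ] g) x)))
    (fun x x' y => by rw [map_add, LinearMap.comp_add, neg_add, map_add])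
    (fun c x y => by rw [map_smul, LinearMap.comp_smul, ← smul_neg, map_smul])
    (fun x y y' => by rw [map_add, LinearMap.add_comp, neg_add, map_add])
    (fun c x y => by rw [map_smul, LinearMap.smul_comp, ← smul_neg, map_smul])
  A := J.g10.toSubmodule
  σ_σ := conjugation_conjugation
  σ_lie := conjugation_lie
  Om_σ := Ω.formC_conjugation
  Om_self x := by
    have h := Ω.formC_skew x x
    linear_combination h / 2
  nondeg x hx := by
    apply Ω.contraction.injective
    ext y
    simpa [SymplecticForm.contraction_apply] using hx (1 ⊗ₜ y)
  closed := Ω.formC_closed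
  Om_mul x y z := by
    rw [LinearMap.mk₂_apply, Ω.formC_contraction_symm]
    rfl
  lie_mem x hx y hy := J.g10.lie_mem hx hy
  isotropic x hx y hy := by
    have h1 := Ω.formC_JC h x y
    rw [J.mem_g10.1 hx, J.mem_g10.1 hy, map_smul, map_smul, LinearMap.smul_apply, smul_smul,
      Complex.I_mul_I, neg_one_smul] at h1
    linear_combination -h1 / 2
  exists_add x := by
    obtain ⟨y, z, hy, hz, rfl⟩ := Submodule.codisjoint_iff_exists_add_eq.1
      J.isCompl_g10_g01.codisjoint x
    exact ⟨y, hy, conjugation g z, J.conjugation_mem_g10.2 hz, by rw [conjugation_conjugation]⟩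

end

end WeakSelfMirror

/-! ### Dimension of `g^(1,0)` and nilpotency of the Courant bracket -/

namespace WeakSelfMirror

open scoped ComplexConjugate

variable {g : Type*} [LieRing g] [LieAlgebra ℝ g] [FiniteDimensional ℝ g]

theorem finrank_complexification : Module.finrank ℂ (ℂ ⊗[ℝ] g) = Module.finrank ℝ g :=
  Module.finrank_baseChange

theorem finrank_g01_add_finrank_g10 (J : ComplexStructure g) :
    Module.finrank ℂ J.g10.toSubmodule + Module.finrank ℂ J.g01.toSubmodule =
      Module.finrank ℝ g := by
  rw [Submodule.finrank_add_eq_of_isCompl J.isCompl_g10_g01, finrank_complexification]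

theorem finrank_g10 (J : ComplexStructure g) (Ω : SymplecticForm g) (h : IsPseudoKahler J Ω) :
    2 * Module.finrank ℂ J.g10.toSubmodule = Module.finrank ℝ g := by
  let D := pkData J Ω h
  have iso01 : ∀ x ∈ J.g01.toSubmodule, ∀ y ∈ J.g01.toSubmodule, Ω.formC x y = 0 := by
    intro x hx y hy
    have := D.isotropic_σ (x := D.σ x) (y := D.σ y) (J.conjugation_mem_g10.2 hx)
      (J.conjugation_mem_g10.2 hy)
    rwa [D.σ_σ, D.σ_σ] at this
  have iso10 : ∀ x ∈ J.g10.toSubmodule, ∀ y ∈ J.g10.toSubmodule, Ω.formC x y = 0 :=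
    D.isotropic
  -- If `P` is isotropic and `P + Q` is everything, the form embeds `P` into the dual of `Q`.
  -- Applied in both orders, this makes the two eigenspaces equidimensional.
  have key : ∀ P Q : Submodule ℂ (ℂ ⊗[ℝ] g), P ⊔ Q = ⊤ → (∀ x ∈ P, ∀ y ∈ P, Ω.formC x y = 0) →
      Module.finrank ℂ P ≤ Module.finrank ℂ Q := by
    intro P Q hPQ hP
    rw [← Subspace.dual_finrank_eq (V := Q)]
    refine LinearMap.finrank_le_finrank_of_injective
      (f := Q.subtype.dualMap ∘ₗ Ω.contraction.toLinearMap ∘ₗ P.subtype) ?_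
    rw [← LinearMap.ker_eq_bot, LinearMap.ker_eq_bot']
    rintro ⟨x, hx⟩ h0
    have h1 : x = 0 := D.nondeg x fun y => by
      have hy : y ∈ P ⊔ Q := by rw [hPQ]; trivial
      obtain ⟨p, hp, q, hq, rfl⟩ := Submodule.mem_sup.1 hy
      have h2 : Ω.formC x q = 0 := LinearMap.congr_fun h0 ⟨q, hq⟩
      rw [map_add]
      change Ω.formC x p + Ω.formC x q = 0
      rw [hP x hx p hp, h2, add_zero]
    exact Subtype.ext h1
  have h1 := key _ _ J.isCompl_g10_g01.sup_eq_top iso10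
  have h2 := key _ _ J.isCompl_g10_g01.symm.sup_eq_top iso01
  have h3 := finrank_g01_add_finrank_g10 J
  omega

theorem courantBracket_fst {L : Type*} [LieRing L] [LieAlgebra ℂ L] (P : LieSubalgebra ℂ L)
    (x y : CourantSpace P) : ((courantBracket P x y).1 : L) = ⁅(x.1 : L), (y.1 : L)⁆ := rfl

theorem courantBracket_snd {L : Type*} [LieRing L] [LieAlgebra ℂ L] (P : LieSubalgebra ℂ L)
    (x y : CourantSpace P) (z : L) : (courantBracket P x y).2.1 z =
      -y.2.1 ⁅(x.1 : L), z⁆ + x.2.1 ⁅(y.1 : L), z⁆ := by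
  simp [courantBracket, contractD, lieBilin]

theorem courantBracket_skew {L : Type*} [LieRing L] [LieAlgebra ℂ L] (P : LieSubalgebra ℂ L)
    (x y : CourantSpace P) : courantBracket P x y = -courantBracket P y x := by
  refine Prod.ext (Subtype.ext ?_) (Subtype.ext (LinearMap.ext fun z => ?_))
  · rw [courantBracket_fst]
    change _ = -((courantBracket P y x).1 : L)
    rw [courantBracket_fst, lie_skew]
  · rw [courantBracket_snd]
    change _ = -(courantBracket P y x).2.1 z
    rw [courantBracket_snd]
    ring

/-- On `P` one takes the lower central series of `L`, on the annihilator the forms that vanish on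
its terms in reverse order. Both halves then descend together. -/
theorem courant_filtration {L : Type*} [LieRing L] [LieAlgebra ℂ L] [LieRing.IsNilpotent L]
    (P : LieSubalgebra ℂ L) : ∃ (S : ℕ → Submodule ℂ (CourantSpace P)) (n : ℕ), S 0 = ⊤ ∧
      S n = ⊥ ∧ ∀ j x, ∀ y ∈ S j, courantBracket P x y ∈ S (j + 1) := by
  obtain ⟨N, n, h0, hn, hN⟩ := exists_filtration L
  refine ⟨fun j => ((N j).comap P.toSubmodule.subtype).prod
    ((N (n - j)).dualAnnihilator.comap P.toSubmodule.dualAnnihilator.subtype), n, ?_, ?_, ?_⟩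
  · simp [h0, hn]
  · simp [h0, hn]
  · rintro j x y ⟨hy1, hy2⟩
    have hy1 : (y.1 : L) ∈ N j := hy1
    have hy2 : ∀ z ∈ N (n - j), y.2.1 z = 0 := (Submodule.mem_dualAnnihilator _).1 hy2
    refine ⟨?_, ?_⟩
    · change ((courantBracket P x y).1 : L) ∈ N (j + 1)
      rw [courantBracket_fst]
      have := hN 0 j x.1 (by rw [h0]; trivial) _ hy1
      rwa [zero_add] at this
    · change (courantBracket P x y).2.1 ∈ (N (n - (j + 1))).dualAnnihilator
      rw [Submodule.mem_dualAnnihilator]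
      intro z hz
      rw [courantBracket_snd]
      -- For `j ≥ n` the truncated difference `n - j` is `0`, so `y` vanishes in both components and
      -- the index arithmetic of the main case is not needed.
      by_cases hj : j < n
      · have h1 := hN 0 (n - (j + 1)) x.1 (by rw [h0]; trivial) z hz
        rw [show 0 + (n - (j + 1)) + 1 = n - j by omega] at h1
        have h2 := hN j (n - (j + 1)) y.1 hy1 z hz
        rw [show j + (n - (j + 1)) + 1 = n by omega, hn n le_rfl, Submodule.mem_bot] at h2
        rw [hy2 _ h1, h2, map_zero, neg_zero, add_zero]
      · have h1 : (y.1 : L) = 0 := by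
          rwa [hn j (not_lt.1 hj), Submodule.mem_bot] at hy1
        rw [h1, zero_lie, map_zero, hy2 _ (by rw [show n - j = 0 by omega, h0]; trivial), neg_zero,
          add_zero]

end WeakSelfMirror

/-! ### From quasi-isomorphisms to self-mirror structures -/

namespace WeakSelfMirror

open scoped ComplexConjugate

theorem ceDiff_eq_zero {K : Type*} [AddCommGroup K] [Module ℂ K] [FiniteDimensional ℂ K]
    (br : K →ₗ[ℂ] K →ₗ[ℂ] K) (α : Module.Dual ℂ K) (h : ∀ x y, α (br x y) = 0) :
    ceDiff br α = 0 := by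
  rw [ceDiff_apply]
  simp [h]

theorem lieBilin_skew {L : Type*} [LieRing L] [LieAlgebra ℂ L] (x y : L) :
    lieBilin L x y = -lieBilin L y x := (lie_skew x y).symm

theorem courantDual_apply {L : Type*} [LieRing L] [LieAlgebra ℂ L] [FiniteDimensional ℂ L]
    {P Q : LieSubalgebra ℂ L} (h : IsCompl P.toSubmodule Q.toSubmodule) (x : CourantSpace P)
    (y : CourantSpace Q) : courantDual h x y = x.2.1 y.1.1 + y.2.1 x.1.1 := rfl

theorem courantDiff_mem {L : Type*} [LieRing L] [LieAlgebra ℂ L] [FiniteDimensional ℂ L]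
    {P Q : LieSubalgebra ℂ L} (h : IsCompl P.toSubmodule Q.toSubmodule) (x : CourantSpace P) :
    courantDiff h x ∈ ⋀[ℂ]^2 (CourantSpace P) :=
  map_mem_exteriorPower _ (ceDiff_mem _ _)

theorem courantDiff_symm {L : Type*} [LieRing L] [LieAlgebra ℂ L] [FiniteDimensional ℂ L]
    {P Q : LieSubalgebra ℂ L} (h : IsCompl P.toSubmodule Q.toSubmodule)
    (α : Module.Dual ℂ (CourantSpace Q)) : courantDiff h ((courantDual h).symm α) =
      ExteriorAlgebra.map (courantDual h).symm.toLinearMap (ceDiff (courantBracket Q) α) := by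
  simp only [courantDiff, LinearMap.comp_apply, LinearEquiv.coe_coe, AlgHom.toLinearMap_apply,
    LinearEquiv.apply_symm_apply]

/-- Finite-dimensional double duality. It produces the Lie homomorphism `χ` from the degree-one part
of a quasi-isomorphism. -/
theorem exists_dualMap_eq {K M : Type*} [AddCommGroup K] [Module ℂ K] [AddCommGroup M] [Module ℂ M]
    [FiniteDimensional ℂ M] (f : Module.Dual ℂ M →ₗ[ℂ] Module.Dual ℂ K) :
    ∃ χ : K →ₗ[ℂ] M, χ.dualMap = f :=
  ⟨(Module.evalEquiv ℂ M).symm.toLinearMap ∘ₗ f.dualMap ∘ₗ Module.Dual.eval ℂ K,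
    LinearMap.ext fun α => LinearMap.ext fun l => by
      simp only [LinearMap.comp_apply, LinearEquiv.coe_coe, Module.apply_evalEquiv_symm_apply,
        LinearMap.dualMap_apply, Module.Dual.eval_apply]⟩

theorem injective_of_surjective {V K M : Type*} [AddCommGroup V] [Module ℂ V] [AddCommGroup K]
    [Module ℂ K] [AddCommGroup M] [Module ℂ M] (f : V →ₗ[ℂ] Module.Dual ℂ K)
    (e : V ≃ₗ[ℂ] Module.Dual ℂ M) (χ : K →ₗ[ℂ] M) (hχ : Function.Surjective χ)
    (h : ∀ x l, f x l = e x (χ l)) : Function.Injective f := by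
  rw [← LinearMap.ker_eq_bot, LinearMap.ker_eq_bot']
  intro x hx
  apply e.injective
  rw [map_zero]
  refine LinearMap.ext fun y => ?_
  obtain ⟨l, rfl⟩ := hχ y
  rw [← h, hx, LinearMap.zero_apply, LinearMap.zero_apply]

/-- A quasi-isomorphism is an isomorphism in degree one. -/
theorem exists_linearEquiv_of_quasiIso {L : Type*} [LieRing L] [LieAlgebra ℂ L]
    [FiniteDimensional ℂ L] [LieRing.IsNilpotent L] {P Q : LieSubalgebra ℂ L}
    (h : IsCompl P.toSubmodule Q.toSubmodule)
    (br : Module.Dual ℂ L →ₗ[ℂ] Module.Dual ℂ L →ₗ[ℂ] Module.Dual ℂ L)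
    (φ : (ExteriorDGA.generatedBy (courantBracket P) (courantDiff h)).Hom
      (ExteriorDGA.generatedBy br (ceDiff (lieBilin L)))) (hφ : φ.IsQuasiIso) :
    ∃ (f : CourantSpace P ≃ₗ[ℂ] Module.Dual ℂ L) (χ : L →ₗ[ℂ] CourantSpace Q),
      (∀ x y, f (courantBracket _ x y) = br (f x) (f y)) ∧
      (∀ x y, courantBracket _ (χ x) (χ y) = χ (lieBilin _ x y)) ∧
      ∀ x l, f x l = courantDual h x (χ l) := by
  obtain ⟨f, hf, hfD, hinj⟩ := exists_linearMap_of_quasiIso (courantBracket P) br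
    (courantDiff h) (ceDiff (lieBilin L))
    (courantDiff_mem h) φ hφ
  have hsymm := courantDiff_symm h
  obtain ⟨cd, hcd⟩ : ∃ cd, cd = courantDual h := ⟨_, rfl⟩
  rw [← hcd] at hsymm
  obtain ⟨χ, hχf⟩ := exists_dualMap_eq (f ∘ₗ cd.symm.toLinearMap)
  have hfχ : ∀ x l, f x l = cd x (χ l) := fun x l => by
    have := LinearMap.congr_fun (LinearMap.congr_fun hχf (cd x)) l
    rw [LinearMap.comp_apply, LinearEquiv.coe_coe, LinearEquiv.symm_apply_apply] at this
    exact this.symm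
  have hD : ∀ α, ExteriorAlgebra.map χ.dualMap (ceDiff (courantBracket Q) α) =
      ceDiff (lieBilin L) (χ.dualMap α) := by
    intro α
    have h1 := hfD (cd.symm α)
    rw [hχf, ← ExteriorAlgebra.map_comp_map]
    rw [hsymm] at h1
    exact h1
  have hχ : ∀ x y, courantBracket Q (χ x) (χ y) = χ (lieBilin _ x y) := by
    intro x y
    rw [← sub_eq_zero, ← Module.forall_dual_apply_eq_zero_iff ℂ]
    intro α
    rw [map_sub, sub_eq_zero]
    exact (map_ceDiff_iff _ _ lieBilin_skew (courantBracket_skew _) χ α).1 (hD α) x y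
  obtain ⟨S, n, h0, hn, hS⟩ := courant_filtration Q
  -- A form that kills brackets is a closed generator; if it also vanishes on the range of `χ`, the
  -- map `f` kills it. Injectivity in cohomology makes it zero, which is surjectivity modulo
  -- brackets.
  have hsurj : Function.Surjective χ := by
    refine surjective_of_nilpotent _ _ (courantBracket_skew _) χ hχ S h0 hS n hn fun α hα hα' => ?_
    have h1 : courantDiff h (cd.symm α) = 0 := by
      rw [hsymm, ceDiff_eq_zero _ _ hα, map_zero]
    have h2 : f (cd.symm α) = 0 := LinearMap.ext fun l => by
      rw [hfχ, cd.apply_symm_apply, hα', LinearMap.zero_apply]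
    have h3 := hinj _ h1 h2
    rw [← cd.apply_symm_apply α, h3, map_zero]
  have hfin : Module.finrank ℂ (CourantSpace P) =
      Module.finrank ℂ (Module.Dual ℂ L) := by
    rw [Module.finrank_prod, Subspace.finrank_add_finrank_dualAnnihilator_eq,
      Subspace.dual_finrank_eq]
  have hinj' := injective_of_surjective f cd χ hsurj hfχ
  exact ⟨LinearEquiv.ofBijective f
    ⟨hinj', (LinearMap.injective_iff_surjective_of_finrank_eq_finrank hfin).1 hinj'⟩, χ, hf, hχ, by rw [← hcd]; exact hfχ⟩

variable {g : Type*} [LieRing g] [LieAlgebra ℝ g] [FiniteDimensional ℝ g]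

theorem SymplecticForm.dualBracket_contraction (Ω : SymplecticForm g) (x y : ℂ ⊗[ℝ] g) :
    Ω.dualBracket (Ω.contraction x) (Ω.contraction y) =
      Ω.contraction (lieBilin (ℂ ⊗[ℝ] g) x y) := by
  simp [dualBracket]

variable (J : ComplexStructure g) (Ω : SymplecticForm g) (h : IsPseudoKahler J Ω)

/-- The form `ι_y Ω` for `y` of type `(1, 0)`. -/
noncomputable def contractionA :
    J.g10.toSubmodule →ₗ[ℂ] J.g10.toSubmodule.dualAnnihilator :=
  (Ω.contraction.toLinearMap ∘ₗ J.g10.toSubmodule.subtype).codRestrict _ fun y =>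
    (Submodule.mem_dualAnnihilator _).2 fun z hz => (pkData J Ω h).isotropic y.1 y.2 z hz

theorem contraction_symm_mem (h : IsPseudoKahler J Ω) {α : Module.Dual ℂ (ℂ ⊗[ℝ] g)}
    (hα : α ∈ J.g10.toSubmodule.dualAnnihilator) :
    Ω.contraction.symm α ∈ J.g10.toSubmodule :=
  (pkData J Ω h).mem_of_Om fun y hy => by
    change Ω.formC _ y = 0
    rw [Ω.formC_contraction_symm]
    exact (Submodule.mem_dualAnnihilator _).1 hα y hy

theorem contraction_symm_mem_g01 (h : IsPseudoKahler J Ω) {α : Module.Dual ℂ (ℂ ⊗[ℝ] g)}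
    (hα : α ∈ J.g01.toSubmodule.dualAnnihilator) :
    conjugation g (Ω.contraction.symm α) ∈ J.g10.toSubmodule :=
  (pkData J Ω h).mem_of_Om fun y hy => by
    rw [show conjugation g (Ω.contraction.symm α) =
      (pkData J Ω h).σ (Ω.contraction.symm α) from rfl, (pkData J Ω h).Om_conj]
    change conj (Ω.formC _ (conjugation g y)) = 0
    rw [Ω.formC_contraction_symm, (Submodule.mem_dualAnnihilator _).1 hα _
      (J.conjugation_mem_g01.2 hy), map_zero]

/-- The annihilator of `A` is `A` itself by contraction with `Ω`, and there `ι_x d(ι_y Ω)` is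
`ι_{xy} Ω`. So the Courant bracket is the semidirect one, and `hfχ` becomes adjointness for `Ω`. -/
theorem exists_selfMirror_of_linearEquiv
    (f : CourantSpace J.g10 ≃ₗ[ℂ] Module.Dual ℂ (ℂ ⊗[ℝ] g))
    (χ : (ℂ ⊗[ℝ] g) →ₗ[ℂ] CourantSpace J.g01)
    (hf : ∀ x y, f (courantBracket _ x y) = Ω.dualBracket (f x) (f y))
    (hχ : ∀ x y, courantBracket _ (χ x) (χ y) = χ (lieBilin _ x y))
    (hfχ : ∀ x l, f x l = courantDual J.isCompl_g10_g01 x (χ l)) :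
    Nonempty (pkData J Ω h).SelfMirror := by
  let D := pkData J Ω h
  let ψ : CourantSpace J.g10 →ₗ[ℂ] (ℂ ⊗[ℝ] g) := Ω.contraction.symm.toLinearMap ∘ₗ f.toLinearMap
  -- `SelfMirror` has linear maps on all of `L` but constrains `ψ₁` and `ψ₂` only on `A`; the
  -- projection supplies an extension.
  let pr := Submodule.projectionOnto _ _ J.isCompl_g10_g01
  have hpr : ∀ x (hx : x ∈ J.g10.toSubmodule), pr x = ⟨x, hx⟩ := fun x hx =>
    Submodule.projectionOnto_apply_of_mem_left _ hx
  have hψ : ∀ x y, ψ (courantBracket _ x y) = lieBilin _ (ψ x) (ψ y) := fun x y => by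
    apply Ω.contraction.injective
    rw [← Ω.dualBracket_contraction]
    simp only [ψ, LinearMap.comp_apply, LinearEquiv.coe_coe, LinearEquiv.apply_symm_apply, hf]
  let c := contractionA J Ω h
  have hψl : ∀ x l, Ω.formC (ψ x) l = courantDual J.isCompl_g10_g01 x (χ l) := fun x l => by
    rw [← hfχ]
    exact Ω.formC_contraction_symm _ _
  refine ⟨⟨ψ ∘ₗ LinearMap.inl ℂ _ _ ∘ₗ pr, ψ ∘ₗ LinearMap.inr ℂ _ _ ∘ₗ c ∘ₗ pr,
    J.g01.toSubmodule.subtype ∘ₗ LinearMap.fst ℂ _ _ ∘ₗ χ,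
    Ω.contraction.symm.toLinearMap ∘ₗ Submodule.subtype _ ∘ₗ LinearMap.snd ℂ _ _ ∘ₗ χ,
    ?_, ?_, ?_, ?_, ?_, ?_, ?_, ?_, ?_, ?_⟩⟩
  · intro x hx y hy
    simp only [LinearMap.comp_apply, hpr x hx, hpr y hy, hpr _ (D.lie_mem x hx y hy)]
    refine (hψ _ _).symm.trans (congrArg ψ ?_)
    refine Prod.ext rfl (Subtype.ext (LinearMap.ext fun z => ?_))
    rw [courantBracket_snd]
    simp
  · intro x hx y hy
    simp only [LinearMap.comp_apply, hpr x hx, hpr y hy]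
    refine (hψ _ _).symm.trans (congrArg ψ ?_)
    refine Prod.ext (Subtype.ext ?_) (Subtype.ext (LinearMap.ext fun z => ?_))
    · rw [courantBracket_fst]
      simp
    · rw [courantBracket_snd]
      rw [hpr _ (D.mul_mem hx hy)]
      have := D.Om_mul x y z
      simp only [LinearMap.inl_apply, LinearMap.inr_apply, Submodule.coe_zero, zero_lie, map_zero,
        add_zero]
      exact this.symm
  · intro x hx y hy
    simp only [LinearMap.comp_apply, hpr x hx, hpr y hy]
    refine (hψ _ _).symm.trans ((congrArg ψ ?_).trans (map_zero ψ))
    refine Prod.ext (Subtype.ext ?_) (Subtype.ext (LinearMap.ext fun z => ?_))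
    · rw [courantBracket_fst]
      simp
    · rw [courantBracket_snd]
      simp
  · intro l
    obtain ⟨⟨x, α⟩, hx⟩ := f.surjective (Ω.contraction l)
    refine ⟨x, x.2, Ω.contraction.symm α.1, contraction_symm_mem J Ω h α.2, ?_⟩
    simp only [LinearMap.comp_apply, hpr _ x.2, hpr _ (contraction_symm_mem J Ω h α.2)]
    rw [← map_add]
    apply Ω.contraction.injective
    simp only [ψ, LinearMap.comp_apply, LinearEquiv.coe_coe, LinearEquiv.apply_symm_apply, ← hx]
    congr 1
    refine Prod.ext (by simp) (Subtype.ext (LinearMap.ext fun z => ?_))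
    simp only [LinearMap.inl_apply, LinearMap.inr_apply, Prod.snd_add, zero_add]
    exact (Ω.formC_contraction_symm _ _).symm
  · intro x hx y hy h0
    simp only [LinearMap.comp_apply, hpr x hx, hpr y hy] at h0
    rw [← map_add] at h0
    have h1 := f.injective ((Ω.contraction.symm.injective (h0.trans (map_zero _).symm)).trans
      (map_zero f).symm)
    have h2 := congrArg (fun p => (p.1 : ℂ ⊗[ℝ] g)) h1
    have h3 := congrArg (fun p => p.2.1) h1
    refine ⟨by simpa using h2, D.nondeg y fun z => ?_⟩
    have h4 := LinearMap.congr_fun h3 z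
    simp only [LinearMap.inl_apply, LinearMap.inr_apply, Prod.snd_add, zero_add] at h4
    exact h4
  · intro l
    exact J.conjugation_mem_g10.2 (χ l).1.2
  · intro l
    exact contraction_symm_mem_g01 J Ω h (χ l).2.2
  · intro x y
    exact congrArg (fun p => (p.1 : ℂ ⊗[ℝ] g)) (hχ x y).symm
  · intro x y
    apply Ω.contraction.injective
    refine LinearMap.ext fun z => ?_
    have h1 := LinearMap.congr_fun (congrArg (fun p => p.2.1) (hχ x y)) z
    rw [courantBracket_snd] at h1
    have h2 := D.Om_mul (χ x).1.1 (Ω.contraction.symm (χ y).2.1) z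
    have h3 := D.Om_mul (χ y).1.1 (Ω.contraction.symm (χ x).2.1) z
    have h4 : ∀ α, D.Om (Ω.contraction.symm α) = α := fun α => Ω.contraction.apply_symm_apply α
    rw [h4] at h2 h3
    rw [map_sub, LinearMap.sub_apply]
    change Ω.contraction (Ω.contraction.symm (χ _).2.1) z =
      D.Om (D.mul (χ x).1.1 (Ω.contraction.symm (χ y).2.1)) z -
      D.Om (D.mul (χ y).1.1 (Ω.contraction.symm (χ x).2.1)) z
    rw [h2, h3, LinearEquiv.apply_symm_apply, sub_neg_eq_add]
    exact h1.symm
  · intro x hx y hy l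
    simp only [LinearMap.comp_apply, hpr x hx, hpr y hy]
    rw [← map_add]
    refine (hψl _ _).trans ?_
    rw [courantDual_apply]
    simp only [LinearMap.inl_apply, LinearMap.inr_apply, Prod.snd_add, Prod.fst_add, zero_add,
      add_zero]
    congr 1
    exact (Ω.formC_contraction_symm _ _).symm

end WeakSelfMirror

/-! ### From self-mirror structures to quasi-isomorphisms -/

namespace WeakSelfMirror

open scoped ComplexConjugate

variable {g : Type*} [LieRing g] [LieAlgebra ℝ g] [FiniteDimensional ℝ g]
  (J : ComplexStructure g) (Ω : SymplecticForm g) (h : IsPseudoKahler J Ω)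

theorem exists_selfMirror_of_quasiIso [LieRing.IsNilpotent g] (φ : J.dga.Hom Ω.dga)
    (hφ : φ.IsQuasiIso) : Nonempty (pkData J Ω h).SelfMirror := by
  obtain ⟨f, χ, hf, hχ, hfχ⟩ :=
    exists_linearEquiv_of_quasiIso J.isCompl_g10_g01 Ω.dualBracket φ hφ
  exact exists_selfMirror_of_linearEquiv J Ω h f χ hf hχ hfχ

/-- That `χ` preserves brackets is dual, by `map_ceDiff_iff`, to `f` commuting with the
differentials on generators. -/
theorem exists_quasiIso_of_linearEquiv_dual {L : Type*} [LieRing L] [LieAlgebra ℂ L]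
    [FiniteDimensional ℂ L] {P Q : LieSubalgebra ℂ L}
    (h : IsCompl P.toSubmodule Q.toSubmodule)
    (br : Module.Dual ℂ L →ₗ[ℂ] Module.Dual ℂ L →ₗ[ℂ] Module.Dual ℂ L)
    (hbr : ∀ x y, br x y = -br y x)
    (f : CourantSpace P ≃ₗ[ℂ] Module.Dual ℂ L) (χ : L →ₗ[ℂ] CourantSpace Q)
    (hf : ∀ x y, f (courantBracket _ x y) = br (f x) (f y))
    (hχ : ∀ x y, courantBracket _ (χ x) (χ y) = χ (lieBilin _ x y))
    (hfχ : ∀ x l, f x l = courantDual h x (χ l)) :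
    ∃ φ : (ExteriorDGA.generatedBy (courantBracket P) (courantDiff h)).Hom
      (ExteriorDGA.generatedBy br (ceDiff (lieBilin L))), φ.IsQuasiIso := by
  refine exists_quasiIso_of_linearEquiv _ _ (courantBracket_skew P) hbr _ _ (courantDiff_mem h)
    (ceDiff_mem _) f hf fun x => ?_
  obtain ⟨α, rfl⟩ := (courantDual h).symm.surjective x
  have e : f.toLinearMap ∘ₗ (courantDual h).symm.toLinearMap = χ.dualMap :=
    LinearMap.ext fun β => LinearMap.ext fun l => by
      simp [hfχ]
  have e2 : f ((courantDual h).symm α) = χ.dualMap α := LinearMap.congr_fun e α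
  rw [courantDiff_symm, e2, ← AlgHom.comp_apply, ExteriorAlgebra.map_comp_map, e]
  exact (map_ceDiff_iff _ _ lieBilin_skew (courantBracket_skew _) χ α).2 fun x y => by rw [hχ]

theorem exists_quasiIso_of_selfMirror (M : (pkData J Ω h).SelfMirror) :
    ∃ φ : J.dga.Hom Ω.dga, φ.IsQuasiIso := by
  let D := pkData J Ω h
  let f₀ : CourantSpace J.g10 →ₗ[ℂ] (ℂ ⊗[ℝ] g) :=
    (M.ψ₁ ∘ₗ J.g10.toSubmodule.subtype).coprod
      (M.ψ₂ ∘ₗ Ω.contraction.symm.toLinearMap ∘ₗ Submodule.subtype _)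
  have hmem : ∀ x : CourantSpace J.g10, Ω.contraction.symm x.2.1 ∈ D.A := fun x =>
    contraction_symm_mem J Ω h x.2.2
  have hf₀ : ∀ x, f₀ x = M.ψ₁ x.1 + M.ψ₂ (Ω.contraction.symm x.2.1) := fun x => rfl
  have hΩ : ∀ (α : Module.Dual ℂ (ℂ ⊗[ℝ] g)) z, D.Om (Ω.contraction.symm α) z = α z :=
    Ω.formC_contraction_symm
  have hinj : Function.Injective f₀ := by
    rw [← LinearMap.ker_eq_bot, LinearMap.ker_eq_bot']
    intro x hx
    obtain ⟨h1, h2⟩ := M.inj _ x.1.2 _ (hmem x) (hx : M.ψ₁ x.1 + M.ψ₂ _ = 0)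
    refine Prod.ext (Subtype.ext h1) (Subtype.ext ?_)
    exact Ω.contraction.symm.injective (h2.trans (map_zero _).symm)
  have hsurj : Function.Surjective f₀ := by
    intro l
    obtain ⟨x, hx, y, hy, rfl⟩ := M.surj l
    refine ⟨(⟨x, hx⟩, contractionA J Ω h ⟨y, hy⟩), ?_⟩
    rw [hf₀]
    congr 2
    exact Ω.contraction.symm_apply_apply y
  let f := (LinearEquiv.ofBijective f₀ ⟨hinj, hsurj⟩).trans Ω.contraction
  have hf : ∀ x, f x = Ω.contraction (f₀ x) := fun x => rfl
  let χ : (ℂ ⊗[ℝ] g) →ₗ[ℂ] CourantSpace J.g01 :=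
    (M.χ₁.codRestrict J.g01.toSubmodule fun l => J.conjugation_mem_g10.1 (M.χ₁_mem l)).prod
      ((Ω.contraction.toLinearMap ∘ₗ M.χ₂).codRestrict J.g01.toSubmodule.dualAnnihilator fun l =>
        (Submodule.mem_dualAnnihilator _).2 fun z hz => by
          have := D.isotropic_σ (M.χ₂_mem l) (J.conjugation_mem_g10.2 hz)
          rw [D.σ_σ] at this
          change D.Om (M.χ₂ l) (D.σ (D.σ z)) = 0 at this
          rw [D.σ_σ] at this
          exact this)
  have hχ1 : ∀ l, ((χ l).1 : ℂ ⊗[ℝ] g) = M.χ₁ l := fun _ => rfl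
  have hχ2 : ∀ l z, (χ l).2.1 z = D.Om (M.χ₂ l) z := fun _ _ => rfl
  refine exists_quasiIso_of_linearEquiv_dual J.isCompl_g10_g01 Ω.dualBracket ?_ f χ ?_ ?_ ?_
  · intro α β
    obtain ⟨x, rfl⟩ := Ω.contraction.surjective α
    obtain ⟨y, rfl⟩ := Ω.contraction.surjective β
    rw [Ω.dualBracket_contraction, Ω.dualBracket_contraction, lieBilin_skew, map_neg]
  · intro x y
    rw [hf, hf, hf, Ω.dualBracket_contraction]
    congr 1
    rw [hf₀, hf₀, hf₀, courantBracket_fst]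
    refine Eq.trans ?_ (M.lie_eq x.1.2 (hmem x) y.1.2 (hmem y)).symm
    congr 2
    apply Ω.contraction.injective
    refine LinearMap.ext fun z => ?_
    rw [LinearEquiv.apply_symm_apply, courantBracket_snd, map_sub, LinearMap.sub_apply]
    have h1 := D.Om_mul x.1.1 (Ω.contraction.symm y.2.1) z
    have h2 := D.Om_mul y.1.1 (Ω.contraction.symm x.2.1) z
    rw [hΩ] at h1 h2
    change _ = D.Om _ z - D.Om _ z
    rw [h1, h2]
    ring
  · intro x y
    refine Prod.ext (Subtype.ext ?_) (Subtype.ext (LinearMap.ext fun z => ?_))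
    · rw [courantBracket_fst, hχ1, hχ1, hχ1]
      exact (M.χ₁_lie x y).symm
    · rw [courantBracket_snd, hχ2, hχ2, hχ2, hχ1, hχ1]
      have h1 := D.Om_mul (M.χ₁ x) (M.χ₂ y) z
      have h2 := D.Om_mul (M.χ₁ y) (M.χ₂ x) z
      have h3 := M.χ₂_lie x y
      have h4 := congrArg (fun l => D.Om l z) h3
      simp only [map_sub, LinearMap.sub_apply] at h4
      refine Eq.trans ?_ h4.symm
      change _ = D.Om (D.mul _ _) z - D.Om (D.mul _ _) z
      rw [h1, h2]
      ring
  · intro x l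
    rw [courantDual_apply, hf, hf₀]
    refine (M.compat _ x.1.2 _ (hmem x) l).trans ?_
    rw [hχ2, hχ1]
    congr 1
    exact hΩ _ _

end WeakSelfMirror

/-! ### Real bases in the three nondegenerate cases -/

namespace WeakSelfMirror

open scoped ComplexConjugate

namespace PKData

variable {L : Type*} [LieRing L] [LieAlgebra ℂ L] {D : PKData L}

/-- A real basis in which only the brackets `[0,1], [0,2], [0,3], [1,4]` may be nonzero. -/
structure RealFrame (D : PKData L) (V : Fin 6 → L) : Prop where
  real : ∀ i, D.σ (V i) = V i
  span : ∀ l, ∃ c₀ c₁ c₂ c₃ c₄ c₅ : ℂ,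
    l = c₀ • V 0 + c₁ • V 1 + c₂ • V 2 + c₃ • V 3 + c₄ • V 4 + c₅ • V 5
  central : ∀ l : L, ⁅V 5, l⁆ = 0
  lie04 : ⁅V 0, V 4⁆ = 0
  lie12 : ⁅V 1, V 2⁆ = 0
  lie13 : ⁅V 1, V 3⁆ = 0
  lie23 : ⁅V 2, V 3⁆ = 0
  lie24 : ⁅V 2, V 4⁆ = 0
  lie34 : ⁅V 3, V 4⁆ = 0

namespace Frame

variable {a w u : L} {β γ α κ δ : ℂ}

theorem exists_realFrame_h6 (F : D.Frame a w u β γ α κ δ) (hu : ∀ l : L, ⁅u, l⁆ = 0)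
    (hww : ⁅w, D.σ w⁆ = 0) (haw : ⁅a, w⁆ = u) (haσw : ⁅a, D.σ w⁆ = D.σ u)
    (haσa : ⁅a, D.σ a⁆ = 0) :
    ∃ V, D.RealFrame V ∧ ⁅V 0, V 1⁆ = -V 4 ∧ ⁅V 0, V 2⁆ = -V 5 ∧ ⁅V 0, V 3⁆ = 0 ∧
      ⁅V 1, V 4⁆ = 0 := by
  have hu' : ∀ l : L, ⁅l, u⁆ = 0 := fun l => by rw [← lie_skew, hu, neg_zero]
  have hσu : ∀ l : L, ⁅D.σ u, l⁆ = 0 := fun l => by rw [← D.σ_σ l, ← D.σ_lie, hu, map_zero]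
  have hσu' : ∀ l : L, ⁅l, D.σ u⁆ = 0 := fun l => by rw [← lie_skew, hσu, neg_zero]
  have h1 : ⁅D.σ a, D.σ w⁆ = D.σ u := by rw [← D.σ_lie, haw]
  have h2 : ⁅D.σ a, w⁆ = u := by
    have h := congrArg D.σ haσw
    rwa [D.σ_lie, D.σ_σ, D.σ_σ] at h
  have h3 : ⁅D.σ a, a⁆ = 0 := by rw [← lie_skew, haσa, neg_zero]
  have h4 : ⁅D.σ w, w⁆ = 0 := by rw [← lie_skew, hww, neg_zero]
  have h5 : ⁅w, a⁆ = -u := by rw [← lie_skew, haw]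
  have h6 : ⁅D.σ w, a⁆ = -D.σ u := by rw [← lie_skew, haσw]
  have h7 : ⁅w, D.σ a⁆ = -u := by rw [← lie_skew, h2]
  have h8 : ⁅D.σ w, D.σ a⁆ = -D.σ u := by rw [← lie_skew, h1]
  have I2 := Complex.I_mul_I
  have I0 := Complex.I_ne_zero
  -- Real and imaginary parts of the frame up to scalars. The last two vectors are scaled to be
  -- minus the brackets of `V 0` with `V 1` and with `V 2`, as the sign convention for `de^k`
  -- requires.
  refine ⟨![a + D.σ a, w + D.σ w, Complex.I • (w - D.σ w), Complex.I • (a - D.σ a),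
    (-2 : ℂ) • (u + D.σ u), (-2 * Complex.I) • (u - D.σ u)],
    ⟨?_, ?_, ?_, ?_, ?_, ?_, ?_, ?_, ?_⟩, ?_, ?_, ?_, ?_⟩
  · intro i
    fin_cases i <;> simp [map_smulₛₗ, D.σ_σ, map_ofNat] <;> module
  · intro l
    obtain ⟨c₁, c₂, c₃, c₄, c₅, c₆, rfl⟩ := F.exists_coords l
    refine ⟨(c₁ + c₄) / 2, (c₂ + c₅) / 2, (c₂ - c₅) / (2 * Complex.I),
      (c₁ - c₄) / (2 * Complex.I), (c₃ + c₆) / -4, (c₃ - c₆) / (-4 * Complex.I), ?_⟩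
    simp
    match_scalars <;> field_simp <;> ring
  all_goals simp [hu, hu', hσu, hσu', haw, haσw, haσa, hww, h1, h2, h3, h4, h5, h6, h7, h8]
  all_goals module

theorem exists_realFrame_h10 (F : D.Frame a w u β γ α κ δ) (hu : ∀ l : L, ⁅u, l⁆ = 0)
    (hww : ⁅w, D.σ w⁆ = 0) (haw : ⁅a, w⁆ = u) (haσw : ⁅a, D.σ w⁆ = D.σ u) {c₁ c₂ : ℂ}
    (haσa : ⁅a, D.σ a⁆ = D.σ w - w + c₁ • u + c₂ • D.σ u) :
    ∃ V, D.RealFrame V ∧ ⁅V 0, V 1⁆ = -V 3 ∧ ⁅V 0, V 2⁆ = -V 4 ∧ ⁅V 0, V 3⁆ = -V 5 ∧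
      ⁅V 1, V 4⁆ = 0 := by
  have hu' : ∀ l : L, ⁅l, u⁆ = 0 := fun l => by rw [← lie_skew, hu, neg_zero]
  have hσu : ∀ l : L, ⁅D.σ u, l⁆ = 0 := fun l => by rw [← D.σ_σ l, ← D.σ_lie, hu, map_zero]
  have hσu' : ∀ l : L, ⁅l, D.σ u⁆ = 0 := fun l => by rw [← lie_skew, hσu, neg_zero]
  have h1 : ⁅D.σ a, D.σ w⁆ = D.σ u := by rw [← D.σ_lie, haw]
  have h2 : ⁅D.σ a, w⁆ = u := by
    have h := congrArg D.σ haσw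
    rwa [D.σ_lie, D.σ_σ, D.σ_σ] at h
  have h3 : ⁅D.σ a, a⁆ = -⁅a, D.σ a⁆ := (lie_skew _ _).symm
  have h4 : ⁅D.σ w, w⁆ = 0 := by rw [← lie_skew, hww, neg_zero]
  obtain ⟨v, hv⟩ : ∃ v, v = ⁅a, D.σ a⁆ := ⟨_, rfl⟩
  have hσv : D.σ v = -v := by rw [hv, D.σ_lie, D.σ_σ, h3]
  rw [← hv] at haσa h3
  have hav : ⁅a, v⁆ = D.σ u - u := by
    rw [haσa]; simp [haw, haσw, hu', hσu']
  have hσav : ⁅D.σ a, v⁆ = D.σ u - u := by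
    rw [haσa]; simp [h1, h2, hu', hσu']
  have hwv : ⁅w, v⁆ = 0 := by
    rw [haσa]; simp [hww, hu', hσu']
  have hσwv : ⁅D.σ w, v⁆ = 0 := by
    rw [haσa]; simp [h4, hu', hσu']
  have I2 := Complex.I_mul_I
  have I0 := Complex.I_ne_zero
  -- The bracket `v = ⁅a, D.σ a⁆` satisfies `D.σ v = -v` and replaces `w - D.σ w`, from which it
  -- differs by a sign and central terms.
  refine ⟨![a + D.σ a, Complex.I • (a - D.σ a), w + D.σ w, (2 * Complex.I) • v,
    (-2 : ℂ) • (u + D.σ u), (-4 * Complex.I) • (D.σ u - u)],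
    ⟨?_, ?_, ?_, ?_, ?_, ?_, ?_, ?_, ?_⟩, ?_, ?_, ?_, ?_⟩
  · intro i
    fin_cases i <;> simp [map_smulₛₗ, D.σ_σ, hσv, map_ofNat] <;> module
  · intro l
    obtain ⟨d₁, d₂, d₃, d₄, d₅, d₆, rfl⟩ := F.exists_coords l
    refine ⟨(d₁ + d₄) / 2, (d₁ - d₄) / (2 * Complex.I), (d₂ + d₅) / 2,
      (d₅ - d₂) / (4 * Complex.I),
      (d₃ + (d₂ - d₅) / 2 * c₁ + (d₆ + (d₂ - d₅) / 2 * c₂)) / -4,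
      (d₃ + (d₂ - d₅) / 2 * c₁ - (d₆ + (d₂ - d₅) / 2 * c₂)) / (8 * Complex.I), ?_⟩
    simp [haσa]
    match_scalars <;> field_simp <;> ring
  all_goals simp [hu, hu', hσu, hσu', haw, haσw, ← hv, h1, h2, h3, hav, hσav, hwv, hσwv]
  all_goals module

theorem exists_realFrame_h9 (F : D.Frame a w u β γ α κ δ) (hu : ∀ l : L, ⁅u, l⁆ = 0)
    (hww : ⁅w, D.σ w⁆ = 0) (haw : ⁅a, w⁆ = 0) (haσw : ⁅a, D.σ w⁆ = u - D.σ u) {c₁ c₂ : ℂ}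
    (haσa : ⁅a, D.σ a⁆ = w - D.σ w + c₁ • u + c₂ • D.σ u) :
    ∃ V, D.RealFrame V ∧ ⁅V 0, V 1⁆ = -V 4 ∧ ⁅V 0, V 2⁆ = 0 ∧ ⁅V 0, V 3⁆ = -V 5 ∧
      ⁅V 1, V 4⁆ = -V 5 := by
  have hu' : ∀ l : L, ⁅l, u⁆ = 0 := fun l => by rw [← lie_skew, hu, neg_zero]
  have hσu : ∀ l : L, ⁅D.σ u, l⁆ = 0 := fun l => by rw [← D.σ_σ l, ← D.σ_lie, hu, map_zero]
  have hσu' : ∀ l : L, ⁅l, D.σ u⁆ = 0 := fun l => by rw [← lie_skew, hσu, neg_zero]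
  have h1 : ⁅D.σ a, D.σ w⁆ = 0 := by rw [← D.σ_lie, haw, map_zero]
  have h2 : ⁅D.σ a, w⁆ = D.σ u - u := by
    have h := congrArg D.σ haσw
    rwa [D.σ_lie, D.σ_σ, map_sub, D.σ_σ] at h
  have h3 : ⁅D.σ a, a⁆ = -⁅a, D.σ a⁆ := (lie_skew _ _).symm
  have h4 : ⁅D.σ w, w⁆ = 0 := by rw [← lie_skew, hww, neg_zero]
  obtain ⟨v, hv⟩ : ∃ v, v = ⁅a, D.σ a⁆ := ⟨_, rfl⟩
  have hσv : D.σ v = -v := by rw [hv, D.σ_lie, D.σ_σ, h3]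
  rw [← hv] at haσa h3
  have hav : ⁅a, v⁆ = D.σ u - u := by
    rw [haσa]; simp [haw, haσw, hu', hσu']
  have hσav : ⁅D.σ a, v⁆ = D.σ u - u := by
    rw [haσa]; simp [h1, h2, hu', hσu']
  have hwv : ⁅w, v⁆ = 0 := by
    rw [haσa]; simp [hww, hu', hσu']
  have hσwv : ⁅D.σ w, v⁆ = 0 := by
    rw [haσa]; simp [h4, hu', hσu']
  have I2 := Complex.I_mul_I
  have I0 := Complex.I_ne_zero
  refine ⟨![Complex.I • (a - D.σ a), a + D.σ a, u + D.σ u, (2 : ℂ) • (w + D.σ w),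
    (-2 * Complex.I) • v, (4 * Complex.I) • (D.σ u - u)],
    ⟨?_, ?_, ?_, ?_, ?_, ?_, ?_, ?_, ?_⟩, ?_, ?_, ?_, ?_⟩
  · intro i
    fin_cases i <;> simp [map_smulₛₗ, D.σ_σ, hσv, map_ofNat] <;> module
  · intro l
    obtain ⟨d₁, d₂, d₃, d₄, d₅, d₆, rfl⟩ := F.exists_coords l
    refine ⟨(d₁ - d₄) / (2 * Complex.I), (d₁ + d₄) / 2,
      (d₃ - (d₂ - d₅) / 2 * c₁ + (d₆ - (d₂ - d₅) / 2 * c₂)) / 2, (d₂ + d₅) / 4,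
      (d₂ - d₅) / (-4 * Complex.I),
      (d₃ - (d₂ - d₅) / 2 * c₁ - (d₆ - (d₂ - d₅) / 2 * c₂)) / (-8 * Complex.I), ?_⟩
    simp [haσa]
    match_scalars <;> field_simp <;> ring
  all_goals simp [hu, hu', hσu, hσu', haw, haσw, ← hv, h1, h2, h3, hav, hσav, hwv, hσwv]
  all_goals module

end Frame

end PKData

end WeakSelfMirror

/-! ### Structure equations from bracket tables; real elements -/

namespace WeakSelfMirror

open scoped ComplexConjugate

section Real

variable {g : Type*} [LieRing g] [LieAlgebra ℝ g]

/-- The brackets of a Lie algebra with few nonzero structure constants. -/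
theorem lie_eq_of_table (e : Module.Basis (Fin 6) ℝ g) {A B C D E : g}
    (h5 : ∀ l : g, ⁅e 5, l⁆ = 0) (h01 : ⁅e 0, e 1⁆ = A) (h02 : ⁅e 0, e 2⁆ = B) (h03 : ⁅e 0, e 3⁆ = C)
    (h04 : ⁅e 0, e 4⁆ = 0) (h12 : ⁅e 1, e 2⁆ = D) (h13 : ⁅e 1, e 3⁆ = 0) (h14 : ⁅e 1, e 4⁆ = E)
    (h23 : ⁅e 2, e 3⁆ = 0) (h24 : ⁅e 2, e 4⁆ = 0) (h34 : ⁅e 3, e 4⁆ = 0) (x y : g) :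
    ⁅x, y⁆ = wedge (e.coord 0) (e.coord 1) x y • A + wedge (e.coord 0) (e.coord 2) x y • B +
      wedge (e.coord 0) (e.coord 3) x y • C + wedge (e.coord 1) (e.coord 2) x y • D +
      wedge (e.coord 1) (e.coord 4) x y • E := by
  have h5' : ∀ l : g, ⁅l, e 5⁆ = 0 := fun l => by rw [← lie_skew, h5, neg_zero]
  have h10 : ⁅e 1, e 0⁆ = -A := by rw [← lie_skew, h01]
  have h20 : ⁅e 2, e 0⁆ = -B := by rw [← lie_skew, h02]
  have h30 : ⁅e 3, e 0⁆ = -C := by rw [← lie_skew, h03]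
  have h41 : ⁅e 4, e 1⁆ = -E := by rw [← lie_skew, h14]
  have h40 : ⁅e 4, e 0⁆ = 0 := by rw [← lie_skew, h04, neg_zero]
  have h21 : ⁅e 2, e 1⁆ = -D := by rw [← lie_skew, h12]
  have h31 : ⁅e 3, e 1⁆ = 0 := by rw [← lie_skew, h13, neg_zero]
  have h32 : ⁅e 3, e 2⁆ = 0 := by rw [← lie_skew, h23, neg_zero]
  have h42 : ⁅e 4, e 2⁆ = 0 := by rw [← lie_skew, h24, neg_zero]
  have h43 : ⁅e 4, e 3⁆ = 0 := by rw [← lie_skew, h34, neg_zero]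
  conv_lhs => rw [← e.sum_repr x, ← e.sum_repr y]
  simp only [Fin.sum_univ_six, add_lie, lie_add, smul_lie, lie_smul, lie_self, h01, h02, h03, h04,
    h12, h13, h14, h23, h24, h34, h5, h5', h10, h20, h30, h41, h40, h21, h31, h32, h42, h43,
    smul_zero, add_zero, zero_add, wedge, Module.Basis.coord_apply]
  module

theorem exists_basis_of_span {K M : Type*} [Field K] [AddCommGroup M] [Module K M]
    (hdim : Module.finrank K M = 6) (v : Fin 6 → M) (hv : ∀ x, ∃ c : Fin 6 → K, x = ∑ i, c i • v i) :
    ∃ e : Module.Basis (Fin 6) K M, ∀ i, e i = v i := by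
  have hspan : (⊤ : Submodule K M) ≤ Submodule.span K (Set.range v) := fun x _ => by
    obtain ⟨c, rfl⟩ := hv x
    exact Submodule.sum_mem _ fun i _ => Submodule.smul_mem _ _ (Submodule.subset_span ⟨i, rfl⟩)
  exact ⟨basisOfTopLeSpanOfCardEqFinrank v hspan (by simp [hdim]), fun i => by simp⟩

theorem isH1_of_table (e : Module.Basis (Fin 6) ℝ g) (h : ∀ x y : g, ⁅x, y⁆ = 0) : IsH1 g := by
  refine ⟨e, fun k x y => ?_⟩
  rw [h]
  fin_cases k <;> simp

theorem isH6_of_table (e : Module.Basis (Fin 6) ℝ g) (h : ∀ x y, ⁅x, y⁆ =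
    wedge (e.coord 0) (e.coord 1) x y • -e 4 + wedge (e.coord 0) (e.coord 2) x y • -e 5) :
    IsH6 g := by
  refine ⟨e, fun k x y => ?_⟩
  rw [h]
  fin_cases k <;> simp

theorem isH8_of_table (e : Module.Basis (Fin 6) ℝ g)
    (h : ∀ x y, ⁅x, y⁆ = wedge (e.coord 0) (e.coord 1) x y • -e 5) : IsH8 g := by
  refine ⟨e, fun k x y => ?_⟩
  rw [h]
  fin_cases k <;> simp

theorem isH9_of_table (e : Module.Basis (Fin 6) ℝ g) (h : ∀ x y, ⁅x, y⁆ =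
    wedge (e.coord 0) (e.coord 1) x y • -e 4 + wedge (e.coord 0) (e.coord 3) x y • -e 5 +
      wedge (e.coord 1) (e.coord 4) x y • -e 5) : IsH9 g := by
  refine ⟨e, fun k x y => ?_⟩
  rw [h]
  fin_cases k <;> simp <;> ring

theorem isH10_of_table (e : Module.Basis (Fin 6) ℝ g) (h : ∀ x y, ⁅x, y⁆ =
    wedge (e.coord 0) (e.coord 1) x y • -e 3 + wedge (e.coord 0) (e.coord 2) x y • -e 4 +
      wedge (e.coord 0) (e.coord 3) x y • -e 5) : IsH10 g := by
  refine ⟨e, fun k x y => ?_⟩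
  rw [h]
  fin_cases k <;> simp

/-- The real part of an element of the complexification. -/
noncomputable def realPart (g : Type*) [AddCommGroup g] [Module ℝ g] : (ℂ ⊗[ℝ] g) →ₗ[ℝ] g :=
  (TensorProduct.lid ℝ g).toLinearMap ∘ₗ TensorProduct.map Complex.reLm LinearMap.id

theorem realPart_tmul (c : ℂ) (x : g) : realPart g (c ⊗ₜ x) = c.re • x := by
  simp [realPart]

theorem realPart_smul_one_tmul (c : ℂ) (x : g) : realPart g (c • ((1 : ℂ) ⊗ₜ x)) = c.re • x := by
  rw [TensorProduct.smul_tmul', smul_eq_mul, mul_one, realPart_tmul]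

theorem one_tmul_injective {x y : g} (h : (1 : ℂ) ⊗ₜ[ℝ] x = (1 : ℂ) ⊗ₜ y) : x = y := by
  have := congrArg (realPart g) h
  simpa [realPart_tmul] using this

theorem exists_one_tmul_of_real {x : ℂ ⊗[ℝ] g} (h : conjugation g x = x) :
    ∃ y : g, (1 : ℂ) ⊗ₜ[ℝ] y = x := by
  have key : ∀ x : ℂ ⊗[ℝ] g, ∃ y z : g, x = (1 : ℂ) ⊗ₜ y + Complex.I ⊗ₜ z := by
    intro x
    induction x using TensorProduct.induction_on with
    | zero => exact ⟨0, 0, by simp⟩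
    | tmul c x =>
      refine ⟨c.re • x, c.im • x, ?_⟩
      rw [← TensorProduct.smul_tmul, ← TensorProduct.smul_tmul, ← TensorProduct.add_tmul]
      congr 1
      simp only [Complex.real_smul, mul_one]
      exact (Complex.re_add_im c).symm
    | add x x' hx hx' =>
      obtain ⟨y, z, rfl⟩ := hx
      obtain ⟨y', z', rfl⟩ := hx'
      exact ⟨y + y', z + z', by rw [TensorProduct.tmul_add, TensorProduct.tmul_add]; abel⟩
  obtain ⟨y, z, rfl⟩ := key x
  refine ⟨y, ?_⟩
  simp only [map_add, conjugation_tmul, map_one, Complex.conj_I, TensorProduct.neg_tmul] at h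
  have h2 : (2 : ℂ) • (Complex.I ⊗ₜ[ℝ] z) = 0 := by
    rw [two_smul]
    have := add_left_cancel h
    nth_rewrite 1 [← this]
    simp
  rw [(smul_eq_zero.1 h2).resolve_left two_ne_zero, add_zero]

end Real

end WeakSelfMirror

/-! ### Descent to `g` and the list of algebras -/

namespace WeakSelfMirror

open scoped ComplexConjugate

section Real

variable {g : Type*} [LieRing g] [LieAlgebra ℝ g]

theorem lie_eq_of_one_tmul {x y z : g}
    (h : lieBilin (ℂ ⊗[ℝ] g) ((1 : ℂ) ⊗ₜ x) ((1 : ℂ) ⊗ₜ y) = (1 : ℂ) ⊗ₜ z) : ⁅x, y⁆ = z := by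
  rw [lieBilin_tmul, one_mul] at h
  exact one_tmul_injective h

variable [FiniteDimensional ℝ g]

theorem PKData.RealFrame.exists_basis {J : ComplexStructure g} {Ω : SymplecticForm g}
    {h : IsPseudoKahler J Ω} (hdim : Module.finrank ℝ g = 6) {V : Fin 6 → ℂ ⊗[ℝ] g}
    (hV : (pkData J Ω h).RealFrame V) :
    ∃ e : Module.Basis (Fin 6) ℝ g, ∀ i, V i = (1 : ℂ) ⊗ₜ e i := by
  choose v hv using fun i => exists_one_tmul_of_real (hV.real i)
  have hspan : ∀ x : g, ∃ c : Fin 6 → ℝ, x = ∑ i, c i • v i := by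
    intro x
    obtain ⟨c₀, c₁, c₂, c₃, c₄, c₅, hc⟩ := hV.span ((1 : ℂ) ⊗ₜ x)
    -- The real part of a complex combination of real vectors is the combination with the real parts
    -- of the coefficients. Six spanning vectors then form a basis.
    refine ⟨![c₀.re, c₁.re, c₂.re, c₃.re, c₄.re, c₅.re], ?_⟩
    have := congrArg (realPart g) hc
    simp only [← hv, map_add, realPart_smul_one_tmul] at this
    rw [realPart_tmul, Complex.one_re, one_smul] at this
    rw [this]
    simp [Fin.sum_univ_six]
  obtain ⟨e, he⟩ := exists_basis_of_span hdim v hspan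
  exact ⟨e, fun i => by rw [he, hv]⟩

theorem PKData.RealFrame.lie_eq {J : ComplexStructure g} {Ω : SymplecticForm g}
    {h : IsPseudoKahler J Ω} {e : Module.Basis (Fin 6) ℝ g} {V : Fin 6 → ℂ ⊗[ℝ] g}
    (hV : (pkData J Ω h).RealFrame V) (he : ∀ i, V i = (1 : ℂ) ⊗ₜ e i) {A B C E : g}
    (h01 : lieBilin (ℂ ⊗[ℝ] g) (V 0) (V 1) = (1 : ℂ) ⊗ₜ A)
    (h02 : lieBilin (ℂ ⊗[ℝ] g) (V 0) (V 2) = (1 : ℂ) ⊗ₜ B)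
    (h03 : lieBilin (ℂ ⊗[ℝ] g) (V 0) (V 3) = (1 : ℂ) ⊗ₜ C)
    (h14 : lieBilin (ℂ ⊗[ℝ] g) (V 1) (V 4) = (1 : ℂ) ⊗ₜ E) (x y : g) :
    ⁅x, y⁆ = wedge (e.coord 0) (e.coord 1) x y • A + wedge (e.coord 0) (e.coord 2) x y • B +
      wedge (e.coord 0) (e.coord 3) x y • C + wedge (e.coord 1) (e.coord 4) x y • E := by
  have hz : ∀ {i j}, lieBilin (ℂ ⊗[ℝ] g) (V i) (V j) = 0 → ⁅e i, e j⁆ = 0 := fun {i j} hij => by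
    apply lie_eq_of_one_tmul
    rw [← he, ← he, hij, TensorProduct.tmul_zero]
  refine (lie_eq_of_table e (A := A) (B := B) (C := C) (D := 0) (E := E) (fun l => ?_) (lie_eq_of_one_tmul (by rw [← he, ← he, h01]))
    (lie_eq_of_one_tmul (by rw [← he, ← he, h02])) (lie_eq_of_one_tmul (by rw [← he, ← he, h03]))
    (hz hV.lie04) (hz hV.lie12) (hz hV.lie13) (lie_eq_of_one_tmul (by rw [← he, ← he, h14]))
    (hz hV.lie23) (hz hV.lie24) (hz hV.lie34) x y).trans (by rw [smul_zero, add_zero])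
  apply lie_eq_of_one_tmul
  rw [← he, TensorProduct.tmul_zero]
  exact hV.central _

/-- A nilpotent symplectic Lie algebra of dimension six whose derived algebra is a line. -/
theorem isH8_of_lie_mem_span [LieRing.IsNilpotent g] (hdim : Module.finrank ℝ g = 6)
    (Ω : SymplecticForm g) {z x₀ y₀ : g} (hz : z = ⁅x₀, y₀⁆) (hz0 : z ≠ 0)
    (hlie : ∀ x y : g, ∃ c : ℝ, ⁅x, y⁆ = c • z) : IsH8 g := by
  have hcentral : ∀ y : g, ⁅y, z⁆ = 0 := by
    intro y
    obtain ⟨r, hr⟩ := hlie y z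
    -- Since `z` is an eigenvector of the nilpotent operator `ad y`, its eigenvalue `r` is zero.
    obtain ⟨k, hk⟩ := LieModule.exists_forall_pow_toEnd_eq_zero ℝ g g
    have hpow : ∀ n : ℕ, ((LieModule.toEnd ℝ g g y) ^ n) z = r ^ n • z := by
      intro n
      induction n with
      | zero => simp
      | succ n ih =>
        rw [pow_succ', Module.End.mul_apply, ih, map_smul, LieModule.toEnd_apply_apply, hr,
          smul_smul, pow_succ]
    have h0 := hpow k
    rw [hk y, LinearMap.zero_apply] at h0
    have hr0 : r = 0 := eq_zero_of_pow_eq_zero ((smul_eq_zero.1 h0.symm).resolve_right hz0)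
    rw [hr, hr0, zero_smul]
  obtain ⟨l₁, hl₁⟩ : ∃ l, Ω.form z l ≠ 0 := by
    by_contra! hcon
    exact hz0 (Ω.nondegenerate.1 z hcon)
  obtain ⟨l₀, hl₀⟩ : ∃ l, Ω.form z l = 1 :=
    ⟨(Ω.form z l₁)⁻¹ • l₁, by rw [map_smul, smul_eq_mul, inv_mul_cancel₀ hl₁]⟩
  set θ : g →ₗ[ℝ] ℝ := Ω.form z with hθ
  set η : g →ₗ[ℝ] ℝ := Ω.form.flip l₀ ∘ₗ (LieModule.toEnd ℝ g g l₀) with hη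
  have hη' : ∀ y : g, η y = Ω.form ⁅l₀, y⁆ l₀ := fun y => rfl
  have hform : ∀ x y l : g, Ω.form ⁅x, y⁆ l = Ω.form ⁅x, y⁆ l₀ * θ l := by
    intro x y l
    obtain ⟨c, hc⟩ := hlie x y
    rw [hc, map_smul, LinearMap.smul_apply, LinearMap.smul_apply, ← hθ, hl₀, smul_eq_mul,
      smul_eq_mul, mul_one]
  -- Closedness of `Ω` on `x, y, l₀` makes the bracket a decomposable 2-form times `z`. This is what
  -- excludes algebras such as `(0,0,0,0,0,12+34)`.
  have hbr : ∀ x y : g, ⁅x, y⁆ = (θ x * η y - η x * θ y) • z := by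
    intro x y
    have hc := Ω.closed x y l₀
    rw [hform y l₀ x, hform l₀ x y, ← lie_skew y l₀, map_neg, LinearMap.neg_apply, ← hη', ← hη']
      at hc
    obtain ⟨c, hxy⟩ := hlie x y
    rw [hxy, map_smul, LinearMap.smul_apply, ← hθ, hl₀, smul_eq_mul, mul_one] at hc
    rw [hxy]
    congr 1
    linear_combination hc
  have hηl : η l₀ = 0 := by rw [hη', lie_self, map_zero, LinearMap.zero_apply]
  have hηz : η z = 0 := by rw [hη', hcentral, map_zero, LinearMap.zero_apply]
  have hθz : θ z = 0 := Ω.alt z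
  obtain ⟨m₁, hm₁⟩ : ∃ m, η m ≠ 0 := by
    by_contra! hcon
    apply hz0
    rw [hz, hbr, hcon, hcon, mul_zero, zero_mul, sub_zero, zero_smul]
  -- The value `-1` makes `-η` the second coordinate, which matches the sign in `de⁵ = e⁰ ∧ e¹`.
  obtain ⟨m, hθm, hηm⟩ : ∃ m, θ m = 0 ∧ η m = -1 := by
    refine ⟨(-(η m₁)⁻¹) • (m₁ - θ m₁ • l₀), ?_, ?_⟩
    · rw [map_smul, map_sub, map_smul, hl₀]; simp
    · rw [map_smul, map_sub, map_smul, hηl]; simp [hm₁]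
  set K := LinearMap.ker (θ.prod η)
  have hK : Module.finrank ℝ K = 4 := by
    have h1 := (θ.prod η).finrank_range_add_finrank_ker
    have h2 : LinearMap.range (θ.prod η) = ⊤ := by
      rw [LinearMap.range_eq_top]
      rintro ⟨p, q⟩
      exact ⟨p • l₀ - q • m, by simp [hl₀, hθm, hηl, hηm]⟩
    rw [h2, finrank_top, Module.finrank_prod, Module.finrank_self, hdim] at h1
    change 1 + 1 + Module.finrank ℝ K = 6 at h1
    omega
  have hzK : z ∈ K := by simp [K, hθz, hηz]
  obtain ⟨C, hC⟩ := Submodule.exists_isCompl (Submodule.span ℝ {(⟨z, hzK⟩ : K)})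
  have hCfin : Module.finrank ℝ C = 3 := by
    have h1 := Submodule.finrank_add_eq_of_isCompl hC
    rw [finrank_span_singleton (by simpa using hz0), hK] at h1
    omega
  let b := Module.finBasisOfFinrankEq ℝ C hCfin
  obtain ⟨e, he⟩ := exists_basis_of_span hdim
    ![l₀, m, ((b 0 : K) : g), ((b 1 : K) : g), ((b 2 : K) : g), z] (by
      intro x
      have hx : x - θ x • l₀ + η x • m ∈ K := by simp [K, hl₀, hθm, hηl, hηm]
      obtain ⟨p, q, hp, hq, hpq⟩ := Submodule.codisjoint_iff_exists_add_eq.1 hC.codisjoint ⟨_, hx⟩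
      obtain ⟨r, rfl⟩ := Submodule.mem_span_singleton.1 hp
      have hq' := congrArg (fun t : C => ((t : K) : g)) (b.sum_repr ⟨q, hq⟩)
      have hpq' := congrArg (fun t : K => (t : g)) hpq
      simp only [Fin.sum_univ_three, Submodule.coe_add, Submodule.coe_smul] at hq' hpq'
      refine ⟨![θ x, -η x, b.repr ⟨q, hq⟩ 0, b.repr ⟨q, hq⟩ 1, b.repr ⟨q, hq⟩ 2, r], ?_⟩
      simp only [Fin.sum_univ_six, Matrix.cons_val]
      have hx' : x = (x - θ x • l₀ + η x • m) + θ x • l₀ - η x • m := by abel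
      rw [← hpq', ← hq'] at hx'
      rw [neg_smul]
      refine hx'.trans ?_
      abel)
  have hbK : ∀ i, θ ((b i : K) : g) = 0 ∧ η ((b i : K) : g) = 0 := by
    intro i
    have := (b i : K).2
    simpa [K] using this
  have hθe : θ = e.coord 0 := e.ext fun i => by
    rw [e.coord_apply, e.repr_self, he]
    fin_cases i <;> simp [hl₀, hθm, hθz, hbK]
  have hηe : -η = e.coord 1 := e.ext fun i => by
    rw [e.coord_apply, e.repr_self, he]
    fin_cases i <;> simp [hηl, hηm, hηz, hbK]
  refine isH8_of_table e fun x y => ?_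
  rw [hbr, wedge, ← hθe, ← hηe, he]
  simp only [Matrix.cons_val, LinearMap.neg_apply]
  module

/-- Two real vectors on one complex line, the second nonzero, have a real ratio, so a derived
algebra inside a complex line is at most a real line. -/
theorem isH1_or_isH8_of_lie_mem_span [LieRing.IsNilpotent g] (hdim : Module.finrank ℝ g = 6)
    (Ω : SymplecticForm g) {η : ℂ ⊗[ℝ] g}
    (hη : ∀ x y, ∃ c : ℂ, lieBilin (ℂ ⊗[ℝ] g) x y = c • η) : IsH1 g ∨ IsH8 g := by
  by_cases h : ∀ x y : g, ⁅x, y⁆ = 0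
  · exact Or.inl (isH1_of_table (Module.finBasisOfFinrankEq ℝ g hdim) h)
  push Not at h
  obtain ⟨x₀, y₀, h0⟩ := h
  refine Or.inr (isH8_of_lie_mem_span hdim Ω rfl h0 fun x y => ?_)
  have key : ∀ x y : g, ∃ c : ℂ, (1 : ℂ) ⊗ₜ[ℝ] ⁅x, y⁆ = c • η := by
    intro x y
    obtain ⟨c, hc⟩ := hη (1 ⊗ₜ x) (1 ⊗ₜ y)
    rw [lieBilin_tmul, one_mul] at hc
    exact ⟨c, hc⟩
  obtain ⟨c₀, hc₀⟩ := key x₀ y₀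
  obtain ⟨c, hc⟩ := key x y
  have hc₀' : c₀ ≠ 0 := by
    rintro rfl
    rw [zero_smul, ← TensorProduct.tmul_zero g (1 : ℂ)] at hc₀
    exact h0 (one_tmul_injective hc₀)
  have : (1 : ℂ) ⊗ₜ[ℝ] ⁅x, y⁆ = (c * c₀⁻¹) • ((1 : ℂ) ⊗ₜ[ℝ] ⁅x₀, y₀⁆) := by
    rw [hc, hc₀, smul_smul, inv_mul_cancel_right₀ hc₀']
  have := congrArg (realPart g) this
  rw [realPart_smul_one_tmul, realPart_tmul, Complex.one_re, one_smul] at this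
  exact ⟨_, this⟩

theorem PKData.SelfMirror.structureEquations [LieRing.IsNilpotent g]
    (hdim : Module.finrank ℝ g = 6) {J : ComplexStructure g} {Ω : SymplecticForm g}
    {h : IsPseudoKahler J Ω} (M : (pkData J Ω h).SelfMirror) :
    IsH1 g ∨ IsH6 g ∨ IsH8 g ∨ IsH9 g ∨ IsH10 g := by
  have hfin : Module.finrank ℂ (pkData J Ω h).A = 3 := by
    have := finrank_g10 J Ω h
    rw [hdim] at this
    change Module.finrank ℂ J.g10.toSubmodule = 3
    omega
  have hneg : ∀ {i : g} {V : ℂ ⊗[ℝ] g}, V = (1 : ℂ) ⊗ₜ i → -V = (1 : ℂ) ⊗ₜ (-i) := by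
    rintro i V rfl
    rw [TensorProduct.tmul_neg]
  rcases M.classification hfin fun S hS => (pkData J Ω h).exists_mem_not_mem S hS with
    ⟨η, hη⟩ | ⟨a, w, u, β, γ, α, κ, δ, F, hu, hww, ⟨h1, h2, h3⟩ | ⟨c₁, c₂, h1, h2, h3⟩ |
      ⟨c₁, c₂, h1, h2, h3⟩⟩
  · rcases isH1_or_isH8_of_lie_mem_span hdim Ω hη with h | h <;> tauto
  · obtain ⟨V, hV, h01, h02, h03, h14⟩ := F.exists_realFrame_h6 hu hww h1 h2 h3
    obtain ⟨e, he⟩ := hV.exists_basis hdim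
    have := isH6_of_table e fun x y => by
      rw [hV.lie_eq he (h01.trans (hneg (he 4))) (h02.trans (hneg (he 5)))
        (h03.trans (TensorProduct.tmul_zero _ _).symm)
        (h14.trans (TensorProduct.tmul_zero _ _).symm), smul_zero, smul_zero, add_zero, add_zero]
    tauto
  · obtain ⟨V, hV, h01, h02, h03, h14⟩ := F.exists_realFrame_h10 hu hww h1 h2 h3
    obtain ⟨e, he⟩ := hV.exists_basis hdim
    have := isH10_of_table e fun x y => by
      rw [hV.lie_eq he (h01.trans (hneg (he 3))) (h02.trans (hneg (he 4)))
        (h03.trans (hneg (he 5)))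
        (h14.trans (TensorProduct.tmul_zero _ _).symm), smul_zero, add_zero]
    tauto
  · obtain ⟨V, hV, h01, h02, h03, h14⟩ := F.exists_realFrame_h9 hu hww h1 h2 h3
    obtain ⟨e, he⟩ := hV.exists_basis hdim
    have := isH9_of_table e fun x y => by
      rw [hV.lie_eq he (h01.trans (hneg (he 4)))
        (h02.trans (TensorProduct.tmul_zero _ _).symm) (h03.trans (hneg (he 5)))
        (h14.trans (hneg (he 5))), smul_zero, add_zero]
    tauto

end Real

end WeakSelfMirror

/-! ### Self-mirror structures given by a basis -/

namespace WeakSelfMirror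

open scoped ComplexConjugate

namespace PKData

variable {L : Type*} [LieRing L] [LieAlgebra ℂ L] {D : PKData L} {a w u : L}

namespace Frame

variable {β γ α κ δ : ℂ}

theorem exists_basis (F : D.Frame a w u β γ α κ δ) :
    ∃ e : Module.Basis (Fin 6) ℂ L, ∀ i, e i = ![a, w, u, D.σ a, D.σ w, D.σ u] i := by
  have hli : LinearIndependent ℂ ![a, w, u, D.σ a, D.σ w, D.σ u] := by
    rw [Fintype.linearIndependent_iff]
    intro c hc
    simp only [Fin.sum_univ_six, Matrix.cons_val] at hc
    obtain ⟨h0, h1, h2, h3, h4, h5⟩ := F.indep₆ hc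
    intro i
    fin_cases i <;> assumption
  have hsp : ⊤ ≤ Submodule.span ℂ (Set.range ![a, w, u, D.σ a, D.σ w, D.σ u]) := by
    intro l _
    obtain ⟨c₁, c₂, c₃, c₄, c₅, c₆, rfl⟩ := F.exists_coords l
    have hm : ∀ i, (![a, w, u, D.σ a, D.σ w, D.σ u] : Fin 6 → L) i ∈
        Submodule.span ℂ (Set.range ![a, w, u, D.σ a, D.σ w, D.σ u]) := fun i =>
      Submodule.subset_span ⟨i, rfl⟩
    exact add_mem (add_mem (add_mem (add_mem (add_mem (Submodule.smul_mem _ _ (hm 0))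
      (Submodule.smul_mem _ _ (hm 1))) (Submodule.smul_mem _ _ (hm 2)))
      (Submodule.smul_mem _ _ (hm 3))) (Submodule.smul_mem _ _ (hm 4)))
      (Submodule.smul_mem _ _ (hm 5))
  exact ⟨Module.Basis.mk hli hsp, fun i => by simp⟩

/-- A self-mirror structure from a basis `V = (ψ a, ψ a', ψ w, ψ w', ψ u, ψ u')` of `L` and the
images `ε₀ ā, ε₁ ā', …` of its members. -/
theorem exists_selfMirror {c₁ c₂ c₃ : ℂ} (F : D.Frame a w u c₁ 0 c₂ c₃ 0) (hc₁ : conj c₁ = c₁)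
    (hc₂ : conj c₂ = c₂) (hc₃ : conj c₃ = c₃) {V : Fin 6 → L}
    (hV : ∀ l, ∃ c : Fin 6 → ℂ, l = ∑ i, c i • V i)
    (h01 : ⁅V 0, V 1⁆ = c₁ • V 3) (h02 : ⁅V 0, V 2⁆ = (c₂ - c₃) • V 4)
    (h03 : ⁅V 0, V 3⁆ = c₂ • V 5) (h12 : ⁅V 1, V 2⁆ = -(c₃ • V 5)) (h13 : ⁅V 1, V 3⁆ = 0)
    (h23 : ⁅V 2, V 3⁆ = 0) (h4 : ∀ l : L, ⁅V 4, l⁆ = 0) (h5 : ∀ l : L, ⁅V 5, l⁆ = 0)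
    {ε₀ ε₁ ε₂ ε₃ ε₄ ε₅ : ℂ} (e1 : c₁ * (ε₀ * ε₁) = c₁ * ε₃) (e2 : c₂ * (ε₀ * ε₃) = c₂ * ε₅)
    (e3 : (c₂ - c₃) * (ε₀ * ε₂) = (c₂ - c₃) * ε₄) (e4 : c₃ * (ε₂ * ε₁) = c₃ * ε₅)
    (o0 : ∀ k, D.Om (V 0) (V k) =
      D.Om (![0, ε₁ • D.σ a, 0, ε₃ • D.σ w, 0, ε₅ • D.σ u] k) a)
    (o2 : ∀ k, D.Om (V 2) (V k) =
      D.Om (![0, ε₁ • D.σ a, 0, ε₃ • D.σ w, 0, ε₅ • D.σ u] k) w)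
    (o4 : ∀ k, D.Om (V 4) (V k) =
      D.Om (![0, ε₁ • D.σ a, 0, ε₃ • D.σ w, 0, ε₅ • D.σ u] k) u)
    (o1 : ∀ k, D.Om (V 1) (V k) =
      D.Om a (![ε₀ • D.σ a, 0, ε₂ • D.σ w, 0, ε₄ • D.σ u, 0] k))
    (o3 : ∀ k, D.Om (V 3) (V k) =
      D.Om w (![ε₀ • D.σ a, 0, ε₂ • D.σ w, 0, ε₄ • D.σ u, 0] k))
    (o5 : ∀ k, D.Om (V 5) (V k) =
      D.Om u (![ε₀ • D.σ a, 0, ε₂ • D.σ w, 0, ε₄ • D.σ u, 0] k)) :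
    Nonempty D.SelfMirror := by
  obtain ⟨e, he⟩ := F.exists_basis
  obtain ⟨b, hb⟩ := exists_basis_of_span
    (by rw [Module.finrank_eq_card_basis e, Fintype.card_fin]) V hV
  obtain ⟨ψ₁, hψ₁⟩ : ∃ ψ : L →ₗ[ℂ] L, ∀ i, ψ (e i) = ![V 0, V 2, V 4, 0, 0, 0] i :=
    ⟨e.constr ℂ _, fun i => e.constr_basis ℂ _ i⟩
  obtain ⟨ψ₂, hψ₂⟩ : ∃ ψ : L →ₗ[ℂ] L, ∀ i, ψ (e i) = ![V 1, V 3, V 5, 0, 0, 0] i :=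
    ⟨e.constr ℂ _, fun i => e.constr_basis ℂ _ i⟩
  obtain ⟨χ₁, hχ₁⟩ : ∃ χ : L →ₗ[ℂ] L, ∀ i, χ (b i) =
      ![ε₀ • D.σ a, 0, ε₂ • D.σ w, 0, ε₄ • D.σ u, 0] i :=
    ⟨b.constr ℂ _, fun i => b.constr_basis ℂ _ i⟩
  obtain ⟨χ₂, hχ₂⟩ : ∃ χ : L →ₗ[ℂ] L, ∀ i, χ (b i) =
      ![0, ε₁ • D.σ a, 0, ε₃ • D.σ w, 0, ε₅ • D.σ u] i :=
    ⟨b.constr ℂ _, fun i => b.constr_basis ℂ _ i⟩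
  have ψ₁a : ψ₁ a = V 0 := by simpa [he] using hψ₁ 0
  have ψ₁w : ψ₁ w = V 2 := by simpa [he] using hψ₁ 1
  have ψ₁u : ψ₁ u = V 4 := by simpa [he] using hψ₁ 2
  have ψ₂a : ψ₂ a = V 1 := by simpa [he] using hψ₂ 0
  have ψ₂w : ψ₂ w = V 3 := by simpa [he] using hψ₂ 1
  have ψ₂u : ψ₂ u = V 5 := by simpa [he] using hψ₂ 2
  have h4' : ∀ l : L, ⁅l, V 4⁆ = 0 := fun l => by rw [← lie_skew, h4, neg_zero]
  have h5' : ∀ l : L, ⁅l, V 5⁆ = 0 := fun l => by rw [← lie_skew, h5, neg_zero]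
  have h10 : ⁅V 1, V 0⁆ = -(c₁ • V 3) := by rw [← lie_skew, h01]
  have h20 : ⁅V 2, V 0⁆ = -((c₂ - c₃) • V 4) := by rw [← lie_skew, h02]
  have h30 : ⁅V 3, V 0⁆ = -(c₂ • V 5) := by rw [← lie_skew, h03]
  have h21 : ⁅V 2, V 1⁆ = c₃ • V 5 := by rw [← lie_skew, h12, neg_neg]
  have h31 : ⁅V 3, V 1⁆ = 0 := by rw [← lie_skew, h13, neg_zero]
  have h32 : ⁅V 3, V 2⁆ = 0 := by rw [← lie_skew, h23, neg_zero]
  have hlie : ∀ x y : Fin 6 → ℂ, ⁅∑ i, x i • V i, ∑ i, y i • V i⁆ =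
      (c₁ * (x 0 * y 1 - x 1 * y 0)) • V 3 + ((c₂ - c₃) * (x 0 * y 2 - x 2 * y 0)) • V 4 +
        (c₂ * (x 0 * y 3 - x 3 * y 0) + c₃ * (x 2 * y 1 - x 1 * y 2)) • V 5 := by
    intro x y
    simp only [Fin.sum_univ_six, add_lie, lie_add, smul_lie, lie_smul, lie_self, h01, h02, h03, h12,
      h13, h23, h4, h5, h4', h5', h10, h20, h30, h21, h31, h32, smul_zero, add_zero, zero_add]
    module
  have hχ₁' : ∀ x : Fin 6 → ℂ, χ₁ (∑ i, x i • V i) =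
      D.σ (conj (ε₀ * x 0) • a + conj (ε₂ * x 2) • w + conj (ε₄ * x 4) • u) := by
    intro x
    simp only [map_sum, map_smul, ← hb, hχ₁]
    simp only [Fin.sum_univ_six, Matrix.cons_val, map_add, map_smulₛₗ, Complex.conj_conj, smul_zero]
    module
  have hχ₂' : ∀ x : Fin 6 → ℂ, χ₂ (∑ i, x i • V i) =
      D.σ (conj (ε₁ * x 1) • a + conj (ε₃ * x 3) • w + conj (ε₅ * x 5) • u) := by
    intro x
    simp only [map_sum, map_smul, ← hb, hχ₂]
    simp only [Fin.sum_univ_six, Matrix.cons_val, map_add, map_smulₛₗ, Complex.conj_conj, smul_zero]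
    module
  have hmem : ∀ x y z : ℂ, x • a + y • w + z • u ∈ D.A := fun x y z =>
    add_mem (add_mem (D.A.smul_mem _ F.a_mem) (D.A.smul_mem _ F.w_mem)) (D.A.smul_mem _ F.u_mem)
  -- Adjointness is linear in all arguments, so the 36 values on the basis `V` in `o0` to `o5` are
  -- enough.
  have t0 : D.Om (V 0) = D.Om.flip a ∘ₗ χ₂ := b.ext fun k => by
    rw [LinearMap.comp_apply, hχ₂, LinearMap.flip_apply, ← o0, hb]
  have t2 : D.Om (V 2) = D.Om.flip w ∘ₗ χ₂ := b.ext fun k => by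
    rw [LinearMap.comp_apply, hχ₂, LinearMap.flip_apply, ← o2, hb]
  have t4 : D.Om (V 4) = D.Om.flip u ∘ₗ χ₂ := b.ext fun k => by
    rw [LinearMap.comp_apply, hχ₂, LinearMap.flip_apply, ← o4, hb]
  have t1 : D.Om (V 1) = D.Om a ∘ₗ χ₁ := b.ext fun k => by
    rw [LinearMap.comp_apply, hχ₁, ← o1, hb]
  have t3 : D.Om (V 3) = D.Om w ∘ₗ χ₁ := b.ext fun k => by
    rw [LinearMap.comp_apply, hχ₁, ← o3, hb]
  have t5 : D.Om (V 5) = D.Om u ∘ₗ χ₁ := b.ext fun k => by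
    rw [LinearMap.comp_apply, hχ₁, ← o5, hb]
  refine ⟨⟨ψ₁, ψ₂, χ₁, χ₂, ?_, ?_, ?_, ?_, ?_, ?_, ?_, ?_, ?_, ?_⟩⟩
  · intro x hx y hy
    obtain ⟨x₁, x₂, x₃, rfl⟩ := F.span x hx
    obtain ⟨y₁, y₂, y₃, rfl⟩ := F.span y hy
    rw [← D.mul_sub_mul (x₁ • a + x₂ • w + x₃ • u), F.mul_coords, F.mul_coords]
    simp only [map_add, map_sub, map_smul, ψ₁a, ψ₁w, ψ₁u, add_lie, lie_add, smul_lie, lie_smul,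
      lie_self, h02, h20, h4, h4', smul_zero, add_zero]
    module
  · intro x hx y hy
    obtain ⟨x₁, x₂, x₃, rfl⟩ := F.span x hx
    obtain ⟨y₁, y₂, y₃, rfl⟩ := F.span y hy
    rw [F.mul_coords]
    simp only [map_add, map_smul, ψ₁a, ψ₁w, ψ₁u, ψ₂a, ψ₂w, ψ₂u, add_lie, lie_add, smul_lie,
      lie_smul, h01, h03, h21, h23, h4, h5', smul_zero, add_zero]
    module
  · intro x hx y hy
    obtain ⟨x₁, x₂, x₃, rfl⟩ := F.span x hx
    obtain ⟨y₁, y₂, y₃, rfl⟩ := F.span y hy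
    simp only [map_add, map_smul, ψ₂a, ψ₂w, ψ₂u, add_lie, lie_add, smul_lie,
      lie_smul, lie_self, h13, h31, h5, h5', smul_zero, add_zero]
  · intro l
    obtain ⟨c, rfl⟩ := hV l
    refine ⟨_, hmem (c 0) (c 2) (c 4), _, hmem (c 1) (c 3) (c 5), ?_⟩
    simp only [map_add, map_smul, ψ₁a, ψ₁w, ψ₁u, ψ₂a, ψ₂w, ψ₂u, Fin.sum_univ_six]
    module
  · intro x hx y hy h
    obtain ⟨x₁, x₂, x₃, rfl⟩ := F.span x hx
    obtain ⟨y₁, y₂, y₃, rfl⟩ := F.span y hy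
    have := Fintype.linearIndependent_iff.1 b.linearIndependent ![x₁, y₁, x₂, y₂, x₃, y₃] (by
      rw [← h]
      simp only [map_add, map_smul, ψ₁a, ψ₁w, ψ₁u, ψ₂a, ψ₂w, ψ₂u, Fin.sum_univ_six, hb,
        Matrix.cons_val]
      module)
    have g0 : x₁ = 0 := this 0
    have g1 : y₁ = 0 := this 1
    have g2 : x₂ = 0 := this 2
    have g3 : y₂ = 0 := this 3
    have g4 : x₃ = 0 := this 4
    have g5 : y₃ = 0 := this 5
    simp [g0, g1, g2, g3, g4, g5]
  · intro l
    obtain ⟨c, rfl⟩ := hV l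
    rw [hχ₁', D.σ_σ]
    exact hmem _ _ _
  · intro l
    obtain ⟨c, rfl⟩ := hV l
    rw [hχ₂', D.σ_σ]
    exact hmem _ _ _
  · intro l l'
    obtain ⟨x, rfl⟩ := hV l
    obtain ⟨y, rfl⟩ := hV l'
    rw [hχ₁', hχ₁', ← D.σ_lie, hlie, ← D.mul_sub_mul, F.mul_coords, F.mul_coords]
    simp only [map_add, map_sub, map_smul, map_smulₛₗ, ← hb, hχ₁, map_mul, Complex.conj_conj, hc₁,
      hc₂, hc₃, map_zero, Matrix.cons_val]
    linear_combination (norm := module) (-(x 0 * y 2 - x 2 * y 0) * e3) • D.σ u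
  · intro l l'
    obtain ⟨x, rfl⟩ := hV l
    obtain ⟨y, rfl⟩ := hV l'
    rw [hχ₁', hχ₁', hχ₂', hχ₂', ← D.σ_mul, ← D.σ_mul, F.mul_coords, F.mul_coords, hlie]
    simp only [map_add, map_smul, map_smulₛₗ, ← hb, hχ₂, map_mul, Complex.conj_conj, hc₁,
      hc₂, hc₃, map_zero, Matrix.cons_val]
    linear_combination (norm := module) (-(x 0 * y 1 - x 1 * y 0) * e1) • D.σ w +
      (-(x 0 * y 3 - x 3 * y 0) * e2 - (x 2 * y 1 - x 1 * y 2) * e4) • D.σ u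
  · intro x hx y hy l
    obtain ⟨x₁, x₂, x₃, rfl⟩ := F.span x hx
    obtain ⟨y₁, y₂, y₃, rfl⟩ := F.span y hy
    simp only [map_add, map_smul, ψ₁a, ψ₁w, ψ₁u, ψ₂a, ψ₂w, ψ₂u, LinearMap.add_apply,
      LinearMap.smul_apply, t0, t1, t2, t3, t4, t5, LinearMap.comp_apply, LinearMap.flip_apply]
    ring

end Frame

end PKData

end WeakSelfMirror

/-! ### Products from brackets in adapted frames -/

namespace WeakSelfMirror

open scoped ComplexConjugate

namespace PKData

variable {L : Type*} [LieRing L] [LieAlgebra ℂ L]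

/-- A basis of `A` for which the brackets with the conjugate basis have a normal form. -/
structure AdaptedFrame (D : PKData L) (a w u : L) (p b d : ℂ) : Prop where
  a_mem : a ∈ D.A
  w_mem : w ∈ D.A
  u_mem : u ∈ D.A
  span : ∀ x ∈ D.A, ∃ c₁ c₂ c₃ : ℂ, x = c₁ • a + c₂ • w + c₃ • u
  indep : ∀ c₁ c₂ c₃ : ℂ, c₁ • a + c₂ • w + c₃ • u = 0 → c₁ = 0 ∧ c₂ = 0 ∧ c₃ = 0
  lie_aw : ⁅a, w⁆ = (b + d) • u
  lie_aσa : ⁅a, D.σ a⁆ = p • (w - D.σ w)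
  lie_aσw : ⁅a, D.σ w⁆ = d • u + b • D.σ u
  lie_wσw : ⁅w, D.σ w⁆ = 0
  central : ∀ l : L, ⁅u, l⁆ = 0

namespace AdaptedFrame

variable {D : PKData L} {a w u : L} {p b d : ℂ} (F : D.AdaptedFrame a w u p b d)

include F

theorem mul_eq {x y v : L} (hx : x ∈ D.A) (hy : y ∈ D.A) (hv : v ∈ D.A)
    (ha : D.Om y ⁅x, D.σ a⁆ = -D.Om v (D.σ a)) (hw : D.Om y ⁅x, D.σ w⁆ = -D.Om v (D.σ w))
    (hu : D.Om y ⁅x, D.σ u⁆ = -D.Om v (D.σ u)) : D.mul x y = v := by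
  refine D.ext_Om fun z => ?_
  obtain ⟨z₁, h₁, z₂, h₂, rfl⟩ := D.exists_add z
  obtain ⟨c₁, c₂, c₃, rfl⟩ := F.span z₂ h₂
  rw [map_add (D.Om _), map_add (D.Om v), D.isotropic _ (D.mul_mem hx hy) _ h₁, D.isotropic _ hv _ h₁, D.Om_mul]
  simp only [map_add, map_smulₛₗ, lie_add, lie_smul, ha, hw, hu, smul_eq_mul]
  ring

theorem lie_table (hb : conj b = b) (hd : conj d = d) :
    ((∀ l : L, ⁅u, l⁆ = 0) ∧ (∀ l : L, ⁅l, u⁆ = 0) ∧ (∀ l : L, ⁅D.σ u, l⁆ = 0) ∧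
      ∀ l : L, ⁅l, D.σ u⁆ = 0) ∧
    (⁅a, w⁆ = (b + d) • u ∧ ⁅a, D.σ a⁆ = p • (w - D.σ w) ∧ ⁅a, D.σ w⁆ = d • u + b • D.σ u) ∧
    (⁅w, a⁆ = -((b + d) • u) ∧ ⁅w, D.σ a⁆ = -(d • D.σ u + b • u) ∧ ⁅w, D.σ w⁆ = 0) ∧
    (⁅D.σ a, a⁆ = -(p • (w - D.σ w)) ∧ ⁅D.σ a, w⁆ = d • D.σ u + b • u ∧
      ⁅D.σ a, D.σ w⁆ = (b + d) • D.σ u) ∧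
    (⁅D.σ w, a⁆ = -(d • u + b • D.σ u) ∧ ⁅D.σ w, w⁆ = 0 ∧
      ⁅D.σ w, D.σ a⁆ = -((b + d) • D.σ u)) := by
  have hu' : ∀ l : L, ⁅l, u⁆ = 0 := fun l => by rw [← lie_skew, F.central, neg_zero]
  have hσu : ∀ l : L, ⁅l, D.σ u⁆ = 0 := fun l => by
    rw [← D.σ_σ l, ← D.σ_lie, hu', map_zero]
  have hσu' : ∀ l : L, ⁅D.σ u, l⁆ = 0 := fun l => by rw [← lie_skew, hσu, neg_zero]
  have haw : ⁅D.σ a, w⁆ = d • D.σ u + b • u := by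
    rw [← D.σ_σ w, ← D.σ_lie, F.lie_aσw, map_add, map_smulₛₗ, map_smulₛₗ, hb,
      hd, D.σ_σ]
  have haw' : ⁅D.σ a, D.σ w⁆ = (b + d) • D.σ u := by
    rw [← D.σ_lie, F.lie_aw, map_smulₛₗ, map_add, hb, hd]
  refine ⟨⟨F.central, hu', hσu', hσu⟩, ⟨F.lie_aw, F.lie_aσa, F.lie_aσw⟩,
    ⟨?_, ?_, F.lie_wσw⟩, ⟨?_, haw, haw'⟩, ?_, ?_, ?_⟩
  · rw [← lie_skew, F.lie_aw]
  · rw [← lie_skew, haw]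
  · rw [← lie_skew, F.lie_aσa]
  · rw [← lie_skew, F.lie_aσw]
  · rw [← lie_skew, F.lie_wσw, neg_zero]
  · rw [← lie_skew, haw']

/-- The product depends on `Om` as well as on the brackets. The conditions `k1` to `k13` are those
needed for `Om(xy, z) = -Om(y, [x, z])` with `x, y` in the basis of `A` and `z` in the conjugate
basis. -/
theorem frame (hb : conj b = b) (hd : conj d = d) {c₁ c₂ c₃ s r q t n m : ℂ}
    (hs : D.Om a (D.σ a) = s) (hr : D.Om a (D.σ w) = r)
    (hq : D.Om a (D.σ u) = q) (ht : D.Om w (D.σ w) = t) (hn : D.Om w (D.σ u) = n)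
    (hm : D.Om u (D.σ u) = m) (k1 : p * r = -(c₁ * conj r)) (k2 : b * q = -(c₁ * t))
    (k3 : c₁ * n = 0) (k4 : p * t = -(c₂ * conj q)) (k5 : b * n = c₂ * conj n) (k6 : c₂ * m = 0)
    (k7 : d * q = -(c₃ * conj q)) (k8 : c₃ * n = 0) (k9 : c₃ * m = 0) (k10 : d * n = 0)
    (k11 : p * n = 0) (k12 : b * m = 0) (k13 : d * m = 0) : D.Frame a w u c₁ 0 c₂ c₃ 0 := by
  obtain ⟨T, -, T', -⟩ := D.Om_table_of_mem F.a_mem F.w_mem F.u_mem hs hr hq ht hn hm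
  obtain ⟨⟨-, hu', -, hσu⟩, -, ⟨-, hwa, -⟩, -⟩ := F.lie_table hb hd
  have k3' : c₁ * conj n = 0 := by rcases mul_eq_zero.1 k3 with h | h <;> simp [h]
  have k8' : c₃ * conj n = 0 := by rcases mul_eq_zero.1 k8 with h | h <;> simp [h]
  have k11' : p * conj n = 0 := by rcases mul_eq_zero.1 k11 with h | h <;> simp [h]
  refine ⟨F.a_mem, F.w_mem, F.u_mem, F.span, F.indep, ?_, ?_, ?_, ?_, ?_, ?_, ?_, ?_, ?_⟩
  · refine F.mul_eq F.a_mem F.a_mem (add_mem (D.A.smul_mem _ F.w_mem) (D.A.smul_mem _ F.u_mem))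
      ?_ ?_ ?_ <;> simp [F.lie_aσa, F.lie_aσw, hσu, T, T'] <;> grind
  · refine F.mul_eq F.a_mem F.w_mem (D.A.smul_mem _ F.u_mem) ?_ ?_ ?_ <;>
      simp [F.lie_aσa, F.lie_aσw, hσu, T, T'] <;> grind
  · refine F.mul_eq F.w_mem F.a_mem (D.A.smul_mem _ F.u_mem) ?_ ?_ ?_ <;>
      simp [hwa, F.lie_wσw, hσu, T, T'] <;> grind
  · refine F.mul_eq F.w_mem F.w_mem (D.A.smul_mem _ F.u_mem) ?_ ?_ ?_ <;>
      simp [hwa, F.lie_wσw, hσu, T, T'] <;> grind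
  · refine F.mul_eq F.a_mem F.u_mem D.A.zero_mem ?_ ?_ ?_ <;>
      simp [F.lie_aσa, F.lie_aσw, hσu, T, T'] <;> grind
  · refine F.mul_eq F.u_mem F.a_mem D.A.zero_mem ?_ ?_ ?_ <;> simp [F.central]
  · refine F.mul_eq F.w_mem F.u_mem D.A.zero_mem ?_ ?_ ?_ <;>
      simp [hwa, F.lie_wσw, hσu, T, T'] <;> grind
  · refine F.mul_eq F.u_mem F.w_mem D.A.zero_mem ?_ ?_ ?_ <;> simp [F.central]
  · refine F.mul_eq F.u_mem F.u_mem D.A.zero_mem ?_ ?_ ?_ <;> simp [F.central]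

end AdaptedFrame

end PKData

end WeakSelfMirror

/-! ### The four explicit models -/

namespace WeakSelfMirror

open scoped ComplexConjugate

namespace PKData

namespace AdaptedFrame

variable {L : Type*} [LieRing L] [LieAlgebra ℂ L] {D : PKData L} {a w u : L}

theorem selfMirror_h10 (F : D.AdaptedFrame a w u (-1) 1 0) (hs : D.Om a (D.σ a) = 0)
    (hr : D.Om a (D.σ w) = 0) (hq : D.Om a (D.σ u) = 2 * Complex.I) (ht : D.Om w (D.σ w) = -(2 * Complex.I))
    (hn : D.Om w (D.σ u) = 0) (hm : D.Om u (D.σ u) = 0) : Nonempty D.SelfMirror := by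
  have h2 : conj (2 : ℂ) = 2 := Complex.conj_ofNat 2
  have F' : D.Frame a w u 1 0 1 0 0 :=
    F.frame (by simp) (by simp) hs hr hq ht hn hm (by simp) (by simp) (by simp) (by simp [h2])
      (by simp) (by simp) (by simp [h2]) (by simp) (by simp) (by simp) (by simp) (by simp) (by simp)
  obtain ⟨T₁, T₂, T₃, T₄⟩ := F'.Om_table hs hr hq ht hn hm
  obtain ⟨B₁, B₂, B₃, B₄, B₅⟩ := F.lie_table (by simp) (by simp)
  refine F'.exists_selfMirror (by simp) (by simp) (by simp)
    -- Here `ψ₁` is the inclusion of `A` and `ψ₂ x = x - D.σ x`, whose image is an abelian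
    -- subalgebra; all multipliers in `χ` are `1`.
    (V := ![a, a - D.σ a, w, w - D.σ w, u, u - D.σ u])
    (fun l => ?_) ?_ ?_ ?_ ?_ ?_ ?_ ?_ ?_ (ε₀ := 1) (ε₁ := 1) (ε₂ := 1) (ε₃ := 1) (ε₄ := 1) (ε₅ := 1)
    (by norm_num) (by norm_num) (by norm_num) (by norm_num) ?_ ?_ ?_ ?_ ?_ ?_
  · obtain ⟨c₁, c₂, c₃, c₄, c₅, c₆, rfl⟩ := F'.exists_coords l
    refine ⟨![c₁ + c₄, -c₄, c₂ + c₅, -c₅, c₃ + c₆, -c₆], ?_⟩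
    simp only [Fin.sum_univ_six, Matrix.cons_val]
    module
  iterate 8
    simp [B₁, B₂, B₃, B₄, sub_lie, lie_sub]
  all_goals
    intro k
    fin_cases k <;> simp [T₁, T₂, T₃, T₄, h2]

theorem selfMirror_h9 (F : D.AdaptedFrame a w u 1 (-1) 1) (hs : D.Om a (D.σ a) = 0)
    (hr : D.Om a (D.σ w) = 0) (hq : D.Om a (D.σ u) = 2 * Complex.I) (ht : D.Om w (D.σ w) = 2 * Complex.I)
    (hn : D.Om w (D.σ u) = 0) (hm : D.Om u (D.σ u) = 0) : Nonempty D.SelfMirror := by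
  have h2 : conj (2 : ℂ) = 2 := Complex.conj_ofNat 2
  have F' : D.Frame a w u 1 0 1 1 0 :=
    F.frame (by simp) (by simp) hs hr hq ht hn hm (by simp) (by simp) (by simp) (by simp [h2])
      (by simp) (by simp) (by simp [h2]) (by simp) (by simp) (by simp) (by simp) (by simp) (by simp)
  obtain ⟨T₁, T₂, T₃, T₄⟩ := F'.Om_table hs hr hq ht hn hm
  obtain ⟨B₁, B₂, B₃, B₄, B₅⟩ := F.lie_table (by simp) (by simp)
  refine F'.exists_selfMirror (by simp) (by simp) (by simp)
    -- Now `⁅a, w⁆ = 0`, so the sign of `ψ₁ w` is free in `h02`. It is chosen negative to match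
    -- `h12`.
    (V := ![a, a - D.σ a, -w, D.σ w - w, u, u - D.σ u])
    (fun l => ?_) ?_ ?_ ?_ ?_ ?_ ?_ ?_ ?_ (ε₀ := 1) (ε₁ := 1) (ε₂ := 1) (ε₃ := 1) (ε₄ := 1) (ε₅ := 1)
    (by norm_num) (by norm_num) (by norm_num) (by norm_num) ?_ ?_ ?_ ?_ ?_ ?_
  · obtain ⟨c₁, c₂, c₃, c₄, c₅, c₆, rfl⟩ := F'.exists_coords l
    refine ⟨![c₁ + c₄, -c₄, -c₂ - c₅, c₅, c₃ + c₆, -c₆], ?_⟩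
    simp only [Fin.sum_univ_six, Matrix.cons_val]
    module
  iterate 8
    simp [B₁, B₂, B₃, B₄, sub_lie, lie_sub] <;> module
  all_goals
    intro k
    fin_cases k <;> simp [T₁, T₂, T₃, T₄, h2]

theorem selfMirror_h6 (F : D.AdaptedFrame a w u 0 1 0) (hs : D.Om a (D.σ a) = 2 * Complex.I)
    (hr : D.Om a (D.σ w) = 0) (hq : D.Om a (D.σ u) = 0) (ht : D.Om w (D.σ w) = 0)
    (hn : D.Om w (D.σ u) = 2) (hm : D.Om u (D.σ u) = 0) : Nonempty D.SelfMirror := by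
  have h2 : conj (2 : ℂ) = 2 := Complex.conj_ofNat 2
  have F' : D.Frame a w u 0 0 1 0 0 :=
    F.frame (by simp) (by simp) hs hr hq ht hn hm (by simp) (by simp) (by simp) (by simp)
      (by simp [h2]) (by simp) (by simp) (by simp) (by simp) (by simp) (by simp) (by simp) (by simp)
  obtain ⟨T₁, T₂, T₃, T₄⟩ := F'.Om_table hs hr hq ht hn hm
  obtain ⟨B₁, B₂, B₃, B₄, B₅⟩ := F.lie_table (by simp) (by simp)
  refine F'.exists_selfMirror (by simp) (by simp) (by simp)
    -- The pairing `D.Om w (D.σ u)` is real here, so it changes sign when the conjugation is moved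
    -- to the other argument. Adjointness therefore needs `ε₃ = ε₅ = -1`.
    (V := ![a, a - D.σ a, w, D.σ w, u, D.σ u])
    (fun l => ?_) ?_ ?_ ?_ ?_ ?_ ?_ ?_ ?_ (ε₀ := 1) (ε₁ := 1) (ε₂ := 1) (ε₃ := -1) (ε₄ := 1) (ε₅ := -1)
    (by norm_num) (by norm_num) (by norm_num) (by norm_num) ?_ ?_ ?_ ?_ ?_ ?_
  · obtain ⟨c₁, c₂, c₃, c₄, c₅, c₆, rfl⟩ := F'.exists_coords l
    refine ⟨![c₁ + c₄, -c₄, c₂, c₅, c₃, c₆], ?_⟩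
    simp only [Fin.sum_univ_six, Matrix.cons_val]
    module
  iterate 8
    simp [B₁, B₂, B₃, B₄, sub_lie, lie_sub]
  all_goals
    intro k
    fin_cases k <;> simp [T₁, T₂, T₃, T₄, h2]

theorem selfMirror_h8 {p : ℂ} (F : D.AdaptedFrame a w u p 0 0) (hp : conj p = p) (hs : D.Om a (D.σ a) = 0)
    (hr : D.Om a (D.σ w) = 2 * Complex.I) (hq : D.Om a (D.σ u) = 0) (ht : D.Om w (D.σ w) = 0)
    (hn : D.Om w (D.σ u) = 0) (hm : D.Om u (D.σ u) = 2 * Complex.I) : Nonempty D.SelfMirror := by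
  have h2 : conj (2 : ℂ) = 2 := Complex.conj_ofNat 2
  have F' : D.Frame a w u p 0 0 0 0 :=
    F.frame (by simp) (by simp) hs hr hq ht hn hm (by simp [h2]) (by simp) (by simp) (by simp)
      (by simp) (by simp) (by simp) (by simp) (by simp) (by simp) (by simp) (by simp) (by simp)
  obtain ⟨T₁, T₂, T₃, T₄⟩ := F'.Om_table hs hr hq ht hn hm
  obtain ⟨B₁, B₂, B₃, B₄, B₅⟩ := F.lie_table (by simp) (by simp)
  refine F'.exists_selfMirror (by simp [hp]) (by simp) (by simp)
    (V := ![a, a - D.σ a, w, D.σ w - w, u, -D.σ u])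
    (fun l => ?_) ?_ ?_ ?_ ?_ ?_ ?_ ?_ ?_ (ε₀ := -1) (ε₁ := 1) (ε₂ := 1) (ε₃ := -1) (ε₄ := 1) (ε₅ := 1)
    (by norm_num) (by norm_num) (by norm_num) (by norm_num) ?_ ?_ ?_ ?_ ?_ ?_
  · obtain ⟨c₁, c₂, c₃, c₄, c₅, c₆, rfl⟩ := F'.exists_coords l
    refine ⟨![c₁ + c₄, -c₄, c₂ + c₅, c₅, c₃, -c₆], ?_⟩
    simp only [Fin.sum_univ_six, Matrix.cons_val]
    module
  iterate 8
    simp [B₁, B₂, B₃, B₄, sub_lie, lie_sub] <;> module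
  all_goals
    intro k
    fin_cases k <;> simp [T₁, T₂, T₃, T₄, h2]

end AdaptedFrame

end PKData

end WeakSelfMirror

/-! ### The standard complex structure and its `(1,1)` forms -/

namespace WeakSelfMirror

open scoped ComplexConjugate

section Standard

variable {g : Type*} [LieRing g] [LieAlgebra ℝ g] (b : Module.Basis (Fin 6) ℝ g)

/-- The complex structure `x₁ ↦ y₁, x₂ ↦ y₂, x₃ ↦ y₃` of a basis `x₁, y₁, x₂, y₂, x₃, y₃`. -/
noncomputable def standardJ : g →ₗ[ℝ] g :=
  (b.coord 0).smulRight (b 1) - (b.coord 1).smulRight (b 0) + (b.coord 2).smulRight (b 3) -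
    (b.coord 3).smulRight (b 2) + (b.coord 4).smulRight (b 5) - (b.coord 5).smulRight (b 4)

theorem standardJ_apply (x : g) : standardJ b x = b.repr x 0 • b 1 - b.repr x 1 • b 0 +
    b.repr x 2 • b 3 - b.repr x 3 • b 2 + b.repr x 4 • b 5 - b.repr x 5 • b 4 := rfl

theorem standardJ_repr (x : g) : b.repr (standardJ b x) 0 = -b.repr x 1 ∧
    b.repr (standardJ b x) 1 = b.repr x 0 ∧ b.repr (standardJ b x) 2 = -b.repr x 3 ∧
    b.repr (standardJ b x) 3 = b.repr x 2 ∧ b.repr (standardJ b x) 4 = -b.repr x 5 ∧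
    b.repr (standardJ b x) 5 = b.repr x 4 := by
  rw [standardJ_apply]
  simp

theorem standardJ_sq (x : g) : standardJ b (standardJ b x) = -x := by
  obtain ⟨h0, h1, h2, h3, h4, h5⟩ := standardJ_repr b x
  rw [standardJ_apply b (standardJ b x), h0, h1, h2, h3, h4, h5]
  conv_rhs => rw [← b.sum_repr x]
  rw [Fin.sum_univ_six]
  module

/-- A form of type `(1,1)` for `standardJ b`. -/
noncomputable def standardForm (s q r t k l : ℝ) : LinearMap.BilinForm ℝ g :=
  let W i j : LinearMap.BilinForm ℝ g :=
    LinearMap.BilinForm.linMulLin (b.coord i) (b.coord j) -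
      LinearMap.BilinForm.linMulLin (b.coord j) (b.coord i)
  s • W 0 1 + q • (W 0 5 + W 4 1) + r • W 2 3 + t • (W 2 4 + W 3 5) + k • (W 2 1 + W 0 3) +
    l • W 4 5

variable {b} {s q r t k l : ℝ}

theorem standardForm_apply (x y : g) : standardForm b s q r t k l x y =
    s * (b.repr x 0 * b.repr y 1 - b.repr x 1 * b.repr y 0) +
      q * (b.repr x 0 * b.repr y 5 - b.repr x 5 * b.repr y 0 +
        (b.repr x 4 * b.repr y 1 - b.repr x 1 * b.repr y 4)) +
      r * (b.repr x 2 * b.repr y 3 - b.repr x 3 * b.repr y 2) +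
      t * (b.repr x 2 * b.repr y 4 - b.repr x 4 * b.repr y 2 +
        (b.repr x 3 * b.repr y 5 - b.repr x 5 * b.repr y 3)) +
      k * (b.repr x 2 * b.repr y 1 - b.repr x 1 * b.repr y 2 +
        (b.repr x 0 * b.repr y 3 - b.repr x 3 * b.repr y 0)) +
      l * (b.repr x 4 * b.repr y 5 - b.repr x 5 * b.repr y 4) := by
  simp [standardForm]
  ring

theorem standardForm_standardJ (x y : g) :
    standardForm b s q r t k l (standardJ b x) (standardJ b y) =
      standardForm b s q r t k l x y := by
  rw [standardForm_apply, standardForm_apply]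
  simp only [standardJ_repr]
  ring

variable (b) in
/-- The Lie algebras for which `standardJ` is integrable. -/
def IsStandard (α β δ : ℝ) : Prop :=
  ∀ x y : g, ⁅x, y⁆ = wedge (b.coord 0) (b.coord 1) x y • α • b 3 +
    wedge (b.coord 0) (b.coord 2) x y • (β + δ) • b 4 +
    wedge (b.coord 0) (b.coord 3) x y • β • b 5 + wedge (b.coord 1) (b.coord 2) x y • δ • b 5

namespace IsStandard

variable {α β δ : ℝ} (h : IsStandard b α β δ)

include h

theorem repr_lie (x y : g) : b.repr ⁅x, y⁆ 0 = 0 ∧ b.repr ⁅x, y⁆ 1 = 0 ∧ b.repr ⁅x, y⁆ 2 = 0 ∧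
    b.repr ⁅x, y⁆ 3 = α * wedge (b.coord 0) (b.coord 1) x y ∧
    b.repr ⁅x, y⁆ 4 = (β + δ) * wedge (b.coord 0) (b.coord 2) x y ∧
    b.repr ⁅x, y⁆ 5 = β * wedge (b.coord 0) (b.coord 3) x y +
      δ * wedge (b.coord 1) (b.coord 2) x y := by
  rw [h]
  simp [mul_comm]
  ring

theorem integrable (x y : g) : ⁅x, y⁆ + standardJ b ⁅standardJ b x, y⁆ +
    standardJ b ⁅x, standardJ b y⁆ - ⁅standardJ b x, standardJ b y⁆ = 0 := by
  simp only [standardJ_apply b ⁅_, _⁆, h.repr_lie]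
  rw [h x y, h (standardJ b x) (standardJ b y)]
  simp only [wedge, Module.Basis.coord_apply, standardJ_repr]
  module

theorem closed (h1 : α * r + (β + 2 * δ) * q = 0) (h2 : α * t = 0) (h3 : β * l = 0)
    (h4 : δ * l = 0) (h5 : δ * t = 0) (x y z : g) :
    standardForm b s q r t k l ⁅x, y⁆ z + standardForm b s q r t k l ⁅y, z⁆ x +
      standardForm b s q r t k l ⁅z, x⁆ y = 0 := by
  simp only [standardForm_apply, h.repr_lie, wedge, Module.Basis.coord_apply]
  generalize b.repr x 0 = x0, b.repr x 1 = x1, b.repr x 2 = x2, b.repr x 3 = x3, b.repr x 4 = x4,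
    b.repr x 5 = x5, b.repr y 0 = y0, b.repr y 1 = y1, b.repr y 2 = y2, b.repr y 3 = y3,
    b.repr y 4 = y4, b.repr y 5 = y5, b.repr z 0 = z0, b.repr z 1 = z1, b.repr z 2 = z2,
    b.repr z 3 = z3, b.repr z 4 = z4, b.repr z 5 = z5
  -- The cyclic sum is a combination of 3×3 minors of the coordinates of `x, y, z`, one for each
  -- basis 3-form occurring in `dΩ`, with the hypotheses as coefficients.
  linear_combination
    -(x0 * (y1 * z2 - y2 * z1) - x1 * (y0 * z2 - y2 * z0) + x2 * (y0 * z1 - y1 * z0)) * h1 +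
    (x0 * (y1 * z5 - y5 * z1) - x1 * (y0 * z5 - y5 * z0) + x5 * (y0 * z1 - y1 * z0)) * h2 -
    (x0 * (y3 * z4 - y4 * z3) - x3 * (y0 * z4 - y4 * z0) + x4 * (y0 * z3 - y3 * z0)) * h3 +
    (x0 * (y2 * z5 - y5 * z2) - x2 * (y0 * z5 - y5 * z0) + x5 * (y0 * z2 - y2 * z0)) * (h3 + h4) -
    (x1 * (y2 * z3 - y3 * z2) - x2 * (y1 * z3 - y3 * z1) + x3 * (y1 * z2 - y2 * z1)) * h5 -
    (x1 * (y2 * z4 - y4 * z2) - x2 * (y1 * z4 - y4 * z1) + x4 * (y1 * z2 - y2 * z1)) * h4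

end IsStandard

theorem standardForm_nondegenerate (h : ∀ x, (∀ i, standardForm b s q r t k l x (b i) = 0) → x = 0) :
    (standardForm b s q r t k l).Nondegenerate := by
  refine ⟨fun x hx => h x fun i => hx _, fun x hx => h x fun i => ?_⟩
  have := hx (b i)
  rw [standardForm_apply] at this ⊢
  linear_combination -this

end Standard

end WeakSelfMirror

/-! ### Adapted frames from standard bases -/

namespace WeakSelfMirror

open scoped ComplexConjugate

section Standard

variable {g : Type*} [LieRing g] [LieAlgebra ℝ g]

theorem lieBilin_add_sub (x y z w : g) :
    lieBilin (ℂ ⊗[ℝ] g) ((1 : ℂ) ⊗ₜ x - Complex.I ⊗ₜ y) ((1 : ℂ) ⊗ₜ z + Complex.I ⊗ₜ w) =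
      (1 : ℂ) ⊗ₜ (⁅x, z⁆ + ⁅y, w⁆) + Complex.I ⊗ₜ (⁅x, w⁆ - ⁅y, z⁆) := by
  simp only [map_add, map_sub, LinearMap.sub_apply, lieBilin_tmul, one_mul, mul_one,
    Complex.I_mul_I, TensorProduct.neg_tmul, TensorProduct.tmul_add, TensorProduct.tmul_sub]
  abel

theorem lieBilin_sub_sub (x y z w : g) :
    lieBilin (ℂ ⊗[ℝ] g) ((1 : ℂ) ⊗ₜ x - Complex.I ⊗ₜ y) ((1 : ℂ) ⊗ₜ z - Complex.I ⊗ₜ w) =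
      (1 : ℂ) ⊗ₜ (⁅x, z⁆ - ⁅y, w⁆) - Complex.I ⊗ₜ (⁅x, w⁆ + ⁅y, z⁆) := by
  simp only [map_sub, LinearMap.sub_apply, lieBilin_tmul, one_mul, mul_one,
    Complex.I_mul_I, TensorProduct.neg_tmul, TensorProduct.tmul_add, TensorProduct.tmul_sub]
  abel

theorem conjugation_one_sub_I (x y : g) : conjugation g ((1 : ℂ) ⊗ₜ x - Complex.I ⊗ₜ y) =
    (1 : ℂ) ⊗ₜ x + Complex.I ⊗ₜ y := by
  rw [map_sub, conjugation_tmul, conjugation_tmul, map_one, Complex.conj_I,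
    TensorProduct.neg_tmul, sub_neg_eq_add]

variable [FiniteDimensional ℝ g]

theorem formC_add_sub (Ω : SymplecticForm g) (x y z w : g) :
    Ω.formC ((1 : ℂ) ⊗ₜ x - Complex.I ⊗ₜ y) ((1 : ℂ) ⊗ₜ z + Complex.I ⊗ₜ w) =
      (Ω.form x z + Ω.form y w : ℝ) + (Ω.form x w - Ω.form y z : ℝ) * Complex.I := by
  simp only [map_add, map_sub, LinearMap.sub_apply, Ω.formC_tmul, one_mul, mul_one,
    Complex.I_mul_I]
  push_cast
  ring

variable {b : Module.Basis (Fin 6) ℝ g} {s q r t k l α β δ : ℝ}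

/-- The frame is `b 0 - i b 1`, `b 2 - i b 3`, `b 4 - i b 5`. The factors `2i` arise from `Ω(x - iy,
x + iy) = 2i Ω(x, y)`, and `-α` from `w - D.σ w = -2i b 3`. -/
theorem IsStandard.exists_adaptedFrame (h : IsStandard b α β δ)
    (h1 : α * r + (β + 2 * δ) * q = 0) (h2 : α * t = 0) (h3 : β * l = 0) (h4 : δ * l = 0)
    (h5 : δ * t = 0)
    (hnd : ∀ x, (∀ i, standardForm b s q r t k l x (b i) = 0) → x = 0) :
    ∃ (J : ComplexStructure g) (Ω : SymplecticForm g) (hJ : IsPseudoKahler J Ω)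
      (a w u : ℂ ⊗[ℝ] g), (pkData J Ω hJ).AdaptedFrame a w u (-α) β δ ∧
      (pkData J Ω hJ).Om a ((pkData J Ω hJ).σ a) = s * (2 * Complex.I) ∧
      (pkData J Ω hJ).Om a ((pkData J Ω hJ).σ w) = k * (2 * Complex.I) ∧
      (pkData J Ω hJ).Om a ((pkData J Ω hJ).σ u) = q * (2 * Complex.I) ∧
      (pkData J Ω hJ).Om w ((pkData J Ω hJ).σ w) = r * (2 * Complex.I) ∧
      (pkData J Ω hJ).Om w ((pkData J Ω hJ).σ u) = t * 2 ∧
      (pkData J Ω hJ).Om u ((pkData J Ω hJ).σ u) = l * (2 * Complex.I) := by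
  let J : ComplexStructure g := ⟨standardJ b, standardJ_sq b, h.integrable⟩
  let Ω : SymplecticForm g := ⟨standardForm b s q r t k l, fun x => by
    rw [standardForm_apply]; ring, standardForm_nondegenerate hnd, h.closed h1 h2 h3 h4 h5⟩
  have hJ : IsPseudoKahler J Ω := fun x y => standardForm_standardJ x y
  have hΩ : ∀ x y, Ω.form x y = standardForm b s q r t k l x y := fun _ _ => rfl
  have hJC : ∀ (c : ℂ) (x : g), J.JC (c ⊗ₜ x) = c ⊗ₜ standardJ b x := fun c x => by
    simp [ComplexStructure.JC, J]
  have hJb : standardJ b (b 0) = b 1 ∧ standardJ b (b 1) = -b 0 ∧ standardJ b (b 2) = b 3 ∧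
      standardJ b (b 3) = -b 2 ∧ standardJ b (b 4) = b 5 ∧ standardJ b (b 5) = -b 4 := by
    simp [standardJ_apply]
  have hmem : ∀ x y : g, standardJ b x = y →
      (1 : ℂ) ⊗ₜ[ℝ] x - Complex.I ⊗ₜ y ∈ J.g10.toSubmodule := by
    rintro x y rfl
    rw [J.mem_g10, map_sub, hJC, hJC, standardJ_sq, smul_sub, TensorProduct.smul_tmul',
      TensorProduct.smul_tmul', TensorProduct.tmul_neg, smul_eq_mul, smul_eq_mul, mul_one,
      Complex.I_mul_I, TensorProduct.neg_tmul]
    abel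
  let B := b.baseChange ℂ
  have hB : ∀ (c : ℂ) i, c ⊗ₜ[ℝ] b i = c • B i := fun c i => by
    simp [B, TensorProduct.smul_tmul']
  have hlie : ∀ i j, ⁅b i, b j⁆ = wedge (b.coord 0) (b.coord 1) (b i) (b j) • α • b 3 +
    wedge (b.coord 0) (b.coord 2) (b i) (b j) • (β + δ) • b 4 +
    wedge (b.coord 0) (b.coord 3) (b i) (b j) • β • b 5 +
      wedge (b.coord 1) (b.coord 2) (b i) (b j) • δ • b 5 := fun i j => h _ _
  have hr : ∀ (c : ℂ) (a : ℝ) (x : g), c ⊗ₜ[ℝ] (a • x) = (a : ℂ) • (c ⊗ₜ[ℝ] x) := fun c a x => by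
    rw [TensorProduct.tmul_smul, TensorProduct.smul_tmul', TensorProduct.smul_tmul', smul_eq_mul,
      Complex.real_smul]
  refine ⟨J, Ω, hJ, (1 : ℂ) ⊗ₜ b 0 - Complex.I ⊗ₜ b 1, (1 : ℂ) ⊗ₜ b 2 - Complex.I ⊗ₜ b 3,
    (1 : ℂ) ⊗ₜ b 4 - Complex.I ⊗ₜ b 5, ⟨hmem _ _ hJb.1, hmem _ _ hJb.2.2.1,
    hmem _ _ hJb.2.2.2.2.1, ?_, ?_, ?_, ?_, ?_, ?_, ?_⟩, ?_, ?_, ?_, ?_, ?_, ?_⟩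
  · intro x hx
    replace hx := J.mem_g10.1 hx
    obtain ⟨c, rfl⟩ : ∃ c : Fin 6 → ℂ, x = ∑ i, c i • B i := ⟨B.repr x, (B.sum_repr x).symm⟩
    have hB' : ∀ i, B i = (1 : ℂ) ⊗ₜ b i := fun i => by rw [hB, one_smul]
    have hz := Fintype.linearIndependent_iff.1 B.linearIndependent
      ![Complex.I * c 0 + c 1, Complex.I * c 1 - c 0, Complex.I * c 2 + c 3,
        Complex.I * c 3 - c 2, Complex.I * c 4 + c 5, Complex.I * c 5 - c 4] (by
        rw [← sub_eq_zero] at hx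
        rw [← neg_eq_zero, ← hx]
        simp only [map_add, map_smul, Fin.sum_univ_six, Matrix.cons_val, hB', hJC, hJb]
        simp only [TensorProduct.tmul_neg, hB]
        module)
    -- On the `i`-eigenspace each odd coordinate is `-i` times the preceding even one.
    have z0 : Complex.I * c 0 + c 1 = 0 := hz 0
    have z2 : Complex.I * c 2 + c 3 = 0 := hz 2
    have z4 : Complex.I * c 4 + c 5 = 0 := hz 4
    refine ⟨c 0, c 2, c 4, ?_⟩
    simp only [Fin.sum_univ_six, hB]
    linear_combination (norm := module) z0 • B 1 + z2 • B 3 + z4 • B 5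
  · intro c₁ c₂ c₃ hc
    have := Fintype.linearIndependent_iff.1 B.linearIndependent
      ![c₁, -(c₁ * Complex.I), c₂, -(c₂ * Complex.I), c₃, -(c₃ * Complex.I)] (by
        rw [← hc]
        simp only [hB, Fin.sum_univ_six, Matrix.cons_val]
        module)
    exact ⟨this 0, this 2, this 4⟩
  · refine (lieBilin_sub_sub _ _ _ _).trans ?_
    simp [hlie, wedge, hr, hB, TensorProduct.tmul_add,
      -Complex.coe_smul]
    module
  · refine (congrArg (lieBilin (ℂ ⊗[ℝ] g) _) (conjugation_one_sub_I _ _)).trans ?_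
    refine (lieBilin_add_sub _ _ _ _).trans ?_
    change _ = _ • (_ - conjugation g _)
    rw [conjugation_one_sub_I]
    simp [hlie, wedge, hr, hB, TensorProduct.tmul_add,
      -Complex.coe_smul]
    module
  · refine (congrArg (lieBilin (ℂ ⊗[ℝ] g) _) (conjugation_one_sub_I _ _)).trans ?_
    refine (lieBilin_add_sub _ _ _ _).trans ?_
    change _ = _ + _ • conjugation g _
    rw [conjugation_one_sub_I]
    simp [hlie, wedge, hr, hB, TensorProduct.tmul_sub, -Complex.coe_smul]
    module
  · refine (congrArg (lieBilin (ℂ ⊗[ℝ] g) _) (conjugation_one_sub_I _ _)).trans ?_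
    refine (lieBilin_add_sub _ _ _ _).trans ?_
    simp [hlie, wedge]
  · intro l
    change lieBilin (ℂ ⊗[ℝ] g) _ l = 0
    have hz : ∀ x : g, ⁅b 4, x⁆ = 0 ∧ ⁅b 5, x⁆ = 0 := fun x => by
      simp [h _ x, wedge]
    induction l using TensorProduct.induction_on with
    | zero => simp
    | add x y hx hy => rw [map_add, hx, hy, add_zero]
    | tmul c x => simp [lieBilin_tmul, hz]
  all_goals
    refine (congrArg (Ω.formC _) (conjugation_one_sub_I _ _)).trans ?_
    rw [formC_add_sub]
    simp [hΩ, standardForm_apply]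
    try ring

end Standard

end WeakSelfMirror

/-! ### Existence for the five algebras -/

namespace WeakSelfMirror

section StructureConstants

variable {g : Type*} [LieRing g] [LieAlgebra ℝ g]

/-- The brackets of a basis with given structure equations. -/
theorem lie_of_structureEquations {c : Fin 6 → g → g → ℝ}
    {e : Module.Basis (Fin 6) ℝ g} (h : ∀ k x y, -e.coord k ⁅x, y⁆ = c k x y) (x y : g) :
    ⁅x, y⁆ = ∑ k, (-c k x y) • e k := by
  conv_lhs => rw [← e.sum_repr ⁅x, y⁆]
  exact Finset.sum_congr rfl fun k _ => by rw [← h, neg_neg, Module.Basis.coord_apply]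

theorem isStandard_of_span {e : Module.Basis (Fin 6) ℝ g} {α β δ : ℝ} (v : Fin 6 → g)
    (hv : ∀ x : Fin 6 → ℝ, ∃ c : Fin 6 → ℝ, ∑ i, x i • e i = ∑ i, c i • v i)
    (h5 : ∀ l : g, ⁅v 5, l⁆ = 0) (h4 : ∀ l : g, ⁅l, v 4⁆ = 0) (h01 : ⁅v 0, v 1⁆ = α • v 3)
    (h02 : ⁅v 0, v 2⁆ = (β + δ) • v 4) (h03 : ⁅v 0, v 3⁆ = β • v 5)
    (h12 : ⁅v 1, v 2⁆ = δ • v 5) (h13 : ⁅v 1, v 3⁆ = 0) (h23 : ⁅v 2, v 3⁆ = 0) :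
    ∃ b : Module.Basis (Fin 6) ℝ g, IsStandard b α β δ := by
  obtain ⟨b, hb⟩ := exists_basis_of_span
    (by rw [Module.finrank_eq_card_basis e, Fintype.card_fin]) v fun x => by
      obtain ⟨c, hc⟩ := hv (e.repr x)
      exact ⟨c, by rw [← hc, e.sum_repr]⟩
  refine ⟨b, fun x y => ?_⟩
  simp only [← hb] at h5 h4 h01 h02 h03 h12 h13 h23
  rw [lie_eq_of_table b h5 h01 h02 h03 (h4 _) h12 h13 (h4 _) h23 (h4 _) (h4 _) x y, smul_zero,
    add_zero]

end StructureConstants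

section Existence

variable {g : Type*} [LieRing g] [LieAlgebra ℝ g] [FiniteDimensional ℝ g]

/-- A pseudo-Kähler pair with a quasi-isomorphism between its two algebras. -/
def IsWeakSelfMirror (g : Type*) [LieRing g] [LieAlgebra ℝ g] [FiniteDimensional ℝ g] : Prop :=
  ∃ (J : ComplexStructure g) (Ω : SymplecticForm g), IsPseudoKahler J Ω ∧
    ∃ φ : ExteriorDGA.Hom J.dga Ω.dga, φ.IsQuasiIso

theorem isWeakSelfMirror_of_selfMirror {J : ComplexStructure g} {Ω : SymplecticForm g}
    {h : IsPseudoKahler J Ω} (M : Nonempty (pkData J Ω h).SelfMirror) : IsWeakSelfMirror g :=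
  M.elim fun M => ⟨J, Ω, h, exists_quasiIso_of_selfMirror J Ω h M⟩

variable {b : Module.Basis (Fin 6) ℝ g}

theorem IsStandard.isWeakSelfMirror_h10 (h : IsStandard b 1 1 0) : IsWeakSelfMirror g := by
  -- With `q = 1`, the value `r = -1` solves the closedness condition `α * r + (β + 2 * δ) * q = 0`.
  obtain ⟨J, Ω, hJ, a, w, u, F, hs, hk, hq, hr, ht, hl⟩ := h.exists_adaptedFrame (s := 0) (q := 1)
    (r := -1) (t := 0) (k := 0) (l := 0) (by norm_num) (by simp) (by simp) (by simp) (by simp)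
    (fun x hx => by
      have h0 := hx 0
      have h1 := hx 1
      have h2 := hx 2
      have h3 := hx 3
      have h4 := hx 4
      have h5 := hx 5
      simp [standardForm_apply] at h0 h1 h2 h3 h4 h5
      exact b.ext_elem fun i => by fin_cases i <;> simp [*])
  exact isWeakSelfMirror_of_selfMirror (PKData.AdaptedFrame.selfMirror_h10 (by simpa using F)
    (by simpa using hs) (by simpa using hk) (by simpa using hq) (by simpa using hr)
    (by simpa using ht) (by simpa using hl))

theorem IsStandard.isWeakSelfMirror_h9 (h : IsStandard b (-1) (-1) 1) : IsWeakSelfMirror g := by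
  obtain ⟨J, Ω, hJ, a, w, u, F, hs, hk, hq, hr, ht, hl⟩ := h.exists_adaptedFrame (s := 0) (q := 1)
    (r := 1) (t := 0) (k := 0) (l := 0) (by norm_num) (by simp) (by simp) (by simp) (by simp)
    (fun x hx => by
      have h0 := hx 0
      have h1 := hx 1
      have h2 := hx 2
      have h3 := hx 3
      have h4 := hx 4
      have h5 := hx 5
      simp [standardForm_apply] at h0 h1 h2 h3 h4 h5
      exact b.ext_elem fun i => by fin_cases i <;> simp [*])
  exact isWeakSelfMirror_of_selfMirror (PKData.AdaptedFrame.selfMirror_h9 (by simpa using F)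
    (by simpa using hs) (by simpa using hk) (by simpa using hq) (by simpa using hr)
    (by simpa using ht) (by simpa using hl))

theorem IsStandard.isWeakSelfMirror_h6 (h : IsStandard b 0 1 0) : IsWeakSelfMirror g := by
  obtain ⟨J, Ω, hJ, a, w, u, F, hs, hk, hq, hr, ht, hl⟩ := h.exists_adaptedFrame (s := 1) (q := 0)
    (r := 0) (t := 1) (k := 0) (l := 0) (by norm_num) (by simp) (by simp) (by simp) (by simp)
    (fun x hx => by
      have h0 := hx 0
      have h1 := hx 1
      have h2 := hx 2
      have h3 := hx 3
      have h4 := hx 4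
      have h5 := hx 5
      simp [standardForm_apply] at h0 h1 h2 h3 h4 h5
      exact b.ext_elem fun i => by fin_cases i <;> simp [*])
  exact isWeakSelfMirror_of_selfMirror (PKData.AdaptedFrame.selfMirror_h6 (by simpa using F)
    (by simpa using hs) (by simpa using hk) (by simpa using hq) (by simpa using hr)
    (by simpa using ht) (by simpa using hl))

/-- The parameter `α` is left free so that `α = 0` covers the abelian algebra. For `α ≠ 0`
closedness forces `r = t = 0`, and the entries `k` and `l` make the form nondegenerate. -/
theorem IsStandard.isWeakSelfMirror_h8 {α : ℝ} (h : IsStandard b α 0 0) : IsWeakSelfMirror g := by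
  obtain ⟨J, Ω, hJ, a, w, u, F, hs, hk, hq, hr, ht, hl⟩ := h.exists_adaptedFrame (s := 0) (q := 0)
    (r := 0) (t := 0) (k := 1) (l := 1) (by norm_num) (by simp) (by simp) (by simp) (by simp)
    (fun x hx => by
      have h0 := hx 0
      have h1 := hx 1
      have h2 := hx 2
      have h3 := hx 3
      have h4 := hx 4
      have h5 := hx 5
      simp [standardForm_apply] at h0 h1 h2 h3 h4 h5
      exact b.ext_elem fun i => by fin_cases i <;> simp [*])
  exact isWeakSelfMirror_of_selfMirror (PKData.AdaptedFrame.selfMirror_h8 (p := -α)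
    (by simpa using F) (by simp)
    (by simpa using hs) (by simpa using hk) (by simpa using hq) (by simpa using hr)
    (by simpa using ht) (by simpa using hl))

theorem isWeakSelfMirror_of_structureEquations
    (h : IsH1 g ∨ IsH6 g ∨ IsH8 g ∨ IsH9 g ∨ IsH10 g) : IsWeakSelfMirror g := by
  rcases h with ⟨e, h⟩ | ⟨e, h⟩ | ⟨e, h⟩ | ⟨e, h⟩ | ⟨e, h⟩
  · have hl : ∀ x y : g, ⁅x, y⁆ = 0 := fun x y => by
      rw [lie_of_structureEquations h]
      simp [Fin.sum_univ_six]
    exact IsStandard.isWeakSelfMirror_h8 (b := e) (α := 0) fun x y => by simp [hl]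
  · have hl := lie_of_structureEquations h
    obtain ⟨b, hb⟩ : ∃ b : Module.Basis (Fin 6) ℝ g, IsStandard b 0 1 0 := by
      refine isStandard_of_span (e := e)
        ![e 0, e 3, e 2, e 1, -e 5, -e 4]
        (fun x => ⟨![x 0, x 3, x 2, x 1, -x 5, -x 4], by
          simp only [Fin.sum_univ_six, Matrix.cons_val]; module⟩)
        ?_ ?_ ?_ ?_ ?_ ?_ ?_ ?_ <;>
      simp [hl, Fin.sum_univ_six, wedge]
    exact hb.isWeakSelfMirror_h6
  · have hl := lie_of_structureEquations h
    obtain ⟨b, hb⟩ : ∃ b : Module.Basis (Fin 6) ℝ g, IsStandard b (-1) 0 0 := by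
      refine isStandard_of_span (e := e)
        ![e 0, e 1, e 2, e 5, e 3, e 4]
        (fun x => ⟨![x 0, x 1, x 2, x 5, x 3, x 4], by
          simp only [Fin.sum_univ_six, Matrix.cons_val]; module⟩)
        ?_ ?_ ?_ ?_ ?_ ?_ ?_ ?_ <;>
      simp [hl, Fin.sum_univ_six, wedge]
    exact hb.isWeakSelfMirror_h8
  · have hl := lie_of_structureEquations h
    obtain ⟨b, hb⟩ : ∃ b : Module.Basis (Fin 6) ℝ g, IsStandard b (-1) (-1) 1 := by
      refine isStandard_of_span (e := e)
        -- Since `β + δ = 0`, the fifth vector is not a bracket. It is `e 2`, which enters no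
        -- structure equation.
        ![e 1, e 0, e 3, -e 4, e 2, -e 5]
        (fun x => ⟨![x 1, x 0, x 3, -x 4, x 2, -x 5], by
          simp only [Fin.sum_univ_six, Matrix.cons_val]; module⟩)
        ?_ ?_ ?_ ?_ ?_ ?_ ?_ ?_ <;>
      simp [hl, Fin.sum_univ_six, wedge]
    exact hb.isWeakSelfMirror_h9
  · have hl := lie_of_structureEquations h
    obtain ⟨b, hb⟩ : ∃ b : Module.Basis (Fin 6) ℝ g, IsStandard b 1 1 0 := by
      refine isStandard_of_span (e := e)
        ![e 0, e 1, e 2, -e 3, -e 4, e 5]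
        (fun x => ⟨![x 0, x 1, x 2, -x 3, -x 4, x 5], by
          simp only [Fin.sum_univ_six, Matrix.cons_val]; module⟩)
        ?_ ?_ ?_ ?_ ?_ ?_ ?_ ?_ <;>
      simp [hl, Fin.sum_univ_six, wedge]
    exact hb.isWeakSelfMirror_h10

end Existence

end WeakSelfMirror

theorem mainTheorem1 (g : Type*) [LieRing g] [LieAlgebra ℝ g] [FiniteDimensional ℝ g]
    (hdim : Module.finrank ℝ g = 6) (hnil : LieRing.IsNilpotent g) :
    (∃ (J : WeakSelfMirror.ComplexStructure g) (Ω : WeakSelfMirror.SymplecticForm g),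
        WeakSelfMirror.IsPseudoKahler J Ω ∧
          ∃ φ : WeakSelfMirror.ExteriorDGA.Hom J.dga Ω.dga, φ.IsQuasiIso) ↔
      (WeakSelfMirror.IsH1 g ∨ WeakSelfMirror.IsH6 g ∨ WeakSelfMirror.IsH8 g ∨
        WeakSelfMirror.IsH9 g ∨ WeakSelfMirror.IsH10 g) := by
  constructor
  · rintro ⟨J, Ω, h, φ, hφ⟩
    exact (WeakSelfMirror.exists_selfMirror_of_quasiIso J Ω h φ hφ).elim fun M =>
      M.structureEquations hdim
  · exact WeakSelfMirror.isWeakSelfMirror_of_structureEquations
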